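/- Let $n\ge 0$, let $M=\mathbb{R}\mathrm{P}^n$ with its standard action of $\mathrm{SL}(n+1,\mathbb{R})$, and lift this action canonically to the cotangent bundle $T^*M$. Let $\mathcal{S}(M)=\bigoplus_{k\ge 0}\mathcal{S}_k(M)$ be the space of smooth complex-valued functions on $T^*M$ that are polynomial on the fibres, where $\mathcal{S}_k(M)$ consists of the functions that are homogeneous polynomials of degree $k$ on each fibre; the group acts on $\mathcal{S}(M)$ by $F\mapsto F\circ g^{-1}$. Let $\mathcal{E}=\sum_i\xi_i\,\partial/\partial\xi_i$ be the Euler operator, where $\xi_i$ are the fibre coordinates of $T^*M$, and let $\mathrm{End}(\mathcal{S}(M))$ be the algebra of all $\mathbb{C}$-linear maps $\mathcal{S}(M)\to\mathcal{S}(M)$. Then the commutant of $\mathrm{SL}(n+1,\mathbb{R})$ in $\mathrm{End}(\mathcal{S}(M))$ is generated by $\mathcal{E}$, in the following sense. An operator $A\in\mathrm{End}(\mathcal{S}(M))$ commutes with the action of every $g\in\mathrm{SL}(n+1,\mathbb{R})$ if and only if $A$ is a series in $\mathcal{E}$ convergent on $\mathcal{S}(M)$, that is, there are $a_j\in\mathbb{C}$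 with $(AF)(z)=\sum_{j\ge 0}a_j\,(\mathcal{E}^jF)(z)$ (absolutely convergent) for all $F\in\mathcal{S}(M)$ and $z\in T^*M$. Equivalently, $A$ commutes with the action if and only if there are $c_k\in\mathbb{C}$ such that $AF=c_kF$ for all $k\ge 0$ and $F\in\mathcal{S}_k(M)$. -/

import Mathlib

open scoped Matrix ContDiff

noncomputable section

namespace ProjSymbols

/-! ### The cotangent bundle of real projective space

Let `V = ℝ^(n+1)` and let `π : V ∖ {0} → ℝP^n` be the projection. A covector of `ℝP^n` at the
point `[x]`, pulled back along `π` to the point `x`, is a linear form `ξ` on `V` with `ξ(x) = 0`,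
and every such form arises exactly once. Pulling the same covector back to the representative
`c x` gives `c⁻¹ ξ`. Hence `T*ℝP^n` is the set of pairs `(x, ξ)`, `x ≠ 0`, `ξ(x) = 0`, modulo
`(x, ξ) ∼ (c x, c⁻¹ ξ)`. -/

/-- Pairs `(x, ξ)` of a nonzero vector and a linear form (written as a row of coefficients)
that vanishes on it. -/
abbrev IncidencePair (n : ℕ) : Type :=
  {z : (Fin (n + 1) → ℝ) × (Fin (n + 1) → ℝ) // z.1 ≠ 0 ∧ z.2 ⬝ᵥ z.1 = 0}

/-- `(x, ξ)` and `(c x, c⁻¹ ξ)` are the same covector. -/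
def cotangentSetoid (n : ℕ) : Setoid (IncidencePair n) where
  r z w := ∃ c : ℝ, c ≠ 0 ∧ w.1.1 = c • z.1.1 ∧ w.1.2 = c⁻¹ • z.1.2
  iseqv :=
    { refl := fun z => ⟨1, one_ne_zero, by simp, by simp⟩
      symm := by
        rintro z w ⟨c, hc, h1, h2⟩
        exact ⟨c⁻¹, inv_ne_zero hc, by rw [h1, smul_smul, inv_mul_cancel₀ hc, one_smul],
          by rw [h2, smul_smul, inv_inv, mul_inv_cancel₀ hc, one_smul]⟩
      trans := by
        rintro z w v ⟨c, hc, h1, h2⟩ ⟨d, hd, h3, h4⟩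
        exact ⟨d * c, mul_ne_zero hd hc, by rw [h3, h1, smul_smul],
          by rw [h4, h2, smul_smul, mul_inv]⟩ }

/-- The cotangent bundle `T*ℝP^n`. -/
def CotangentRP (n : ℕ) : Type := Quotient (cotangentSetoid n)

namespace CotangentRP

variable {n : ℕ}

/-- The covector `[x, ξ]` at the point `[x]` of `ℝP^n`. -/
def mk (x ξ : Fin (n + 1) → ℝ) (hx : x ≠ 0) (h : ξ ⬝ᵥ x = 0) : CotangentRP n :=
  Quotient.mk (cotangentSetoid n) ⟨(x, ξ), hx, h⟩

theorem ind {P : CotangentRP n → Prop} (H : ∀ x ξ hx h, P (mk x ξ hx h)) (z : CotangentRP n) :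
    P z := by
  induction z using Quotient.ind with
  | _ a => exact H a.1.1 a.1.2 a.2.1 a.2.2

/-- The projection `T*ℝP^n → ℝP^n`. -/
def proj : CotangentRP n → Projectivization ℝ (Fin (n + 1) → ℝ) :=
  Quotient.lift (s := cotangentSetoid n) (fun z => Projectivization.mk ℝ z.1.1 z.2.1) (by
    rintro z w ⟨c, hc, h1, -⟩
    rw [Projectivization.mk_eq_mk_iff']
    exact ⟨c⁻¹, by rw [h1, smul_smul, inv_mul_cancel₀ hc, one_smul]⟩)

/-- Multiplication by a real number in the fibres: `t · [x, ξ] = [x, t ξ]`. -/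
def fiberScale (t : ℝ) : CotangentRP n → CotangentRP n :=
  Quotient.lift (s := cotangentSetoid n)
    (fun z => mk z.1.1 (t • z.1.2) z.2.1 (by rw [smul_dotProduct, z.2.2, smul_zero])) (by
    rintro z w ⟨c, hc, h1, h2⟩
    exact Quotient.sound (s := cotangentSetoid n)
      ⟨c, hc, h1, by change t • w.1.2 = _; rw [h2, smul_comm]⟩)

theorem fiberScale_mk (t : ℝ) (x ξ : Fin (n + 1) → ℝ) (hx : x ≠ 0) (h : ξ ⬝ᵥ x = 0) :
    fiberScale t (mk x ξ hx h) = mk x (t • ξ) hx (by rw [smul_dotProduct, h, smul_zero]) := rfl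

theorem insertNth_ne_zero (i : Fin (n + 1)) (y : Fin n → ℝ) :
    i.insertNth (α := fun _ => ℝ) 1 y ≠ 0 := fun h => by simpa using congrFun h i

theorem insertNth_dotProduct (i : Fin (n + 1)) (y η : Fin n → ℝ) :
    i.insertNth (α := fun _ => ℝ) (-(η ⬝ᵥ y)) η ⬝ᵥ i.insertNth (α := fun _ => ℝ) 1 y = 0 := by
  simp [dotProduct, Fin.sum_univ_succAbove _ i]

/-- The canonical cotangent coordinates over the affine chart `{x_i ≠ 0}` of `ℝP^n`. The point of
`ℝP^n` with affine coordinates `y` is `[y_0 : … : 1 : … : y_{n-1}]` (with `1` in position `i`);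
`chart i y η` is the covector `∑ j, η_j dy_j` at this point, i.e. the linear form
`ξ` that vanishes on `x` and has the value `η_j` on `∂x/∂y_j`. -/
def chart (i : Fin (n + 1)) (y η : Fin n → ℝ) : CotangentRP n :=
  mk (i.insertNth (α := fun _ => ℝ) 1 y) (i.insertNth (α := fun _ => ℝ) (-(η ⬝ᵥ y)) η)
    (insertNth_ne_zero i y) (insertNth_dotProduct i y η)

end CotangentRP

open CotangentRP

variable {n : ℕ}

theorem mulVec_ne_zero_of_sl (g : Matrix.SpecialLinearGroup (Fin (n + 1)) ℝ)
    {x : Fin (n + 1) → ℝ} (hx : x ≠ 0) : g.1 *ᵥ x ≠ 0 := by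
  intro h
  apply hx
  have h2 : (g⁻¹).1 *ᵥ (g.1 *ᵥ x) = x := by
    rw [Matrix.mulVec_mulVec, ← Matrix.SpecialLinearGroup.coe_mul, inv_mul_cancel]
    simp
  rw [← h2, h, Matrix.mulVec_zero]

theorem dotProduct_sl (g : Matrix.SpecialLinearGroup (Fin (n + 1)) ℝ)
    (x ξ : Fin (n + 1) → ℝ) : (ξ ᵥ* (g⁻¹).1) ⬝ᵥ (g.1 *ᵥ x) = ξ ⬝ᵥ x := by
  rw [Matrix.dotProduct_mulVec, Matrix.vecMul_vecMul, ← Matrix.SpecialLinearGroup.coe_mul,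
    inv_mul_cancel]
  simp

/-- The canonical lift to `T*ℝP^n` of the action of `SL(n+1, ℝ)` on `ℝP^n`: a covector is
transported by the inverse of the cotangent map, `g · [x, ξ] = [g x, ξ ∘ g⁻¹]`. -/
instance : MulAction (Matrix.SpecialLinearGroup (Fin (n + 1)) ℝ) (CotangentRP n) where
  smul g := Quotient.lift (s := cotangentSetoid n)
    (fun z => mk (g.1 *ᵥ z.1.1) (z.1.2 ᵥ* (g⁻¹).1) (mulVec_ne_zero_of_sl g z.2.1)
      ((dotProduct_sl g _ _).trans z.2.2)) (by
    rintro z w ⟨c, hc, h1, h2⟩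
    exact Quotient.sound (s := cotangentSetoid n) ⟨c, hc,
      by change g.1 *ᵥ w.1.1 = _; rw [h1, Matrix.mulVec_smul],
      by change w.1.2 ᵥ* (g⁻¹).1 = _; rw [h2, Matrix.smul_vecMul]⟩)
  one_smul z := by
    induction z using CotangentRP.ind with
    | _ x ξ hx h => exact Quotient.sound (s := cotangentSetoid n) ⟨1, one_ne_zero, by simp, by simp⟩
  mul_smul g g' z := by
    induction z using CotangentRP.ind with
    | _ x ξ hx h =>
      refine Quotient.sound (s := cotangentSetoid n) ⟨1, one_ne_zero, ?_, ?_⟩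
      · simp [Matrix.mulVec_mulVec]
      · simp only [inv_one, one_smul, mul_inv_rev, Matrix.SpecialLinearGroup.coe_mul,
          Matrix.vecMul_vecMul]

theorem smul_mk (g : Matrix.SpecialLinearGroup (Fin (n + 1)) ℝ) (x ξ : Fin (n + 1) → ℝ)
    (hx : x ≠ 0) (h : ξ ⬝ᵥ x = 0) :
    g • mk x ξ hx h = mk (g.1 *ᵥ x) (ξ ᵥ* (g⁻¹).1) (mulVec_ne_zero_of_sl g hx)
      ((dotProduct_sl g _ _).trans h) := rfl

/-- The lifted action covers the action on `ℝP^n`. -/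
theorem proj_smul (g : Matrix.SpecialLinearGroup (Fin (n + 1)) ℝ) (z : CotangentRP n) :
    proj (g • z) = Projectivization.map (Matrix.SpecialLinearGroup.toLin' g).toLinearMap
      (Matrix.SpecialLinearGroup.toLin' g).injective (proj z) := by
  induction z using CotangentRP.ind with
  | _ x ξ hx h => rfl

theorem smul_fiberScale (g : Matrix.SpecialLinearGroup (Fin (n + 1)) ℝ) (t : ℝ)
    (z : CotangentRP n) : g • fiberScale t z = fiberScale t (g • z) := by
  induction z using CotangentRP.ind with
  | _ x ξ hx h => exact Quotient.sound (s := cotangentSetoid n) ⟨1, one_ne_zero, by simp,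
      by simp [Matrix.smul_vecMul]⟩

/-! ### Symbols -/

/-- A complex-valued function on `T*ℝP^n` is smooth if it is smooth in the `n + 1` canonical
coordinate systems. -/
def IsSmooth (F : CotangentRP n → ℂ) : Prop :=
  ∀ i, ContDiff ℝ ∞ (fun p : (Fin n → ℝ) × (Fin n → ℝ) => F (chart i p.1 p.2))

/-- On the fibre `{ξ | ξ(x) = 0}` over each point `[x]`, the function `F` is (the restriction of)
a homogeneous polynomial of degree `k`. -/
def IsFiberHomogeneous (k : ℕ) (F : CotangentRP n → ℂ) : Prop :=
  ∀ (x : Fin (n + 1) → ℝ) (hx : x ≠ 0), ∃ p : MvPolynomial (Fin (n + 1)) ℂ, p.IsHomogeneous k ∧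
    ∀ (ξ : Fin (n + 1) → ℝ) (h : ξ ⬝ᵥ x = 0),
      F (mk x ξ hx h) = MvPolynomial.eval (fun j => (ξ j : ℂ)) p

/-- The space `S_k(M)`, `M = ℝP^n`: smooth complex-valued functions on `T*M` that are homogeneous
polynomials of degree `k` on the fibres. -/
def symbolsOfDegree (n k : ℕ) : Submodule ℂ (CotangentRP n → ℂ) where
  carrier := {F | IsSmooth F ∧ IsFiberHomogeneous k F}
  zero_mem' := ⟨fun _ => contDiff_const, fun _ _ =>
    ⟨0, MvPolynomial.isHomogeneous_zero _ _ _, fun _ _ => by simp⟩⟩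
  add_mem' := by
    rintro F G ⟨hF, hF'⟩ ⟨hG, hG'⟩
    refine ⟨fun i => (hF i).add (hG i), fun x hx => ?_⟩
    obtain ⟨p, hp, hp'⟩ := hF' x hx
    obtain ⟨q, hq, hq'⟩ := hG' x hx
    exact ⟨p + q, hp.add hq, fun ξ h => by simp [hp', hq']⟩
  smul_mem' := by
    rintro c F ⟨hF, hF'⟩
    refine ⟨fun i => contDiff_const.mul (hF i), fun x hx => ?_⟩
    obtain ⟨p, hp, hp'⟩ := hF' x hx
    exact ⟨MvPolynomial.C c * p, by simpa using (MvPolynomial.isHomogeneous_C _ c).mul hp,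
      fun ξ h => by simp [hp']⟩

/-- The space of symbols `S(M) = ⊕_k S_k(M)`, `M = ℝP^n`: smooth complex-valued functions on `T*M`
that are polynomial on the fibres. -/
def symbols (n : ℕ) : Submodule ℂ (CotangentRP n → ℂ) := ⨆ k, symbolsOfDegree n k

/-! ### The lifted action on symbols -/

theorem mk_eq_chart (i : Fin (n + 1)) (x ξ : Fin (n + 1) → ℝ) (hx : x ≠ 0) (h : ξ ⬝ᵥ x = 0)
    (hi : x i ≠ 0) :
    mk x ξ hx h = chart i (fun m => x (i.succAbove m) / x i)
      (fun m => x i * ξ (i.succAbove m)) := by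
  refine Quotient.sound (s := cotangentSetoid n) ⟨(x i)⁻¹, inv_ne_zero hi, ?_, ?_⟩
  · ext j
    rcases Fin.eq_self_or_eq_succAbove i j with rfl | ⟨m, rfl⟩
    · simp [hi]
    · simp [div_eq_inv_mul]
  · ext j
    rcases Fin.eq_self_or_eq_succAbove i j with rfl | ⟨m, rfl⟩
    · rw [dotProduct, Fin.sum_univ_succAbove _ j] at h
      simp only [Fin.insertNth_apply_same, dotProduct, Pi.smul_apply, smul_eq_mul, inv_inv]
      have : ∀ m, x j * ξ (j.succAbove m) * (x (j.succAbove m) / x j)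
          = ξ (j.succAbove m) * x (j.succAbove m) := fun m => by field_simp
      simp only [this]
      linarith
    · simp

/-- `F ∘ g⁻¹`. -/
def translate (g : Matrix.SpecialLinearGroup (Fin (n + 1)) ℝ) :
    (CotangentRP n → ℂ) →ₗ[ℂ] (CotangentRP n → ℂ) where
  toFun F z := F (g⁻¹ • z)
  map_add' _ _ := rfl
  map_smul' _ _ := rfl

theorem IsSmooth.comp_smul {F : CotangentRP n → ℂ} (hF : IsSmooth F)
    (g : Matrix.SpecialLinearGroup (Fin (n + 1)) ℝ) : IsSmooth (fun z => F (g • z)) := by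
  intro i
  rw [contDiff_iff_contDiffAt]
  intro p
  let X : (Fin n → ℝ) × (Fin n → ℝ) → Fin (n + 1) → ℝ :=
    fun q => g.1 *ᵥ (i.insertNth (α := fun _ => ℝ) 1 q.1)
  let Ξ : (Fin n → ℝ) × (Fin n → ℝ) → Fin (n + 1) → ℝ :=
    fun q => (i.insertNth (α := fun _ => ℝ) (-(q.2 ⬝ᵥ q.1)) q.2) ᵥ* (g⁻¹).1
  have hX : ContDiff ℝ ∞ X := by
    refine contDiff_pi.2 fun j => ?_
    simp only [X, Matrix.mulVec, dotProduct]
    refine ContDiff.sum fun m _ => contDiff_const.mul ?_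
    rcases Fin.eq_self_or_eq_succAbove i m with rfl | ⟨m, rfl⟩
    · simpa using contDiff_const
    · simp only [Fin.insertNth_apply_succAbove]; fun_prop
  have hΞ : ContDiff ℝ ∞ Ξ := by
    refine contDiff_pi.2 fun j => ?_
    simp only [Ξ, Matrix.vecMul, dotProduct]
    refine ContDiff.sum fun m _ => ContDiff.mul ?_ contDiff_const
    rcases Fin.eq_self_or_eq_succAbove i m with rfl | ⟨m, rfl⟩
    · simp only [Fin.insertNth_apply_same]; fun_prop
    · simp only [Fin.insertNth_apply_succAbove]; fun_prop
  have hX0 : ∀ q, X q ≠ 0 := fun q =>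
    mulVec_ne_zero_of_sl g (insertNth_ne_zero i q.1)
  obtain ⟨j, hj⟩ := Function.ne_iff.1 (hX0 p)
  simp only [Pi.zero_apply] at hj
  have hXj : ContDiff ℝ ∞ (fun q => X q j) := contDiff_pi.1 hX j
  have hev : ∀ᶠ q in nhds p, X q j ≠ 0 := hXj.continuous.continuousAt.eventually_ne hj
  have key : (fun q : (Fin n → ℝ) × (Fin n → ℝ) => F (g • chart i q.1 q.2)) =ᶠ[nhds p]
      (fun q => (fun r : (Fin n → ℝ) × (Fin n → ℝ) => F (chart j r.1 r.2))
        (fun m => X q (j.succAbove m) / X q j, fun m => X q j * Ξ q (j.succAbove m))) := by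
    filter_upwards [hev] with q hq
    exact congrArg F (mk_eq_chart j (X q) (Ξ q) (hX0 q)
      ((dotProduct_sl g _ _).trans (insertNth_dotProduct i q.1 q.2)) hq)
  refine ContDiffAt.congr_of_eventuallyEq ?_ key
  refine (hF j).contDiffAt.comp p (ContDiffAt.prodMk ?_ ?_)
  · exact contDiffAt_pi.2 fun m =>
      ((contDiff_pi.1 hX _).contDiffAt).div hXj.contDiffAt hj
  · exact contDiffAt_pi.2 fun m => (hXj.mul (contDiff_pi.1 hΞ _)).contDiffAt

theorem IsFiberHomogeneous.comp_smul {k : ℕ} {F : CotangentRP n → ℂ}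
    (hF : IsFiberHomogeneous k F) (g : Matrix.SpecialLinearGroup (Fin (n + 1)) ℝ) :
    IsFiberHomogeneous k (fun z => F (g • z)) := by
  intro x hx
  obtain ⟨p, hp, hp'⟩ := hF (g.1 *ᵥ x) (mulVec_ne_zero_of_sl g hx)
  refine ⟨MvPolynomial.aeval (fun j => ∑ m, MvPolynomial.X m *
    MvPolynomial.C (((g⁻¹).1 m j : ℝ) : ℂ)) p, ?_, fun ξ h => ?_⟩
  · have := hp.aeval (n := 1) (fun j : Fin (n + 1) => ∑ m : Fin (n + 1),
      MvPolynomial.X m * MvPolynomial.C (((g⁻¹).1 m j : ℝ) : ℂ)) (fun j =>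
        MvPolynomial.IsHomogeneous.sum _ _ _ fun m _ => by
          simpa using (MvPolynomial.isHomogeneous_X ℂ m).mul
            (MvPolynomial.isHomogeneous_C (Fin (n + 1)) (((g⁻¹).1 m j : ℝ) : ℂ)))
    simpa using this
  · refine (hp' (ξ ᵥ* (g⁻¹).1) ((dotProduct_sl g _ _).trans h)).trans ?_
    rw [← MvPolynomial.coe_aeval_eq_eval, ← MvPolynomial.coe_aeval_eq_eval]
    simp only [RingHom.coe_coe]
    rw [← AlgHom.comp_apply, MvPolynomial.comp_aeval]
    congr 2
    ext j
    simp [Matrix.vecMul, dotProduct]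

theorem translate_mem (g : Matrix.SpecialLinearGroup (Fin (n + 1)) ℝ) :
    ∀ F ∈ symbols n, translate g F ∈ symbols n := by
  change symbols n ≤ (symbols n).comap (translate g)
  refine iSup_le fun k F hF => ?_
  exact Submodule.mem_iSup_of_mem k ⟨hF.1.comp_smul g⁻¹, hF.2.comp_smul g⁻¹⟩

/-- The action of `SL(n+1, ℝ)` on the space of symbols by means of the canonical lift,
`F ↦ F ∘ g⁻¹`. -/
def liftedAction (n : ℕ) :
    Representation ℂ (Matrix.SpecialLinearGroup (Fin (n + 1)) ℝ) (symbols n) where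
  toFun g := (translate g).restrict (translate_mem g)
  map_one' := by
    ext F z
    simp [translate]
  map_mul' g g' := by
    ext F z
    simp [translate, mul_smul]

/-- The commutant of `SL(n+1, ℝ)` in `End(S(M))`: all linear operators on the space of symbols
that commute with the lifted action. -/
def commutant (n : ℕ) : Subalgebra ℂ (Module.End ℂ (symbols n)) :=
  Subalgebra.centralizer ℂ (Set.range (liftedAction n))

/-! ### The Euler operator -/

/-- The Euler operator `ξ_i ∂/∂ξ_i` on functions: the derivative in the direction of the
radial field of the fibres. -/
def eulerFun (F : CotangentRP n → ℂ) (z : CotangentRP n) : ℂ :=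
  deriv (fun t : ℝ => F (fiberScale t z)) 1

/-- In canonical coordinates, the Euler operator is `∑ j, η_j ∂/∂η_j`. -/
theorem eulerFun_chart {F : CotangentRP n → ℂ} (hF : IsSmooth F) (i : Fin (n + 1))
    (y η : Fin n → ℝ) :
    eulerFun F (chart i y η) =
      ∑ j, (η j : ℂ) * fderiv ℝ (fun ζ => F (chart i y ζ)) η (Pi.single j 1) := by
  have h1 : ∀ t : ℝ, fiberScale t (chart i y η) = chart i y (t • η) := fun t =>
    Quotient.sound (s := cotangentSetoid n) ⟨1, one_ne_zero, by simp, by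
      ext j
      rcases Fin.eq_self_or_eq_succAbove i j with rfl | ⟨m, rfl⟩ <;> simp⟩
  have hd : ContDiff ℝ ∞ (fun ζ : Fin n → ℝ => F (chart i y ζ)) :=
    (hF i).comp (contDiff_const.prodMk contDiff_id)
  have hD : HasFDerivAt (fun ζ : Fin n → ℝ => F (chart i y ζ))
      (fderiv ℝ (fun ζ => F (chart i y ζ)) η) ((1 : ℝ) • η) := by
    rw [one_smul]
    exact (hd.differentiable (by simp) η).hasFDerivAt
  have hs : HasDerivAt (fun t : ℝ => t • η) η 1 := by
    simpa using (hasDerivAt_id (1 : ℝ)).smul_const η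
  unfold eulerFun
  simp only [h1]
  refine (hD.comp_hasDerivAt (1 : ℝ) hs).deriv.trans ?_
  have hη : η = ∑ j, η j • Pi.single (M := fun _ => ℝ) j 1 := pi_eq_sum_univ' η
  have h2 : ∀ L : (Fin n → ℝ) →L[ℝ] ℂ, L η = ∑ j, (η j : ℂ) * L (Pi.single j 1) := by
    intro L
    conv_lhs => rw [hη]
    simp [map_sum]
  exact h2 _

theorem fiberScale_of_homogeneous {k : ℕ} {F : CotangentRP n → ℂ} (hF : IsFiberHomogeneous k F)
    (t : ℝ) (z : CotangentRP n) : F (fiberScale t z) = (t : ℂ) ^ k * F z := by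
  induction z using CotangentRP.ind with
  | _ x ξ hx h =>
    obtain ⟨p, hp, hp'⟩ := hF x hx
    rw [fiberScale_mk, hp', hp', MvPolynomial.eval_eq, MvPolynomial.eval_eq, Finset.mul_sum]
    refine Finset.sum_congr rfl fun d hd => ?_
    have hk : ∑ j ∈ d.support, d j = k := by
      rw [← hp (MvPolynomial.mem_support_iff.1 hd), Finsupp.weight_apply]
      simp [Finsupp.sum]
    simp only [Pi.smul_apply, smul_eq_mul, Complex.ofReal_mul, mul_pow, Finset.prod_mul_distrib,
      Finset.prod_pow_eq_pow_sum, hk]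
    ring

theorem hasDerivAt_of_homogeneous {k : ℕ} {F : CotangentRP n → ℂ} (hF : IsFiberHomogeneous k F)
    (z : CotangentRP n) :
    HasDerivAt (fun t : ℝ => F (fiberScale t z)) ((k : ℂ) * F z) 1 := by
  simp only [fiberScale_of_homogeneous hF]
  have := (((hasDerivAt_id (1 : ℝ)).ofReal_comp).pow k).mul_const (F z)
  simpa using this

/-- `E F = k F` for a symbol `F` of degree `k`. -/
theorem eulerFun_of_homogeneous {k : ℕ} {F : CotangentRP n → ℂ} (hF : IsFiberHomogeneous k F) :
    eulerFun F = (k : ℂ) • F :=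
  funext fun z => (hasDerivAt_of_homogeneous hF z).deriv

theorem differentiableAt_fiberScale {F : CotangentRP n → ℂ} (hF : F ∈ symbols n)
    (z : CotangentRP n) : DifferentiableAt ℝ (fun t : ℝ => F (fiberScale t z)) 1 := by
  induction hF using Submodule.iSup_induction' with
  | mem k F hF => exact (hasDerivAt_of_homogeneous hF.2 z).differentiableAt
  | zero => exact differentiableAt_const _
  | add F G _ _ hF hG => exact hF.add hG

theorem eulerFun_add {F G : CotangentRP n → ℂ} (hF : F ∈ symbols n) (hG : G ∈ symbols n) :
    eulerFun (F + G) = eulerFun F + eulerFun G :=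
  funext fun z =>
    deriv_add (differentiableAt_fiberScale hF z) (differentiableAt_fiberScale hG z)

theorem eulerFun_mem {F : CotangentRP n → ℂ} (hF : F ∈ symbols n) : eulerFun F ∈ symbols n := by
  induction hF using Submodule.iSup_induction' with
  | mem k F hF =>
    rw [eulerFun_of_homogeneous hF.2]
    exact Submodule.smul_mem _ _ (Submodule.mem_iSup_of_mem k hF)
  | zero =>
    have : eulerFun (0 : CotangentRP n → ℂ) = 0 := funext fun z => deriv_const _ _
    rw [this]
    exact Submodule.zero_mem _
  | add F G hF hG h1 h2 =>
    rw [eulerFun_add hF hG]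
    exact Submodule.add_mem _ h1 h2

/-- The Euler operator `E = ξ_i ∂/∂ξ_i` as an endomorphism of the space of symbols. -/
def euler (n : ℕ) : Module.End ℂ (symbols n) where
  toFun F := ⟨eulerFun F.1, eulerFun_mem F.2⟩
  map_add' F G := Subtype.ext (eulerFun_add F.2 G.2)
  map_smul' c F := Subtype.ext (funext fun z =>
    deriv_const_mul c (differentiableAt_fiberScale F.2 z))

/-- `A = ∑ j, a_j E^j`, the power series converging on `S(M)`, that is,
`∑ j, a_j (E^j F)(z) = (A F)(z)` for every symbol `F` and every point `z` of `T*M`. -/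
def IsSeriesInEuler (a : PowerSeries ℂ) (A : Module.End ℂ (symbols n)) : Prop :=
  ∀ (F : symbols n) (z : CotangentRP n),
    HasSum (fun j : ℕ => PowerSeries.coeff j a * ((euler n ^ j) F).1 z) ((A F).1 z)

end ProjSymbols

end

/-! The operator `A` is not assumed continuous, local or degree preserving; all of this must come
out of invariance. Let the dimension be at least 1. The real multiples of the single covector dy_0
over [e_0] meet every orbit in T*M, so `A` is determined by the functionals F ↦ (coefficient of t^l
in (AF)(t dy_0)). Each is invariant under the shears e_{i+1} ↦ e_{i+1} + b e_0 and has weight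
(d_0/d_1)^l under positive diagonal matrices (`exists_isBorelEigen`). Everything reduces to showing
that on symbols of degree k such a functional is zero if l ≠ k, and vanishes on the kernel of
evaluation at dy_0 if l = k (`IsBorelEigen.eq_zero`).

Away from [e_0]: in the chart x_{i+1} ≠ 0 a shear translates the coordinate y_0 and a diagonal
matrix halves it. On symbols f(y) η^β the functional becomes a translation invariant functional μ of
test functions f, with weight q = 2^(-l-β_0) under halving. An invariant distribution would be
Lebesgue measure in y_0, which has weight 2 > q. Continuity is replaced by a cohomological equation:
μ factors through periodisation along y_0, halving becomes the transfer operator T of the doubling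
map, and μ ∘ T = q μ. Since T - q is onto for 0 < q ≠ 2 (`PeriodicSmooth.exists_transfer_sub_eq`), μ
= 0. The surjectivity is a Neumann series for q > 2, and differentiation along the period, which
turns T into T/2, brings smaller q to this case. By cutoffs, the functional depends only on the germ
over [e_0].

At [e_0]: the diagonal matrices leave only the monomials y^α η^(α + l e_0), and the linear term in b
of the invariance under shears kills those with α ≠ 0. Hadamard's lemma splits smooth coefficients
into monomials and a remainder of high order at the origin; the remainder is killed by a convergent
series of dilates (`germFunctional_flat`).

Finally, any sequence of eigenvalues c_k is the sequence of values at k of an entire power series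
(`exists_powerSeries_hasSum`), and E acts as k in degree k. -/

/-! ### Parameter integrals, series of dilates and Hadamard's lemma -/

theorem hasFDerivAt_intervalIntegral_of_contDiff {E G : Type*} [NormedAddCommGroup E]
    [NormedSpace ℝ E] [NormedAddCommGroup G] [NormedSpace ℝ G] {a b : ℝ} {g : E × ℝ → G}
    (hg : ContDiff ℝ ∞ g) (x : E) :
    HasFDerivAt (fun x => ∫ t in a..b, g (x, t))
      (∫ t in a..b, (fderiv ℝ g (x, t)).comp (ContinuousLinearMap.inl ℝ E ℝ)) x := by
  let g' : E × ℝ → E →L[ℝ] G := fun p => (fderiv ℝ g p).comp (ContinuousLinearMap.inl ℝ E ℝ)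
  have hg' : ContDiff ℝ ∞ g' :=
    (hg.fderiv_right (m := ∞) (by simp)).clm_comp contDiff_const
  have hder : ∀ t x, HasFDerivAt (fun x => g (x, t)) (g' (x, t)) x := fun t x =>
    ((hg.differentiable (by simp) (x, t)).hasFDerivAt).comp x (hasFDerivAt_prodMk_left x t)
  have hgc : ∀ x, Continuous (fun t => g' (x, t)) := fun x => hg'.continuous.comp (by fun_prop)
  obtain ⟨C, hC⟩ := (isCompact_uIcc (a := a) (b := b)).exists_bound_of_continuousOn
    (f := fun t => g' (x, t)) (hgc x).continuousOn
  have hev : ∀ᶠ y in nhds x, ∀ t ∈ Set.uIcc a b, ‖g' (y, t)‖ < C + 1 := by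
    refine (isCompact_uIcc (a := a) (b := b)).eventually_forall_of_forall_eventually ?_
    intro t ht
    have : ContinuousAt (fun p => ‖g' p‖) (x, t) := hg'.continuous.norm.continuousAt
    exact this.eventually_lt continuousAt_const (lt_of_le_of_lt (hC t ht) (lt_add_one C))
  have hcx : ∀ y, Continuous (fun t => g (y, t)) := fun y => by fun_prop
  refine hasFDerivAt_integral_of_dominated_of_fderiv_le'' (a := a) (b := b)
    (F := fun x t => g (x, t)) (F' := fun x t => g' (x, t)) (bound := fun _ => C + 1)
    hev (Filter.Eventually.of_forall fun y => (hcx y).aestronglyMeasurable)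
    ((hcx x).intervalIntegrable _ _) ?_ ?_ intervalIntegrable_const ?_
  · exact (hgc x).aestronglyMeasurable
  · exact (MeasureTheory.ae_restrict_iff' measurableSet_uIoc).2
      (Filter.Eventually.of_forall fun t ht y hy => (hy t (Set.uIoc_subset_uIcc ht)).le)
  · exact Filter.Eventually.of_forall fun t y hy => hder t y

theorem contDiff_intervalIntegral {E : Type} [NormedAddCommGroup E] [NormedSpace ℝ E]
    {a b : ℝ} {G : Type} [NormedAddCommGroup G] [NormedSpace ℝ G] {g : E × ℝ → G}
    (hg : ContDiff ℝ ∞ g) : ContDiff ℝ ∞ (fun x => ∫ t in a..b, g (x, t)) := by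
  -- The target varies in the induction: the derivative is an integral of the same kind with values
  -- in `E →L[ℝ] G`. This is why `E` and `G` share a universe.
  have key : ∀ m : ℕ, ∀ (G : Type) [NormedAddCommGroup G] [NormedSpace ℝ G] (g : E × ℝ → G),
      ContDiff ℝ ∞ g → ContDiff ℝ m (fun x => ∫ t in a..b, g (x, t)) := by
    intro m
    induction m with
    | zero =>
      intro G _ _ g hg
      exact contDiff_zero.2 (intervalIntegral.continuous_parametric_intervalIntegral_of_continuous'
        (f := fun x t => g (x, t)) hg.continuous a b)
    | succ m ih =>
      intro G _ _ g hg
      have h2 : ContDiff ℝ ((m : WithTop ℕ∞) + 1) (fun x => ∫ t in a..b, g (x, t)) := by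
        rw [contDiff_succ_iff_fderiv]
        refine ⟨fun x => (hasFDerivAt_intervalIntegral_of_contDiff hg x).differentiableAt,
          by simp, ?_⟩
        rw [funext fun x => (hasFDerivAt_intervalIntegral_of_contDiff (a := a) (b := b) hg x).fderiv]
        exact ih _ (fun p => (fderiv ℝ g p).comp (ContinuousLinearMap.inl ℝ E ℝ))
          ((hg.fderiv_right (m := ∞) (by simp)).clm_comp contDiff_const)
      exact_mod_cast h2
  exact contDiff_infty.2 fun m => key m G g hg

theorem norm_iteratedFDeriv_comp_affine_le {E : Type*} [NormedAddCommGroup E] [NormedSpace ℝ E]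
    {f : E → ℂ} (hf : ContDiff ℝ ∞ f) {j : ℕ} {B : ℝ} (hB : ∀ x, ‖iteratedFDeriv ℝ j f x‖ ≤ B)
    (A : E →L[ℝ] E) (v x : E) :
    ‖iteratedFDeriv ℝ j (fun y => f (A y + v)) x‖ ≤ B * ‖A‖ ^ j := by
  have hg : ContDiff ℝ ∞ (fun y => f (y + v)) := hf.comp (contDiff_id.add contDiff_const)
  have h2 := A.iteratedFDeriv_comp_right (f := fun y => f (y + v)) hg x
    (i := j) (by exact_mod_cast le_top)
  change ‖iteratedFDeriv ℝ j ((fun y => f (y + v)) ∘ A) x‖ ≤ _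
  rw [h2]
  refine (ContinuousMultilinearMap.norm_compContinuousLinearMap_le _ _).trans ?_
  rw [Finset.prod_const, Finset.card_univ, Fintype.card_fin, iteratedFDeriv_comp_add_right]
  exact mul_le_mul_of_nonneg_right (hB _) (by positivity)

theorem iteratedFDeriv_const_mul_apply' {E : Type*} [NormedAddCommGroup E] [NormedSpace ℝ E]
    {f : E → ℂ} (hf : ContDiff ℝ ∞ f) (j : ℕ) (c : ℂ) (x : E) :
    iteratedFDeriv ℝ j (fun y => c * f y) x = c • iteratedFDeriv ℝ j f x :=
  iteratedFDeriv_const_smul_apply (𝕜 := ℝ) (i := j) (a := c) (x := x)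
    (f := f) (hf.of_le (by exact_mod_cast le_top)).contDiffAt

/-- A series of dilates of a smooth function all of whose derivatives are bounded. -/
theorem contDiff_tsum_comp_linear {E ι : Type*} [NormedAddCommGroup E] [NormedSpace ℝ E]
    {f : E → ℂ} (hf : ContDiff ℝ ∞ f) (hb : ∀ j : ℕ, ∃ B, ∀ x, ‖iteratedFDeriv ℝ j f x‖ ≤ B)
    {c : ι → ℂ} (hc : Summable fun i => ‖c i‖) (A : ι → E →L[ℝ] E) (hA : ∀ i, ‖A i‖ ≤ 1) :
    ContDiff ℝ ∞ (fun y => ∑' i, c i * f (A i y)) := by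
  choose B hB using hb
  have hv : ∀ i, ContDiff ℝ ∞ (fun y => f (A i y)) := fun i => hf.comp (A i).contDiff
  refine contDiff_tsum (N := ⊤) (v := fun j i => ‖c i‖ * B j) (fun i => contDiff_const.mul (hv i))
    (fun j _ => hc.mul_right _) (fun j i x _ => ?_)
  rw [iteratedFDeriv_const_mul_apply' (hv i), norm_smul]
  refine mul_le_mul_of_nonneg_left ?_ (norm_nonneg _)
  have h := norm_iteratedFDeriv_comp_affine_le hf (hB j) (A i) 0 x
  simp only [add_zero] at h
  exact h.trans (mul_le_of_le_one_right ((norm_nonneg _).trans (hB j x))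
    (pow_le_one₀ (norm_nonneg _) (hA i)))

theorem exists_bound_iteratedFDeriv_of_hasCompactSupport {E : Type*} [NormedAddCommGroup E]
    [NormedSpace ℝ E] {f : E → ℂ} (hf : ContDiff ℝ ∞ f) (hc : HasCompactSupport f) (j : ℕ) :
    ∃ B, ∀ x, ‖iteratedFDeriv ℝ j f x‖ ≤ B :=
  (hc.iteratedFDeriv j).exists_bound_of_continuous
    (hf.continuous_iteratedFDeriv (by exact_mod_cast le_top))

/-- Hadamard's lemma. -/
theorem exists_eq_add_sum_mul {n : ℕ} {f : (Fin n → ℝ) → ℂ} (hf : ContDiff ℝ ∞ f) :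
    ∃ g : Fin n → (Fin n → ℝ) → ℂ, (∀ i, ContDiff ℝ ∞ (g i)) ∧
      ∀ y, f y = f 0 + ∑ i, (y i : ℂ) * g i y := by
  have hd : ContDiff ℝ ∞ (fderiv ℝ f) := hf.fderiv_right (m := ∞) (by simp)
  refine ⟨fun i y => ∫ t in (0 : ℝ)..1, fderiv ℝ f (t • y) (Pi.single i 1), fun i => ?_, fun y => ?_⟩
  · exact contDiff_intervalIntegral (g := fun p : (Fin n → ℝ) × ℝ =>
      fderiv ℝ f (p.2 • p.1) (Pi.single i 1)) (by fun_prop)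
  · have h1 : ∀ t : ℝ, HasDerivAt (fun t : ℝ => f (t • y)) (fderiv ℝ f (t • y) y) t := by
      intro t
      have hs : HasDerivAt (fun t : ℝ => t • y) y t := by
        simpa using (hasDerivAt_id t).smul_const y
      exact ((hf.differentiable (by simp) (t • y)).hasFDerivAt).comp_hasDerivAt t hs
    have hcont : ∀ v : Fin n → ℝ, Continuous fun t : ℝ => fderiv ℝ f (t • y) v := fun v => by
      have := hd.continuous
      fun_prop
    have h2 := intervalIntegral.integral_eq_sub_of_hasDerivAt (a := 0) (b := 1)
      (fun t _ => h1 t) ((hcont y).intervalIntegrable _ _)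
    have h3 : ∀ t : ℝ, fderiv ℝ f (t • y) y
        = ∑ i, (y i : ℂ) * fderiv ℝ f (t • y) (Pi.single i 1) := by
      intro t
      have h4 : ∀ L : (Fin n → ℝ) →L[ℝ] ℂ, L y = ∑ i, (y i : ℂ) * L (Pi.single i 1) := by
        intro L
        conv_lhs => rw [pi_eq_sum_univ' y]
        simp [map_sum]
      exact h4 _
    simp only [h3] at h2
    rw [intervalIntegral.integral_finsetSum
      fun i _ => ((hcont _).const_mul _ |>.intervalIntegrable _ _)] at h2
    simp only [intervalIntegral.integral_const_mul, one_smul, zero_smul] at h2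
    rw [h2]; ring

/-! ### The transfer operator of the doubling map on periodic functions -/

noncomputable section Rigidity

variable {E : Type} [NormedAddCommGroup E] [NormedSpace ℝ E]

/-- The linear map that halves the coordinate `ℓ` along `e`. -/
def halving (ℓ : E →L[ℝ] ℝ) (e : E) : E →L[ℝ] E :=
  ContinuousLinearMap.id ℝ E - (2⁻¹ : ℝ) • ℓ.smulRight e

theorem halving_apply (ℓ : E →L[ℝ] ℝ) (e y : E) : halving ℓ e y = y - (ℓ y / 2) • e := by
  simp [halving, smul_smul, div_eq_inv_mul]

/-- Smooth functions that are periodic along `e`, and compactly supported in the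
complementary directions. -/
structure PeriodicSmooth (ℓ : E →L[ℝ] ℝ) (e : E) (u : E → ℂ) : Prop where
  smooth : ContDiff ℝ ∞ u
  periodic : ∀ y, u (y + e) = u y
  support : ∃ K, IsCompact K ∧ ∀ y, y - ℓ y • e ∉ K → u y = 0

/-- The transfer operator of the doubling map. -/
def transfer (ℓ : E →L[ℝ] ℝ) (e : E) (u : E → ℂ) (y : E) : ℂ :=
  u (halving ℓ e y) + u (halving ℓ e y + (2⁻¹ : ℝ) • e)

/-- The mean over a period. -/
def periodMean (e : E) (u : E → ℂ) (y : E) : ℂ := ∫ t in (0 : ℝ)..1, u (y + t • e)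

/-- A primitive of `u - periodMean u`. -/
def periodPrimitive (e : E) (u : E → ℂ) (y : E) : ℂ :=
  ∫ t in (0 : ℝ)..1, ((t - 2⁻¹ : ℝ) : ℂ) * u (y + t • e)

variable {ℓ : E →L[ℝ] ℝ} {e : E} {u v : E → ℂ}

theorem halving_add_smul (he : ℓ e = 1) (y : E) (t : ℝ) :
    halving ℓ e (y + t • e) = halving ℓ e y + (t / 2) • e := by
  simp only [halving_apply, map_add, map_smul, he]
  module

theorem transverse_add_smul (he : ℓ e = 1) (y : E) (t : ℝ) :
    (y + t • e) - ℓ (y + t • e) • e = y - ℓ y • e := by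
  simp only [map_add, map_smul, he, smul_eq_mul, mul_one]
  module

theorem transverse_halving (he : ℓ e = 1) (y : E) :
    halving ℓ e y - ℓ (halving ℓ e y) • e = y - ℓ y • e := by
  simp only [halving_apply, map_sub, map_smul, he, smul_eq_mul, mul_one]
  module

namespace PeriodicSmooth

theorem add (hu : PeriodicSmooth ℓ e u) (hv : PeriodicSmooth ℓ e v) :
    PeriodicSmooth ℓ e (fun y => u y + v y) := by
  obtain ⟨K, hK, hK'⟩ := hu.support
  obtain ⟨K₂, hK₂, hK₂'⟩ := hv.support
  refine ⟨hu.smooth.add hv.smooth, fun y => by rw [hu.periodic, hv.periodic], K ∪ K₂, hK.union hK₂,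
    fun y hy => ?_⟩
  rw [hK' y fun h => hy (Or.inl h), hK₂' y fun h => hy (Or.inr h), add_zero]

theorem const_mul (hu : PeriodicSmooth ℓ e u) (c : ℂ) :
    PeriodicSmooth ℓ e (fun y => c * u y) := by
  obtain ⟨K, hK, hK'⟩ := hu.support
  exact ⟨contDiff_const.mul hu.smooth, fun y => by rw [hu.periodic], K, hK,
    fun y hy => by rw [hK' y hy, mul_zero]⟩

theorem sub (hu : PeriodicSmooth ℓ e u) (hv : PeriodicSmooth ℓ e v) :
    PeriodicSmooth ℓ e (fun y => u y - v y) := by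
  simpa [sub_eq_add_neg] using hu.add (hv.const_mul (-1))

theorem transfer (he : ℓ e = 1) (hu : PeriodicSmooth ℓ e u) :
    PeriodicSmooth ℓ e (transfer ℓ e u) := by
  obtain ⟨K, hK, hK'⟩ := hu.support
  refine ⟨(hu.smooth.comp (halving ℓ e).contDiff).add
    (hu.smooth.comp ((halving ℓ e).contDiff.add contDiff_const)), fun y => ?_, K, hK, fun y hy => ?_⟩
  · have h1 := halving_add_smul he y 1
    rw [one_smul] at h1
    simp only [_root_.transfer]
    rw [h1, add_assoc, ← add_smul, add_comm]
    have : (1 / 2 + 2⁻¹ : ℝ) = 1 := by norm_num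
    rw [this, one_smul, hu.periodic, one_div]
  · rw [_root_.transfer, hK' _ (by rwa [transverse_halving he]),
      hK' _ (by rwa [transverse_add_smul he, transverse_halving he]), add_zero]

theorem integral (he : ℓ e = 1) (hu : PeriodicSmooth ℓ e u) {k : ℝ → ℂ} (hk : ContDiff ℝ ∞ k) :
    PeriodicSmooth ℓ e (fun y => ∫ t in (0 : ℝ)..1, k t * u (y + t • e)) := by
  obtain ⟨K, hK, hK'⟩ := hu.support
  have hs := hu.smooth
  refine ⟨contDiff_intervalIntegral (g := fun p : E × ℝ => k p.2 * u (p.1 + p.2 • e))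
    (by fun_prop), fun y => ?_, K, hK, fun y hy => ?_⟩
  · congr 1
    ext t
    rw [add_right_comm, hu.periodic]
  · have : ∀ t : ℝ, u (y + t • e) = 0 := fun t => hK' _ (by rwa [transverse_add_smul he])
    simp [this]

theorem periodMean (he : ℓ e = 1) (hu : PeriodicSmooth ℓ e u) :
    PeriodicSmooth ℓ e (periodMean e u) := by
  have := hu.integral he (k := fun _ => 1) contDiff_const
  simp only [one_mul] at this
  exact this

theorem periodPrimitive (he : ℓ e = 1) (hu : PeriodicSmooth ℓ e u) :
    PeriodicSmooth ℓ e (periodPrimitive e u) :=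
  hu.integral he (k := fun t => ((t - 2⁻¹ : ℝ) : ℂ))
    (Complex.ofRealCLM.contDiff.comp (contDiff_id.sub contDiff_const))

theorem fderiv (hu : PeriodicSmooth ℓ e u) :
    PeriodicSmooth ℓ e (fun y => fderiv ℝ u y e) := by
  obtain ⟨K, hK, hK'⟩ := hu.support
  refine ⟨(hu.smooth.fderiv_right (m := ∞) (by simp)).clm_apply contDiff_const, fun y => ?_, K, hK,
    fun y hy => ?_⟩
  · rw [← fderiv_comp_add_right]
    simp only [hu.periodic]
  · have hopen : IsOpen {y : E | y - ℓ y • e ∉ K} :=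
      hK.isClosed.isOpen_compl.preimage (by fun_prop : Continuous fun y : E => y - ℓ y • e)
    have : u =ᶠ[nhds y] fun _ => 0 := by
      filter_upwards [hopen.mem_nhds hy] with z hz using hK' z hz
    rw [this.fderiv_eq]
    simp

theorem hasDerivAt (hu : PeriodicSmooth ℓ e u) (y : E) (t : ℝ) :
    HasDerivAt (fun t : ℝ => u (y + t • e)) (_root_.fderiv ℝ u (y + t • e) e) t := by
  have h1 : HasDerivAt (fun t : ℝ => y + t • e) e t := by
    simpa using ((hasDerivAt_id t).smul_const e).const_add y
  exact ((hu.smooth.differentiable (by simp) _).hasFDerivAt).comp_hasDerivAt t h1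

theorem continuous_line (hu : PeriodicSmooth ℓ e u) (y : E) :
    Continuous (fun t : ℝ => u (y + t • e)) :=
  hu.smooth.continuous.comp (by fun_prop)

theorem periodMean_fderiv (hu : PeriodicSmooth ℓ e u) (y : E) :
    _root_.periodMean e (fun y => _root_.fderiv ℝ u y e) y = 0 := by
  rw [_root_.periodMean, intervalIntegral.integral_eq_sub_of_hasDerivAt
    (fun t _ => hu.hasDerivAt y t) (((hu.fderiv).continuous_line y).intervalIntegrable _ _)]
  simp [hu.periodic]

/-- Integration by parts: the kernel t - 1/2 takes the values -1/2 and 1/2 at the ends of the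
period, so the boundary terms add up to u(y), and its derivative 1 produces the mean. -/
theorem fderiv_periodPrimitive (hu : PeriodicSmooth ℓ e u) (y : E) :
    _root_.fderiv ℝ (_root_.periodPrimitive e u) y e = u y - _root_.periodMean e u y := by
  have hs := hu.smooth
  have hg : ContDiff ℝ ∞ (fun p : E × ℝ => ((p.2 - 2⁻¹ : ℝ) : ℂ) * u (p.1 + p.2 • e)) :=
    (Complex.ofRealCLM.contDiff.comp (contDiff_snd.sub contDiff_const)).mul (by fun_prop)
  have h1 := hasFDerivAt_intervalIntegral_of_contDiff (a := 0) (b := 1) hg y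
  have hc : Continuous fun t : ℝ => (_root_.fderiv ℝ (fun p : E × ℝ =>
      ((p.2 - 2⁻¹ : ℝ) : ℂ) * u (p.1 + p.2 • e)) (y, t)).comp (ContinuousLinearMap.inl ℝ E ℝ) :=
    ((hg.fderiv_right (m := ∞) (by simp)).clm_comp contDiff_const).continuous.comp
      (Continuous.prodMk_right y)
  have h2 : ∀ t : ℝ, (_root_.fderiv ℝ (fun p : E × ℝ =>
      ((p.2 - 2⁻¹ : ℝ) : ℂ) * u (p.1 + p.2 • e)) (y, t)).comp (ContinuousLinearMap.inl ℝ E ℝ) e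
      = ((t - 2⁻¹ : ℝ) : ℂ) * _root_.fderiv ℝ u (y + t • e) e := by
    intro t
    have h3 := HasFDerivAt.comp (f := fun z : E => (z, t)) y
      ((hg.differentiable (by simp) (y, t)).hasFDerivAt) (hasFDerivAt_prodMk_left y t)
    have h4 : HasFDerivAt (fun z : E => u (z + t • e)) (_root_.fderiv ℝ u (y + t • e)) y :=
      (hasFDerivAt_comp_add_right (t • e)).2 (hs.differentiable (by simp) _).hasFDerivAt
    have h5 := h3.unique (h4.const_mul ((t - 2⁻¹ : ℝ) : ℂ))
    rw [h5]
    simp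
  rw [show _root_.fderiv ℝ (_root_.periodPrimitive e u) y = _ from h1.fderiv,
    ContinuousLinearMap.intervalIntegral_apply (hc.intervalIntegrable _ _)]
  simp only [h2]
  have hk : ∀ t : ℝ, HasDerivAt (fun t : ℝ => ((t - 2⁻¹ : ℝ) : ℂ)) 1 t := fun t => by
    simpa using ((hasDerivAt_id t).sub_const (2⁻¹ : ℝ)).ofReal_comp
  rw [intervalIntegral.integral_mul_deriv_eq_deriv_mul (fun t _ => hk t)
    (fun t _ => hu.hasDerivAt y t) intervalIntegrable_const
    (((hu.fderiv).continuous_line y).intervalIntegrable _ _)]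
  simp only [one_smul, zero_smul, add_zero, hu.periodic, one_mul, _root_.periodMean]
  push_cast
  ring

theorem periodMean_add_smul (hu : PeriodicSmooth ℓ e u) (y : E) (s : ℝ) :
    _root_.periodMean e u (y + s • e) = _root_.periodMean e u y := by
  have hp : Function.Periodic (fun t : ℝ => u (y + t • e)) 1 := fun t => by
    simp only [add_smul, one_smul, ← add_assoc, hu.periodic]
  have h1 := hp.intervalIntegral_add_eq s 0
  have h2 := intervalIntegral.integral_comp_add_right (a := 0) (b := 1)
    (fun t : ℝ => u (y + t • e)) s
  rw [zero_add, add_comm 1 s] at h2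
  rw [zero_add] at h1
  simp only [_root_.periodMean]
  rw [← h1, ← h2]
  congr 1
  ext t
  rw [add_smul, add_comm (t • e), add_assoc]

/-- The two branches of the transfer operator sweep the first and the second half of the period at
half speed, whence the factor 2. -/
theorem periodMean_transfer (he : ℓ e = 1) (hu : PeriodicSmooth ℓ e u) (y : E) :
    _root_.periodMean e (_root_.transfer ℓ e u) y = 2 * _root_.periodMean e u y := by
  have hc := hu.continuous_line (halving ℓ e y)
  have h0 : _root_.periodMean e u y = _root_.periodMean e u (halving ℓ e y) := by
    rw [halving_apply, sub_eq_add_neg, ← neg_smul, hu.periodMean_add_smul]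
  have h1 : ∀ t : ℝ, _root_.transfer ℓ e u (y + t • e)
      = u (halving ℓ e y + (t / 2) • e) + u (halving ℓ e y + (t / 2 + 2⁻¹) • e) := fun t => by
    rw [_root_.transfer, halving_add_smul he, add_assoc, ← add_smul]
  rw [h0]
  simp only [_root_.periodMean, h1]
  have hc1 : Continuous fun t : ℝ => u (halving ℓ e y + (t / 2) • e) := by
    have := hu.smooth.continuous
    fun_prop
  have hc2 : Continuous fun t : ℝ => u (halving ℓ e y + (t / 2 + 2⁻¹) • e) := by
    have := hu.smooth.continuous
    fun_prop
  rw [intervalIntegral.integral_add (hc1.intervalIntegrable _ _) (hc2.intervalIntegrable _ _),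
    intervalIntegral.integral_comp_div (fun t : ℝ => u (halving ℓ e y + t • e)) two_ne_zero,
    intervalIntegral.integral_comp_div_add (fun t : ℝ => u (halving ℓ e y + t • e)) two_ne_zero,
    ← smul_add]
  norm_num only
  rw [intervalIntegral.integral_add_adjacent_intervals (hc.intervalIntegrable _ _)
    (hc.intervalIntegrable _ _)]
  simp

/-- Halving maps e to e/2. This commutation rule is what exchanges the eigenvalue q for 2q in
`exists_transfer_sub_eq_of_double`. -/
theorem fderiv_transfer (he : ℓ e = 1) (hu : PeriodicSmooth ℓ e u) (y : E) :
    _root_.fderiv ℝ (_root_.transfer ℓ e u) y e =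
      2⁻¹ * _root_.transfer ℓ e (fun y => _root_.fderiv ℝ u y e) y := by
  have hH : halving ℓ e e = (2⁻¹ : ℝ) • e := by
    rw [halving_apply, he]; module
  have h1 : HasFDerivAt (fun y => u (halving ℓ e y))
      ((_root_.fderiv ℝ u (halving ℓ e y)).comp (halving ℓ e)) y :=
    ((hu.smooth.differentiable (by simp) _).hasFDerivAt).comp y (halving ℓ e).hasFDerivAt
  have h2 : HasFDerivAt (fun y => u (halving ℓ e y + (2⁻¹ : ℝ) • e))
      ((_root_.fderiv ℝ u (halving ℓ e y + (2⁻¹ : ℝ) • e)).comp (halving ℓ e)) y :=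
    ((hu.smooth.differentiable (by simp) _).hasFDerivAt).comp y
      ((halving ℓ e).hasFDerivAt.add_const _)
  have h3 : HasFDerivAt (_root_.transfer ℓ e u) _ y := h1.add h2
  rw [h3.fderiv]
  simp [hH, _root_.transfer, mul_add]

/-- Modulo the period, the support lies in the compact image of K × [0, 1]. The uniform bounds make
the Neumann series converge with all its derivatives. -/
theorem exists_bound_iteratedFDeriv (hu : PeriodicSmooth ℓ e u) (j : ℕ) :
    ∃ B, ∀ y, ‖iteratedFDeriv ℝ j u y‖ ≤ B := by
  obtain ⟨K, hK, hK'⟩ := hu.support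
  have hcont : Continuous (iteratedFDeriv ℝ j u) :=
    hu.smooth.continuous_iteratedFDeriv (by exact_mod_cast le_top)
  have hS : IsCompact ((fun p : E × ℝ => p.1 + p.2 • e) '' (K ×ˢ Set.Icc (0 : ℝ) 1)) :=
    (hK.prod isCompact_Icc).image (by fun_prop)
  obtain ⟨B, hB⟩ := hS.exists_bound_of_continuousOn hcont.continuousOn
  have hper : ∀ y, iteratedFDeriv ℝ j u (y + e) = iteratedFDeriv ℝ j u y := fun y => by
    rw [← iteratedFDeriv_comp_add_right]
    simp only [hu.periodic]
  have hper' : ∀ y, Function.Periodic (fun t : ℝ => iteratedFDeriv ℝ j u (y + t • e)) 1 :=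
    fun y t => by simp only [add_smul, one_smul, ← add_assoc, hper]
  refine ⟨max B 0, fun y => ?_⟩
  by_cases hy : y - ℓ y • e ∈ K
  · have h1 : iteratedFDeriv ℝ j u y
        = iteratedFDeriv ℝ j u (y - ℓ y • e + Int.fract (ℓ y) • e) := by
      have := (hper' y).sub_zsmul_eq ⌊ℓ y⌋ (x := 0)
      simp only [zero_smul, add_zero] at this
      rw [← this]
      congr 1
      rw [Int.fract]
      simp only [zsmul_eq_mul, mul_one]
      module
    rw [h1]
    exact (hB _ ⟨(_, _), ⟨hy, Int.fract_nonneg _, (Int.fract_lt_one _).le⟩, rfl⟩).trans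
      (le_max_left _ _)
  · have hopen : IsOpen {y : E | y - ℓ y • e ∉ K} :=
      hK.isClosed.isOpen_compl.preimage (by fun_prop : Continuous fun y : E => y - ℓ y • e)
    have : u =ᶠ[nhds y] fun _ => 0 := by
      filter_upwards [hopen.mem_nhds hy] with z hz using hK' z hz
    rw [(this.iteratedFDeriv ℝ j).eq_of_nhds]
    simp

end PeriodicSmooth

end Rigidity

/-! ### Surjectivity of the transfer operator minus a scalar -/

noncomputable section RigidFunctionals

variable {E : Type} [NormedAddCommGroup E] [NormedSpace ℝ E] {ℓ : E →L[ℝ] ℝ} {e : E} {u : E → ℂ}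

namespace PeriodicSmooth

theorem iterate_transfer (he : ℓ e = 1) (hu : PeriodicSmooth ℓ e u) (i : ℕ) :
    PeriodicSmooth ℓ e ((_root_.transfer ℓ e)^[i] u) := by
  induction i with
  | zero => exact hu
  | succ i ih => rw [Function.iterate_succ_apply']; exact ih.transfer he

/-- Each branch is a composition with an affine contraction, which does not increase the supremum of
any derivative; there are two branches. -/
theorem norm_iteratedFDeriv_iterate_transfer_le (he : ℓ e = 1) (hH : ‖halving ℓ e‖ ≤ 1)
    (hu : PeriodicSmooth ℓ e u) {j : ℕ} {B : ℝ} (hB : ∀ y, ‖iteratedFDeriv ℝ j u y‖ ≤ B) (i : ℕ)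
    (y : E) : ‖iteratedFDeriv ℝ j ((_root_.transfer ℓ e)^[i] u) y‖ ≤ 2 ^ i * B := by
  induction i generalizing y with
  | zero => simpa using hB y
  | succ i ih =>
    rw [Function.iterate_succ_apply']
    have hw := (hu.iterate_transfer he i).smooth
    set w := (_root_.transfer ℓ e)^[i] u
    have hB0 : 0 ≤ 2 ^ i * B := (norm_nonneg _).trans (ih y)
    have h1 : ∀ v, ‖iteratedFDeriv ℝ j (fun y => w (halving ℓ e y + v)) y‖ ≤ 2 ^ i * B := fun v =>
      (norm_iteratedFDeriv_comp_affine_le hw ih _ v y).trans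
        (mul_le_of_le_one_right hB0 (pow_le_one₀ (norm_nonneg _) hH))
    have hc : ∀ v, ContDiff ℝ j (fun y => w (halving ℓ e y + v)) := fun v =>
      (hw.comp ((halving ℓ e).contDiff.add contDiff_const)).of_le (by exact_mod_cast le_top)
    have h2 : _root_.transfer ℓ e w = (fun y => w (halving ℓ e y + 0)) +
        (fun y => w (halving ℓ e y + (2⁻¹ : ℝ) • e)) := by
      ext y; simp [_root_.transfer]
    rw [h2, iteratedFDeriv_add_apply (hc _).contDiffAt (hc _).contDiffAt]
    calc _ ≤ 2 ^ i * B + 2 ^ i * B := (norm_add_le _ _).trans (add_le_add (h1 _) (h1 _))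
      _ = 2 ^ (i + 1) * B := by ring

/-- The transfer operator has norm at most `2`, so that `transfer - q` is invertible for
`q > 2`. -/
theorem exists_transfer_sub_eq_of_two_lt (he : ℓ e = 1) (hH : ‖halving ℓ e‖ ≤ 1)
    (hu : PeriodicSmooth ℓ e u) {q : ℝ} (hq : 2 < q) :
    ∃ v, PeriodicSmooth ℓ e v ∧ ∀ y, _root_.transfer ℓ e v y - q * v y = u y := by
  have hq0 : 0 < q := by linarith
  have hqc : (q : ℂ) ≠ 0 := by exact_mod_cast hq0.ne'
  let W : ℕ → E → ℂ := fun i => (_root_.transfer ℓ e)^[i] u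
  have hW : ∀ i, PeriodicSmooth ℓ e (W i) := fun i => hu.iterate_transfer he i
  choose B hB using fun j => hu.exists_bound_iteratedFDeriv j
  have hWB : ∀ j i y, ‖iteratedFDeriv ℝ j (W i) y‖ ≤ 2 ^ i * B j := fun j i y =>
    hu.norm_iteratedFDeriv_iterate_transfer_le he hH (hB j) i y
  -- The Neumann series (T - q)⁻¹ = -∑ q^(-i-1) T^i; the sign stands outside the power.
  let c : ℕ → ℂ := fun i => -((q : ℂ)⁻¹) ^ (i + 1)
  have hcn : ∀ i, ‖c i‖ = q⁻¹ ^ (i + 1) := fun i => by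
    simp [c, abs_of_pos hq0]
  have hsum : ∀ j, Summable fun i => ‖c i‖ * (2 ^ i * B j) := by
    intro j
    have h1 : Summable fun i : ℕ => (2 * q⁻¹) ^ i :=
      summable_geometric_of_lt_one (by positivity) (by rw [← div_eq_mul_inv, div_lt_one hq0]; exact hq)
    refine (h1.mul_right (q⁻¹ * B j)).congr fun i => ?_
    rw [hcn, mul_pow, pow_succ]; ring
  have hs : ∀ y, Summable fun i => c i * W i y := by
    intro y
    refine Summable.of_norm_bounded (hsum 0) fun i => ?_
    rw [norm_mul]
    have := hWB 0 i y
    rw [norm_iteratedFDeriv_zero] at this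
    exact mul_le_mul_of_nonneg_left this (norm_nonneg _)
  refine ⟨fun y => ∑' i, c i * W i y, ⟨?_, fun y => ?_, ?_⟩, fun y => ?_⟩
  · refine contDiff_tsum (N := ⊤) (v := fun j i => ‖c i‖ * (2 ^ i * B j))
      (fun i => contDiff_const.mul (hW i).smooth) (fun j _ => hsum j) (fun j i x _ => ?_)
    rw [iteratedFDeriv_const_mul_apply' (hW i).smooth, norm_smul]
    exact mul_le_mul_of_nonneg_left (hWB j i x) (norm_nonneg _)
  · simp only [(hW _).periodic]
  · obtain ⟨K, hK, hK'⟩ := hu.support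
    have h : ∀ i y, y - ℓ y • e ∉ K → W i y = 0 := by
      intro i
      induction i with
      | zero => exact hK'
      | succ i ih =>
        intro y hy
        simp only [W, Function.iterate_succ_apply']
        change _root_.transfer ℓ e (W i) y = 0
        rw [_root_.transfer, ih _ (by rwa [transverse_halving he]),
          ih _ (by rwa [transverse_add_smul he, transverse_halving he]), add_zero]
    exact ⟨K, hK, fun y hy => by simp [h _ y hy]⟩
  · have hT : _root_.transfer ℓ e (fun y => ∑' i, c i * W i y) y = ∑' i, c i * W (i + 1) y := by
      simp only [_root_.transfer]
      rw [← (hs _).tsum_add (hs _)]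
      congr 1
      ext i
      simp only [W, Function.iterate_succ_apply', _root_.transfer]
      ring
    have h0 : ∑' i, c i * W i y = c 0 * W 0 y + ∑' i, c (i + 1) * W (i + 1) y :=
      (hs y).tsum_eq_zero_add
    simp only [hT]
    rw [h0, mul_add, ← tsum_mul_left]
    have h1 : ∀ i, (q : ℂ) * (c (i + 1) * W (i + 1) y) = c i * W (i + 1) y := fun i => by
      simp only [c, pow_succ]; field_simp
    simp only [h1]
    simp only [c, W, Function.iterate_zero, id]
    linear_combination u y * mul_inv_cancel₀ hqc

theorem eq_of_fderiv_eq_zero (hu : PeriodicSmooth ℓ e u) (h : ∀ y, _root_.fderiv ℝ u y e = 0)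
    (y : E) (t : ℝ) : u (y + t • e) = u y := by
  have h1 := is_const_of_deriv_eq_zero (fun t => (hu.hasDerivAt y t).differentiableAt)
    (fun t => by rw [(hu.hasDerivAt y t).deriv, h]) t 0
  simpa using h1

theorem transfer_eq_two_mul (h : ∀ (y : E) (t : ℝ), u (y + t • e) = u y) (y : E) :
    _root_.transfer ℓ e u y = 2 * u y := by
  rw [_root_.transfer, h, halving_apply, sub_eq_add_neg, ← neg_smul, h, two_mul]

theorem periodMean_sub_mul {a b : E → ℂ} (c d : ℂ) (ha : PeriodicSmooth ℓ e a)
    (hb : PeriodicSmooth ℓ e b) (y : E) :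
    _root_.periodMean e (fun y => c * a y - d * b y) y
      = c * _root_.periodMean e a y - d * _root_.periodMean e b y := by
  have h1 : Continuous fun t : ℝ => c * a (y + t • e) :=
    continuous_const.mul (ha.continuous_line y)
  have h2 : Continuous fun t : ℝ => d * b (y + t • e) :=
    continuous_const.mul (hb.continuous_line y)
  simp only [_root_.periodMean]
  rw [intervalIntegral.integral_sub (h1.intervalIntegrable _ _) (h2.intervalIntegrable _ _),
    intervalIntegral.integral_const_mul, intervalIntegral.integral_const_mul]

/-- The derivative of the equation T v - q v = u along e is (T - 2q) v' = 2u'. A solution V of the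
latter is integrated, after removal of its mean, to J; then T J - q J - u is constant along e, and
on such functions T is multiplication by 2. -/
theorem exists_transfer_sub_eq_of_double (he : ℓ e = 1) {q : ℝ}
    (ih : ∀ u, PeriodicSmooth ℓ e u → (∀ y, _root_.periodMean e u y = 0) →
      ∃ v, PeriodicSmooth ℓ e v ∧ ∀ y, _root_.transfer ℓ e v y - ((2 * q : ℝ) : ℂ) * v y = u y)
    (hu : PeriodicSmooth ℓ e u) (hm : ∀ y, _root_.periodMean e u y = 0) :
    ∃ v, PeriodicSmooth ℓ e v ∧ ∀ y, _root_.transfer ℓ e v y - q * v y = u y := by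
  obtain ⟨V, hV, hVu⟩ := ih _ (hu.fderiv.const_mul 2) (fun y => by
    have := hu.periodMean_fderiv y
    simp only [_root_.periodMean, intervalIntegral.integral_const_mul] at this ⊢
    rw [this, mul_zero])
  -- The mean of T V - 2q V is (2 - 2q) times that of V, and the mean of a derivative is 0. The mean
  -- of V enters the derivative of w only with the factor q - 1, so q = 1 needs no separate
  -- treatment.
  have hVm : ∀ y, ((q : ℂ) - 1) * _root_.periodMean e V y = 0 := by
    intro y
    have h1 := periodMean_sub_mul 1 ((2 * q : ℝ) : ℂ) (hV.transfer he) hV y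
    simp only [one_mul, hVu] at h1
    have h2 := hu.periodMean_fderiv y
    simp only [_root_.periodMean, intervalIntegral.integral_const_mul] at h1 h2
    rw [h2, mul_zero] at h1
    have h3 := hV.periodMean_transfer he y
    simp only [_root_.periodMean] at h3 ⊢
    rw [h3] at h1
    push_cast at h1
    linear_combination (1 / 2 : ℂ) * h1
  have hJ := hV.periodPrimitive he
  set J := _root_.periodPrimitive e V with hJdef
  have hw := ((hJ.transfer he).sub (hJ.const_mul q)).sub hu
  set w : E → ℂ := fun y => _root_.transfer ℓ e J y - q * J y - u y with hwdef
  have hDw : ∀ y, _root_.fderiv ℝ w y e = 0 := by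
    intro y
    have d : ∀ {a : E → ℂ}, PeriodicSmooth ℓ e a → DifferentiableAt ℝ a y := fun ha =>
      ha.smooth.differentiable (by simp) y
    have h1 : _root_.fderiv ℝ w y e = _root_.fderiv ℝ (_root_.transfer ℓ e J) y e
        - q * _root_.fderiv ℝ J y e - _root_.fderiv ℝ u y e := by
      have := (((d (hJ.transfer he)).hasFDerivAt.sub ((d hJ).hasFDerivAt.const_mul (q : ℂ))).sub
        (d hu).hasFDerivAt).fderiv
      rw [show _root_.fderiv ℝ w y = _ from this]
      simp
    have h2 : ∀ y, _root_.fderiv ℝ J y e = V y - _root_.periodMean e V y :=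
      fun y => hV.fderiv_periodPrimitive y
    have h3 := transfer_eq_two_mul (ℓ := ℓ) hV.periodMean_add_smul y
    have h4 := hVu y
    rw [h1, hJ.fderiv_transfer he]
    simp only [h2]
    simp only [_root_.transfer] at h3 h4 ⊢
    push_cast at h4
    linear_combination (1 / 2 : ℂ) * h4 - (1 / 2 : ℂ) * h3 + hVm y
  have hwc := hw.eq_of_fderiv_eq_zero hDw
  -- For q = 2 the constant w cannot be absorbed, but it equals its mean, which is (2 - q) times the
  -- mean of J minus the mean of u, hence 0. For q ≠ 2 subtracting w/(2 - q) from J corrects the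
  -- error.
  by_cases hq : q = 2
  · refine ⟨J, hJ, fun y => ?_⟩
    have h1 : _root_.periodMean e w y = w y := by
      simp [_root_.periodMean, hwc]
    have h2 : _root_.periodMean e w y = 0 := by
      have h3 := periodMean_sub_mul 1 1 ((hJ.transfer he).sub (hJ.const_mul q)) hu y
      have h4 := periodMean_sub_mul 1 q (hJ.transfer he) hJ y
      simp only [one_mul] at h3 h4
      rw [hwdef, h3, h4, hJ.periodMean_transfer he, hm, hq]
      push_cast
      ring
    rw [h2] at h1
    linear_combination -h1
  · have hq' : (2 : ℂ) - q ≠ 0 := sub_ne_zero.2 fun h => hq (by exact_mod_cast h.symm)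
    refine ⟨_, hJ.sub (hw.const_mul (2 - q : ℂ)⁻¹), fun y => ?_⟩
    have h1 := transfer_eq_two_mul (ℓ := ℓ) hwc y
    have h2 : w y = _root_.transfer ℓ e J y - q * J y - u y := rfl
    simp only [_root_.transfer] at h1 h2 ⊢
    have h3 : (2 - q : ℂ)⁻¹ * (2 - q) = 1 := inv_mul_cancel₀ hq'
    linear_combination -h2 - (2 - q : ℂ)⁻¹ * h1 - w y * h3

/-- Doubling q finitely often brings it above 2, where the Neumann series applies. -/
theorem exists_transfer_sub_eq_of_periodMean_eq_zero (he : ℓ e = 1) (hH : ‖halving ℓ e‖ ≤ 1)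
    {q : ℝ} (hq : 0 < q) (hu : PeriodicSmooth ℓ e u) (hm : ∀ y, _root_.periodMean e u y = 0) :
    ∃ v, PeriodicSmooth ℓ e v ∧ ∀ y, _root_.transfer ℓ e v y - q * v y = u y := by
  have key : ∀ N : ℕ, ∀ q : ℝ, 2 < 2 ^ N * q → ∀ u, PeriodicSmooth ℓ e u →
      (∀ y, _root_.periodMean e u y = 0) →
      ∃ v, PeriodicSmooth ℓ e v ∧ ∀ y, _root_.transfer ℓ e v y - q * v y = u y := by
    intro N
    induction N with
    | zero =>
      intro q hq u hu _
      exact hu.exists_transfer_sub_eq_of_two_lt he hH (by simpa using hq)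
    | succ N ih =>
      intro q hq u hu hm
      exact exists_transfer_sub_eq_of_double he (ih (2 * q) (by rw [pow_succ] at hq; linarith)) hu hm
  obtain ⟨N, hN⟩ := pow_unbounded_of_one_lt (2 / q) (one_lt_two : (1 : ℝ) < 2)
  exact key N q (by rwa [div_lt_iff₀ hq] at hN) u hu hm

/-- The mean of u is constant along e, so T - q acts on it as the scalar 2 - q; the rest of u has
mean zero. Here q = 2 is a genuine exception, caused by Lebesgue measure. -/
theorem exists_transfer_sub_eq (he : ℓ e = 1) (hH : ‖halving ℓ e‖ ≤ 1)
    {q : ℝ} (hq : 0 < q) (hq2 : q ≠ 2) (hu : PeriodicSmooth ℓ e u) :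
    ∃ v, PeriodicSmooth ℓ e v ∧ ∀ y, _root_.transfer ℓ e v y - q * v y = u y := by
  have hM := hu.periodMean he
  obtain ⟨v, hv, hvu⟩ := exists_transfer_sub_eq_of_periodMean_eq_zero he hH hq (hu.sub hM)
    (fun y => by
      have h1 := periodMean_sub_mul 1 1 hu hM y
      have h2 : _root_.periodMean e (_root_.periodMean e u) y = _root_.periodMean e u y := by
        rw [_root_.periodMean]
        simp [hu.periodMean_add_smul]
      simp only [one_mul] at h1
      rw [h1, h2, sub_self])
  have hq' : (2 : ℂ) - q ≠ 0 := sub_ne_zero.2 fun h => hq2 (by exact_mod_cast h.symm)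
  refine ⟨_, hv.add (hM.const_mul (2 - q : ℂ)⁻¹), fun y => ?_⟩
  have h1 := transfer_eq_two_mul (ℓ := ℓ) hu.periodMean_add_smul y
  have h2 := hvu y
  have h3 : (2 - q : ℂ)⁻¹ * (2 - q) = 1 := inv_mul_cancel₀ hq'
  simp only [_root_.transfer] at h1 h2 ⊢
  linear_combination h2 + (2 - q : ℂ)⁻¹ * h1 + _root_.periodMean e u y * h3

end PeriodicSmooth

end RigidFunctionals

/-! ### Vanishing of translation invariant functionals of weight other than 2 -/

noncomputable section RigidFunctionals

variable {E : Type} [NormedAddCommGroup E] [NormedSpace ℝ E] {ℓ : E →L[ℝ] ℝ} {e : E} {u : E → ℂ}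

/-- A bump function whose integer translates sum to `1`. -/
def unitBump (s : ℝ) : ℝ := Real.smoothTransition (s + 1) - Real.smoothTransition s

theorem unitBump_contDiff : ContDiff ℝ ∞ unitBump :=
  (Real.smoothTransition.contDiff.comp (contDiff_id.add contDiff_const)).sub
    Real.smoothTransition.contDiff

theorem unitBump_eq_zero {s : ℝ} (hs : 1 < |s|) : unitBump s = 0 := by
  rcases lt_abs.1 hs with h | h
  · rw [unitBump, Real.smoothTransition.one_of_one_le (by linarith),
      Real.smoothTransition.one_of_one_le h.le, sub_self]
  · rw [unitBump, Real.smoothTransition.zero_of_nonpos (by linarith),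
      Real.smoothTransition.zero_of_nonpos (by linarith), sub_self]

theorem sum_unitBump_add {s : ℝ} {N : ℕ} (h0 : s ≤ 0) (h1 : 1 ≤ s + N) :
    ∑ m ∈ Finset.range N, unitBump (s + m) = 1 := by
  have := Finset.sum_range_sub (fun m : ℕ => Real.smoothTransition (s + m)) N
  simp only [Nat.cast_add, Nat.cast_one, Nat.cast_zero, add_zero, ← add_assoc] at this
  simp only [unitBump]
  rw [this, Real.smoothTransition.one_of_one_le h1, Real.smoothTransition.zero_of_nonpos h0,
    sub_zero]

theorem sum_unitBump_sub {s : ℝ} {N : ℕ} (h0 : 0 ≤ s) (h1 : s + 1 ≤ N) :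
    ∑ m ∈ Finset.range N, unitBump (s - m) = 1 := by
  have := Finset.sum_range_sub' (fun m : ℕ => Real.smoothTransition (s + 1 - m)) N
  simp only [Nat.cast_add, Nat.cast_one, Nat.cast_zero, sub_zero] at this
  have h2 : ∀ m : ℕ, unitBump (s - m)
      = Real.smoothTransition (s + 1 - m) - Real.smoothTransition (s + 1 - (m + 1)) := fun m => by
    rw [unitBump]
    congr 2 <;> ring
  simp only [h2]
  rw [this, Real.smoothTransition.one_of_one_le (by linarith),
    Real.smoothTransition.zero_of_nonpos (by linarith), sub_zero]

theorem PeriodicSmooth.hasCompactSupport_unitBump_mul (hu : PeriodicSmooth ℓ e u) :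
    HasCompactSupport (fun y => (unitBump (ℓ y) : ℂ) * u y) := by
  obtain ⟨K, hK, hK'⟩ := hu.support
  have hS : IsCompact ((fun p : E × ℝ => p.1 + p.2 • e) '' (K ×ˢ Set.Icc (-1 : ℝ) 1)) :=
    (hK.prod isCompact_Icc).image (by fun_prop)
  refine HasCompactSupport.intro hS fun y hy => ?_
  by_cases h1 : y - ℓ y • e ∈ K
  · by_cases h2 : |ℓ y| ≤ 1
    · exact absurd ⟨(_, _), ⟨h1, abs_le.1 h2⟩, sub_add_cancel _ _⟩ hy
    · simp [unitBump_eq_zero (not_le.1 h2)]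
  · simp [hK' y h1]

theorem PeriodicSmooth.contDiff_unitBump_mul (hu : PeriodicSmooth ℓ e u) :
    ContDiff ℝ ∞ (fun y => (unitBump (ℓ y) : ℂ) * u y) :=
  (Complex.ofRealCLM.contDiff.comp (unitBump_contDiff.comp ℓ.contDiff)).mul hu.smooth

theorem HasCompactSupport.exists_abs_le {f : E → ℂ} (hc : HasCompactSupport f) (ℓ : E →L[ℝ] ℝ) :
    ∃ R, ∀ y, R < |ℓ y| → f y = 0 := by
  obtain ⟨R, hR⟩ := IsCompact.exists_bound_of_continuousOn (f := ℓ) hc.isCompact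
    ℓ.continuous.continuousOn
  refine ⟨R, fun y hy => ?_⟩
  by_contra h
  exact absurd (hR y (subset_tsupport f h)) (not_le.2 hy)

theorem sum_range_two_mul {M : Type*} [AddCommMonoid M] (h : ℕ → M) (N : ℕ) :
    ∑ m ∈ Finset.range (2 * N), h m = ∑ m ∈ Finset.range N, (h (2 * m) + h (2 * m + 1)) := by
  induction N with
  | zero => simp
  | succ N ih => rw [mul_add, Finset.sum_range_succ, Finset.sum_range_succ, ih,
      Finset.sum_range_succ, add_assoc]

/-- A functional on smooth compactly supported functions that is invariant under the unit
translation along `e`, and multiplied by `q` by the halving of the coordinate along `e`. -/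
structure IsTransferEigen (ℓ : E →L[ℝ] ℝ) (e : E) (q : ℝ) (μ : (E → ℂ) →ₗ[ℂ] ℂ) : Prop where
  translate : ∀ f, ContDiff ℝ ∞ f → HasCompactSupport f → μ (fun y => f (y + e)) = μ f
  halve : ∀ f, ContDiff ℝ ∞ f → HasCompactSupport f → μ (fun y => f (halving ℓ e y)) = q * μ f

namespace IsTransferEigen

variable {q : ℝ} {μ : (E → ℂ) →ₗ[ℂ] ℂ}

theorem translate_sub_smul (hμ : IsTransferEigen ℓ e q μ) (M m : ℕ) {f : E → ℂ}
    (hf : ContDiff ℝ ∞ f) (hc : HasCompactSupport f) :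
    μ (fun y => f (y + ((m : ℝ) - M) • e)) = μ f := by
  have hsm : ∀ v, ContDiff ℝ ∞ (fun y => f (y + v)) := fun v =>
    hf.comp (contDiff_id.add contDiff_const)
  have hcs : ∀ v, HasCompactSupport (fun y => f (y + v)) := fun v =>
    hc.comp_homeomorph (Homeomorph.addRight v)
  have h1 : ∀ m : ℕ, ∀ v, μ (fun y => f (y + (v + (m : ℝ) • e))) = μ (fun y => f (y + v)) := by
    intro m
    induction m with
    | zero => intro v; simp
    | succ m ih =>
      intro v
      rw [← ih v, ← hμ.translate (fun y => f (y + (v + (m : ℝ) • e))) (hsm _) (hcs _)]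
      congr 1
      ext y
      congr 1
      push_cast
      module
  have h2 := h1 m (-(M : ℝ) • e)
  have h3 := h1 M (-(M : ℝ) • e)
  have h4 : (-(M : ℝ) • e) + (M : ℝ) • e = 0 := by module
  have h5 : (-(M : ℝ) • e) + (m : ℝ) • e = ((m : ℝ) - M) • e := by module
  rw [h5] at h2
  rw [h4] at h3
  simp only [add_zero] at h3
  rw [h2, h3]

/-- The functional only depends on the periodisation. -/
theorem eq_unitBump_mul (hμ : IsTransferEigen ℓ e q μ) (he : ℓ e = 1) {f : E → ℂ}
    (hf : ContDiff ℝ ∞ f) (hc : HasCompactSupport f) {M : ℕ} (hM : ∀ y, M - 1 < |ℓ y| → f y = 0)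
    (hu : ∀ y, |ℓ y| ≤ 1 → u y = ∑ m ∈ Finset.range (2 * M), f (y + ((m : ℝ) - M) • e)) :
    μ f = μ (fun y => (unitBump (ℓ y) : ℂ) * u y) := by
  have hb : ContDiff ℝ ∞ (fun y => (unitBump (ℓ y) : ℂ)) :=
    Complex.ofRealCLM.contDiff.comp (unitBump_contDiff.comp ℓ.contDiff)
  have h1 : (fun y => (unitBump (ℓ y) : ℂ) * u y) = ∑ m ∈ Finset.range (2 * M),
      fun y => (unitBump (ℓ y) : ℂ) * f (y + ((m : ℝ) - M) • e) := by
    ext y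
    simp only [Finset.sum_apply, ← Finset.mul_sum]
    by_cases h : |ℓ y| ≤ 1
    · rw [hu y h]
    · simp [unitBump_eq_zero (not_le.1 h)]
  -- Invariance moves each translation from f to the bump; the translated bumps then sum to 1 on the
  -- support of f.
  have h2 : ∀ m : ℕ, μ (fun y => (unitBump (ℓ y) : ℂ) * f (y + ((m : ℝ) - M) • e))
      = μ (fun y => (unitBump (ℓ y + M - m) : ℂ) * f y) := by
    intro m
    have hb' : ContDiff ℝ ∞ (fun y => (unitBump (ℓ y + M - m) : ℂ)) :=
      Complex.ofRealCLM.contDiff.comp (unitBump_contDiff.comp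
        ((ℓ.contDiff.add contDiff_const).sub contDiff_const))
    rw [← hμ.translate_sub_smul M m (f := fun y => (unitBump (ℓ y + M - m) : ℂ) * f y)
      (hb'.mul hf) hc.mul_left]
    congr 1
    ext y
    simp only [map_add, map_smul, he, smul_eq_mul, mul_one]
    congr 3
    ring
  rw [h1, map_sum, Finset.sum_congr rfl fun m _ => h2 m, ← map_sum]
  congr 1
  ext y
  simp only [Finset.sum_apply, ← Finset.sum_mul]
  by_cases h : M - 1 < |ℓ y|
  · simp [hM y h]
  · have h3 := abs_le.1 (not_lt.1 h)
    have := sum_unitBump_sub (s := ℓ y + M) (N := 2 * M) (by linarith) (by push_cast; linarith)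
    rw [← Complex.ofReal_sum, this]
    simp

/-- The periodisation of (bump · u) ∘ halving is the transfer of u: even translations give the
branch u(Hy), odd ones the branch u(Hy + e/2), and on each of them the translated bumps sum to 1. -/
theorem apply_unitBump_mul_transfer (hμ : IsTransferEigen ℓ e q μ) (he : ℓ e = 1)
    (hu : PeriodicSmooth ℓ e u) :
    μ (fun y => (unitBump (ℓ y) : ℂ) * transfer ℓ e u y)
      = q * μ (fun y => (unitBump (ℓ y) : ℂ) * u y) := by
  rw [← hμ.halve _ hu.contDiff_unitBump_mul hu.hasCompactSupport_unitBump_mul]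
  have hH : ∀ y, ℓ (halving ℓ e y) = ℓ y / 2 := fun y => by
    simp only [halving_apply, map_sub, map_smul, he, smul_eq_mul]; ring
  have hper : ∀ (y : E) (m : ℕ), u (y + (m : ℝ) • e) = u y := by
    intro y m
    induction m with
    | zero => simp
    | succ m ih => rw [Nat.cast_succ, add_smul, one_smul, ← add_assoc, hu.periodic, ih]
  have hper' : ∀ (y : E) (m : ℕ), u (y + ((m : ℝ) - 2) • e) = u y := by
    intro y m
    rw [← hper _ 2]
    rw [← hper y m]
    congr 1
    push_cast
    module
  have hcs : HasCompactSupport (fun y => (unitBump (ℓ (halving ℓ e y)) : ℂ) * u (halving ℓ e y)) := by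
    have hinj : ∀ y, y = halving ℓ e y + ℓ (halving ℓ e y) • e := fun y => by
      rw [hH, halving_apply]; module
    obtain ⟨K, hK⟩ : ∃ K, K = tsupport (fun y => (unitBump (ℓ y) : ℂ) * u y) := ⟨_, rfl⟩
    have hKc : IsCompact K := hK ▸ hu.hasCompactSupport_unitBump_mul
    refine HasCompactSupport.intro (hKc.image (f := fun y => y + ℓ y • e) (by fun_prop))
      fun y hy => ?_
    by_contra h
    refine hy ⟨halving ℓ e y, ?_, (hinj y).symm⟩
    rw [hK]
    exact subset_tsupport _ h
  symm
  -- The composed function vanishes for |ℓ y| > 2, so `M = 4` leaves room; an even number of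
  -- half-periods on each side makes the translations split evenly between the two branches.
  refine hμ.eq_unitBump_mul he (hu.contDiff_unitBump_mul.comp (halving ℓ e).contDiff) hcs (M := 4)
    (fun y hy => ?_) (fun y hy => ?_)
  · rw [hH, unitBump_eq_zero, Complex.ofReal_zero, zero_mul]
    rw [abs_div, abs_two]
    norm_num at hy
    linarith
  · have h1 := abs_le.1 hy
    have e1 : ∀ m : ℕ, ((2 * m : ℕ) - (4 : ℕ) : ℝ) / 2 = m - 2 := fun m => by push_cast; ring
    have e2 : ∀ m : ℕ, ((2 * m + 1 : ℕ) - (4 : ℕ) : ℝ) / 2 = 2⁻¹ + (m - 2) := fun m => by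
      push_cast; ring
    have hl : ∀ (z : E) (t : ℝ), ℓ (z + t • e) = ℓ z + t := fun z t => by simp [he]
    have s1 := sum_unitBump_add (s := ℓ y / 2 - 2) (N := 4) (by linarith) (by push_cast; linarith)
    have s2 := sum_unitBump_add (s := ℓ y / 2 + 2⁻¹ - 2) (N := 4) (by linarith)
      (by push_cast; linarith)
    rw [sum_range_two_mul]
    simp only [halving_add_smul he, e1, e2, add_smul (2⁻¹ : ℝ), ← add_assoc, hper', hl, hH]
    rw [Finset.sum_add_distrib, ← Finset.sum_mul, ← Finset.sum_mul]
    have t1 : ∀ m : ℕ, ℓ y / 2 + ((m : ℝ) - 2) = ℓ y / 2 - 2 + m := fun m => by ring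
    have t2 : ∀ m : ℕ, ℓ y / 2 + 2⁻¹ + ((m : ℝ) - 2) = ℓ y / 2 + 2⁻¹ - 2 + m := fun m => by ring
    simp only [t1, t2, ← Complex.ofReal_sum, s1, s2]
    simp [transfer]

end IsTransferEigen

/-- The periodisation of a compactly supported function. -/
theorem exists_periodicSmooth_eq_sum (he : ℓ e = 1) {f : E → ℂ} (hf : ContDiff ℝ ∞ f)
    (hc : HasCompactSupport f) {R : ℝ} (hR : ∀ y, R < |ℓ y| → f y = 0) :
    ∃ u, PeriodicSmooth ℓ e u ∧ ∀ (M : ℕ) (y : E), |ℓ y| + R < M →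
      u y = ∑ m ∈ Finset.range (2 * M), f (y + ((m : ℝ) - M) • e) := by
  have hl : ∀ (z : E) (t : ℝ), ℓ (z + t • e) = ℓ z + t := fun z t => by simp [he]
  let u : E → ℂ := fun y => ∑' m : ℤ, f (y + (m : ℝ) • e)
  have key : ∀ (M : ℕ) (y : E), |ℓ y| + R < M →
      u y = ∑ m ∈ Finset.range (2 * M), f (y + ((m : ℝ) - M) • e) := by
    intro M y hy
    have h1 : u y = ∑ m ∈ Finset.Ico (-(M : ℤ)) M, f (y + (m : ℝ) • e) := by
      refine tsum_eq_sum fun m hm => hR _ ?_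
      rw [hl]
      have h3 : (M : ℝ) ≤ |(m : ℝ)| := by
        rw [Finset.mem_Ico, not_and_or, not_le, not_lt] at hm
        rcases hm with h | h
        · have : (m : ℝ) < -(M : ℝ) := by exact_mod_cast h
          rw [le_abs]; right; linarith
        · exact le_abs.2 (Or.inl (by exact_mod_cast h))
      have h4 := abs_sub_abs_le_abs_sub (m : ℝ) (-ℓ y)
      rw [abs_neg, sub_neg_eq_add, add_comm (m : ℝ)] at h4
      linarith
    rw [h1]
    refine Finset.sum_nbij' (fun m => (m + M).toNat) (fun m => (m : ℤ) - M) ?_ ?_ ?_ ?_ ?_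
    · intro m hm; simp only [Finset.mem_Ico, Finset.mem_range] at hm ⊢; omega
    · intro m hm; simp only [Finset.mem_Ico, Finset.mem_range] at hm ⊢; omega
    · intro m hm; simp only [Finset.mem_Ico] at hm; omega
    · intro m hm; simp
    · intro m hm
      simp only [Finset.mem_Ico] at hm
      have : ((m + M).toNat : ℝ) = m + M := by
        have h : (((m + M).toNat : ℤ) : ℝ) = ((m + M : ℤ) : ℝ) := by
          rw [Int.toNat_of_nonneg (by omega)]
        push_cast at h
        exact h
      rw [this, add_sub_cancel_right]
  refine ⟨u, ⟨?_, fun y => ?_, ?_⟩, key⟩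
  · refine contDiff_iff_contDiffAt.2 fun y => ?_
    obtain ⟨M, hM⟩ := exists_nat_gt (|ℓ y| + R)
    have hopen : IsOpen {z : E | |ℓ z| + R < M} :=
      isOpen_lt (by fun_prop) continuous_const
    have h2 : ContDiff ℝ ∞ fun z => ∑ m ∈ Finset.range (2 * M), f (z + ((m : ℝ) - M) • e) :=
      ContDiff.sum fun m _ => hf.comp (contDiff_id.add contDiff_const)
    refine h2.contDiffAt.congr_of_eventuallyEq ?_
    filter_upwards [hopen.mem_nhds hM] with z hz using key M z hz
  · change ∑' m : ℤ, f (y + e + (m : ℝ) • e) = ∑' m : ℤ, f (y + (m : ℝ) • e)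
    rw [← (Equiv.addRight (1 : ℤ)).tsum_eq (fun m : ℤ => f (y + (m : ℝ) • e))]
    refine tsum_congr fun m => ?_
    congr 1
    simp only [Equiv.coe_addRight]
    push_cast
    module
  · refine ⟨_, hc.isCompact.image (f := fun y => y - ℓ y • e) (by fun_prop), fun y hy => ?_⟩
    have : ∀ m : ℤ, f (y + (m : ℝ) • e) = 0 := by
      intro m
      by_contra h
      exact hy ⟨_, subset_tsupport _ h, transverse_add_smul he _ _⟩
    simp [u, this]

/-- There are no functionals on test functions that are invariant under translations and have
the weight `q ≠ 2` under the halving: the Lebesgue measure has weight `2`. -/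
theorem IsTransferEigen.eq_zero {q : ℝ} {μ : (E → ℂ) →ₗ[ℂ] ℂ} (hμ : IsTransferEigen ℓ e q μ)
    (he : ℓ e = 1) (hH : ‖halving ℓ e‖ ≤ 1) (hq : 0 < q) (hq2 : q ≠ 2) {f : E → ℂ}
    (hf : ContDiff ℝ ∞ f) (hc : HasCompactSupport f) : μ f = 0 := by
  obtain ⟨R, hR⟩ := hc.exists_abs_le ℓ
  obtain ⟨u, hu, hfu⟩ := exists_periodicSmooth_eq_sum he hf hc hR
  obtain ⟨M, hM⟩ := exists_nat_gt (1 + R)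
  rw [hμ.eq_unitBump_mul he hf hc (M := M) (u := u) (fun y hy => hR y (by linarith))
    (fun y hy => hfu M y (by linarith))]
  -- Writing the periodisation as T v - q v, the value of μ becomes q μ(bump · v) - q μ(bump · v).
  obtain ⟨v, hv, hvu⟩ := hu.exists_transfer_sub_eq he hH hq hq2
  have h1 := hμ.apply_unitBump_mul_transfer he hv
  have h2 : (fun y => (unitBump (ℓ y) : ℂ) * u y) = (fun y => (unitBump (ℓ y) : ℂ) * transfer ℓ e v y)
      - (q : ℂ) • (fun y => (unitBump (ℓ y) : ℂ) * v y) := by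
    ext y
    simp only [Pi.sub_apply, Pi.smul_apply, smul_eq_mul, ← hvu]
    ring
  rw [h2, map_sub, map_smul, h1, smul_eq_mul, sub_self]

end RigidFunctionals

/-! ### Coefficients of symbols in charts, and extension by zero -/

noncomputable section SymbolsInCharts

namespace ProjSymbols

open CotangentRP

variable {n : ℕ}

/-- Homogeneous polynomial functions of degree `k`. -/
def IsHomogeneousPoly {ι : Type} (k : ℕ) (ψ : (ι → ℝ) → ℂ) : Prop :=
  ∃ p : MvPolynomial ι ℂ, p.IsHomogeneous k ∧ ∀ η, ψ η = MvPolynomial.eval (fun j => (η j : ℂ)) p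

/-- Linear substitutions preserve homogeneous polynomials. -/
theorem exists_homogeneous_subst {ι κ : Type} [Fintype κ] {k : ℕ} {p : MvPolynomial ι ℂ}
    (hp : p.IsHomogeneous k) (a : ι → κ → ℂ) :
    ∃ q : MvPolynomial κ ℂ, q.IsHomogeneous k ∧ ∀ η : κ → ℂ,
      MvPolynomial.eval η q = MvPolynomial.eval (fun i => ∑ m, η m * a i m) p := by
  refine ⟨MvPolynomial.aeval (fun j => ∑ m, MvPolynomial.X m * MvPolynomial.C (a j m)) p, ?_,
    fun η => ?_⟩
  · have := hp.aeval (n := 1) (fun j : ι => ∑ m : κ,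
      (MvPolynomial.X m * MvPolynomial.C (a j m) : MvPolynomial κ ℂ)) (fun j =>
        MvPolynomial.IsHomogeneous.sum _ _ _ fun m _ => by
          simpa using (MvPolynomial.isHomogeneous_X ℂ m).mul
            (MvPolynomial.isHomogeneous_C κ (a j m)))
    simpa using this
  · rw [← MvPolynomial.coe_aeval_eq_eval, ← MvPolynomial.coe_aeval_eq_eval]
    simp only [RingHom.coe_coe]
    rw [← AlgHom.comp_apply, MvPolynomial.comp_aeval]
    congr 2
    ext j
    simp

/-- The monomial `η^β`. -/
def monomialFun {ι : Type} [Fintype ι] (β : ι → ℕ) (η : ι → ℝ) : ℂ := ∏ m, (η m : ℂ) ^ β m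

theorem contDiff_monomialFun {ι : Type} [Fintype ι] (β : ι → ℕ) :
    ContDiff ℝ ∞ (monomialFun β) := by
  unfold monomialFun
  exact contDiff_prod fun m _ =>
    (Complex.ofRealCLM.contDiff.comp (contDiff_apply ℝ ℝ m)).pow (β m)

theorem isHomogeneousPoly_monomialFun {ι : Type} [Fintype ι] {β : ι → ℕ} {k : ℕ}
    (hβ : ∑ m, β m = k) (c : ℂ) : IsHomogeneousPoly k (fun η => c * monomialFun β η) := by
  refine ⟨MvPolynomial.C c * ∏ m, MvPolynomial.X m ^ β m, ?_, fun η => by simp [monomialFun]⟩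
  have h := MvPolynomial.IsHomogeneous.prod (R := ℂ) Finset.univ
    (fun m : ι => MvPolynomial.X m ^ β m) β (fun m _ => MvPolynomial.isHomogeneous_X_pow m (β m))
  rw [hβ] at h
  simpa using (MvPolynomial.isHomogeneous_C ι c).mul h

/-- The coefficients of a homogeneous polynomial are combinations of its values. -/
theorem exists_coefficient_formula (n k : ℕ) :
    ∃ c : (Fin n → ℕ) → ((Fin n → ℝ) →₀ ℂ), ∀ ψ : (Fin n → ℝ) → ℂ, IsHomogeneousPoly k ψ →
      ∀ η, ψ η = ∑ β ∈ Finset.piAntidiag Finset.univ k,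
        ((c β).sum fun a t => t * ψ a) * monomialFun β η := by
  classical
  let B : Finset (Fin n → ℕ) := Finset.piAntidiag Finset.univ k
  let ev : (Fin n → ℝ) → Module.Dual ℂ (B → ℂ) := fun η =>
    ∑ β : B, monomialFun β.1 η • LinearMap.proj β
  have hev : ∀ η v, ev η v = ∑ β : B, v β * monomialFun β.1 η := fun η v => by
    simp [ev, mul_comm]
  -- A coefficient vector annihilated by all evaluations at real points is a polynomial vanishing on
  -- ℝ^n, hence zero. So evaluations span the dual, and each coefficient functional is a finite
  -- combination of them.
  have hspan : Submodule.span ℂ (Set.range ev) = ⊤ := by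
    rw [← Subspace.dualCoannihilator_dualAnnihilator_eq (W := Submodule.span ℂ (Set.range ev)),
      Submodule.dualAnnihilator_eq_top_iff, Submodule.eq_bot_iff]
    intro v hv
    rw [Submodule.mem_dualCoannihilator] at hv
    have h0 : ∀ η, ∑ β : B, v β * monomialFun β.1 η = 0 := fun η => by
      rw [← hev]; exact hv _ (Submodule.subset_span ⟨η, rfl⟩)
    let p : MvPolynomial (Fin n) ℂ :=
      ∑ β : B, MvPolynomial.monomial (Finsupp.equivFunOnFinite.symm β.1) (v β)
    have hp : p = 0 := by
      refine MvPolynomial.funext_set (fun _ => Set.range ((↑) : ℝ → ℂ))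
        (fun _ => Set.infinite_range_of_injective Complex.ofReal_injective) fun x hx => ?_
      choose η hη using fun i => hx i trivial
      rw [map_zero, ← h0 η]
      simp only [p, map_sum, MvPolynomial.eval_monomial, monomialFun]
      refine Finset.sum_congr rfl fun β _ => ?_
      rw [Finsupp.prod_fintype _ _ (by simp)]
      simp [hη]
    ext β
    have h1 := congrArg (MvPolynomial.coeff (Finsupp.equivFunOnFinite.symm β.1)) hp
    simp only [p, MvPolynomial.coeff_sum, MvPolynomial.coeff_monomial, MvPolynomial.coeff_zero,
      EmbeddingLike.apply_eq_iff_eq, Subtype.coe_inj] at h1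
    simpa using h1
  have hmem : ∀ β : B, ∃ c : (Fin n → ℝ) →₀ ℂ, (c.sum fun a t => t • ev a) = LinearMap.proj β :=
    fun β => Finsupp.mem_span_range_iff_exists_finsupp.1 (by rw [hspan]; trivial)
  choose c hc using hmem
  refine ⟨fun β => if h : β ∈ B then c ⟨β, h⟩ else 0, ?_⟩
  rintro ψ ⟨p, hp, hψ⟩ η
  let v : B → ℂ := fun β => p.coeff (Finsupp.equivFunOnFinite.symm β.1)
  have hv : ∀ η, ψ η = ev η v := by
    intro η
    rw [hψ, hev, MvPolynomial.eval_eq']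
    have h1 : ∑ β : B, v β * monomialFun β.1 η
        = ∑ β ∈ B, p.coeff (Finsupp.equivFunOnFinite.symm β) * monomialFun β η :=
      Finset.sum_coe_sort B
        (fun β => p.coeff (Finsupp.equivFunOnFinite.symm β) * monomialFun β η)
    rw [h1]
    refine Finset.sum_of_injOn (fun d => ⇑d) (fun a _ b _ h => DFunLike.coe_injective h) ?_ ?_ ?_
    · intro d hd
      have h2 := hp (MvPolynomial.mem_support_iff.1 hd)
      rw [Finsupp.weight_apply, Finsupp.sum_fintype _ _ (by simp)] at h2
      simpa [B, Finset.mem_piAntidiag] using h2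
    · intro β _ hβ2
      have : p.coeff (Finsupp.equivFunOnFinite.symm β) = 0 := by
        by_contra h
        exact hβ2 ⟨_, MvPolynomial.mem_support_iff.2 h, by simp⟩
      rw [this, zero_mul]
    · intro d _
      have : Finsupp.equivFunOnFinite.symm (⇑d) = d := by ext; simp
      simp [this, monomialFun]
  rw [hv, hev]
  rw [← Finset.sum_coe_sort (Finset.piAntidiag Finset.univ k)]
  refine Finset.sum_congr rfl fun β _ => ?_
  congr 1
  have h3 := congrArg (fun T => T v) (hc β)
  simp only [Finsupp.sum, LinearMap.sum_apply, LinearMap.smul_apply, smul_eq_mul, ← hv,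
    LinearMap.proj_apply] at h3
  have : β.1 ∈ B := β.2
  simp only [this, dif_pos]
  exact h3.symm

/-- A symbol of degree `k` is a polynomial in the fibre coordinates of each chart. -/
theorem isHomogeneousPoly_chart {k : ℕ} {F : CotangentRP n → ℂ} (hF : IsFiberHomogeneous k F)
    (i : Fin (n + 1)) (y : Fin n → ℝ) : IsHomogeneousPoly k (fun η => F (chart i y η)) := by
  obtain ⟨p, hp, hp'⟩ := hF _ (insertNth_ne_zero i y)
  obtain ⟨q, hq, hq'⟩ := exists_homogeneous_subst hp
    (i.insertNth (α := fun _ => Fin n → ℂ) (fun m => -(y m : ℂ)) (fun j m => if m = j then 1 else 0))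
  refine ⟨q, hq, fun η => ?_⟩
  rw [hq']
  refine (hp' _ (insertNth_dotProduct i y η)).trans ?_
  congr 2
  ext j
  rcases Fin.eq_self_or_eq_succAbove i j with rfl | ⟨m, rfl⟩
  · simp [dotProduct]
  · simp

/-- The coefficients of a symbol in a chart. -/
theorem exists_chart_coefficients {k : ℕ} {F : CotangentRP n → ℂ} (hF : F ∈ symbolsOfDegree n k)
    (i : Fin (n + 1)) : ∃ f : (Fin n → ℕ) → (Fin n → ℝ) → ℂ, (∀ β, ContDiff ℝ ∞ (f β)) ∧
      (∀ y η, F (chart i y η) = ∑ β ∈ Finset.piAntidiag Finset.univ k, f β y * monomialFun β η) ∧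
      ∀ β y, (∀ η, F (chart i y η) = 0) → f β y = 0 := by
  obtain ⟨c, hc⟩ := exists_coefficient_formula n k
  -- The combination of evaluation points is the same for all y, so smoothness in y and vanishing
  -- over y pass from F to its coefficients.
  refine ⟨fun β y => (c β).sum fun a t => t * F (chart i y a), fun β => ?_, fun y η => ?_,
    fun β y h => ?_⟩
  · exact ContDiff.sum fun a _ => contDiff_const.mul
      ((hF.1 i).comp (contDiff_id.prodMk contDiff_const))
  · exact hc _ (isHomogeneousPoly_chart hF.2 i y) η
  · simp [h]

/-- The function on `T*M` that is `φ` in the `i`-th chart, and vanishes outside of it. -/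
def extendChart (i : Fin (n + 1)) (φ : (Fin n → ℝ) → (Fin n → ℝ) → ℂ) : CotangentRP n → ℂ :=
  Quotient.lift (s := cotangentSetoid n)
    (fun z => if z.1.1 i = 0 then 0 else
      φ (fun m => z.1.1 (i.succAbove m) / z.1.1 i) (fun m => z.1.1 i * z.1.2 (i.succAbove m))) (by
    rintro z w ⟨c, hc, h1, h2⟩
    simp only [h1, h2, Pi.smul_apply, smul_eq_mul, mul_eq_zero, hc, false_or]
    congr 2
    · ext m; rw [mul_div_mul_left _ _ hc]
    · ext m; field_simp)

theorem extendChart_mk (i : Fin (n + 1)) (φ : (Fin n → ℝ) → (Fin n → ℝ) → ℂ)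
    (x ξ : Fin (n + 1) → ℝ) (hx : x ≠ 0) (h : ξ ⬝ᵥ x = 0) :
    extendChart i φ (mk x ξ hx h) = if x i = 0 then 0 else
      φ (fun m => x (i.succAbove m) / x i) (fun m => x i * ξ (i.succAbove m)) := rfl

theorem extendChart_chart (i : Fin (n + 1)) (φ : (Fin n → ℝ) → (Fin n → ℝ) → ℂ)
    (y η : Fin n → ℝ) : extendChart i φ (chart i y η) = φ y η := by
  rw [chart, extendChart_mk]
  simp

theorem eq_extendChart {i : Fin (n + 1)} {F : CotangentRP n → ℂ}
    {φ : (Fin n → ℝ) → (Fin n → ℝ) → ℂ} (h1 : ∀ y η, F (chart i y η) = φ y η)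
    (h2 : ∀ x ξ hx h, x i = 0 → F (mk x ξ hx h) = 0) : F = extendChart i φ := by
  ext z
  induction z using CotangentRP.ind with
  | _ x ξ hx h =>
    by_cases hi : x i = 0
    · rw [h2 x ξ hx h hi, extendChart_mk, if_pos hi]
    · rw [extendChart_mk, if_neg hi, mk_eq_chart i x ξ hx h hi, h1]

/-- Local symbols of degree `k`: smooth, supported over a bounded set, polynomial on the
fibres. -/
structure IsLocalSymbol (k : ℕ) (φ : (Fin n → ℝ) → (Fin n → ℝ) → ℂ) : Prop where
  smooth : ContDiff ℝ ∞ (fun p : (Fin n → ℝ) × (Fin n → ℝ) => φ p.1 p.2)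
  bounded : ∃ R, ∀ y η, R < ‖y‖ → φ y η = 0
  poly : ∀ y, IsHomogeneousPoly k (φ y)

theorem contDiff_insertNth {E : Type*} [NormedAddCommGroup E] [NormedSpace ℝ E] (i : Fin (n + 1))
    {f : E → ℝ} {g : E → Fin n → ℝ} (hf : ContDiff ℝ ∞ f) (hg : ContDiff ℝ ∞ g) :
    ContDiff ℝ ∞ (fun p => i.insertNth (α := fun _ => ℝ) (f p) (g p)) := by
  refine contDiff_pi.2 fun j => ?_
  rcases Fin.eq_self_or_eq_succAbove i j with rfl | ⟨m, rfl⟩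
  · simpa using hf
  · simpa using contDiff_pi.1 hg m

/-- Only the hyperplane x_i = 0 is delicate. In the chart j ≠ i, near such a point, the affine
coordinate x_j / x_i = 1 / x_i exceeds the radius of the support, so the extension is zero in a
neighbourhood. -/
theorem IsLocalSymbol.extendChart_mem {k : ℕ} {φ : (Fin n → ℝ) → (Fin n → ℝ) → ℂ}
    (hφ : IsLocalSymbol k φ) (i : Fin (n + 1)) : extendChart i φ ∈ symbolsOfDegree n k := by
  refine ⟨fun j => contDiff_iff_contDiffAt.2 fun p => ?_, fun x hx => ?_⟩
  · let X : (Fin n → ℝ) × (Fin n → ℝ) → Fin (n + 1) → ℝ :=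
      fun q => j.insertNth (α := fun _ => ℝ) 1 q.1
    let Ξ : (Fin n → ℝ) × (Fin n → ℝ) → Fin (n + 1) → ℝ :=
      fun q => j.insertNth (α := fun _ => ℝ) (-(q.2 ⬝ᵥ q.1)) q.2
    have hX : ContDiff ℝ ∞ X := contDiff_insertNth j contDiff_const contDiff_fst
    have hΞ : ContDiff ℝ ∞ Ξ := contDiff_insertNth j (by simp only [dotProduct]; fun_prop)
      contDiff_snd
    have hXi : ContDiff ℝ ∞ (fun q => X q i) := contDiff_pi.1 hX i
    have hval : ∀ q, extendChart i φ (chart j q.1 q.2) = if X q i = 0 then 0 else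
        φ (fun m => X q (i.succAbove m) / X q i) (fun m => X q i * Ξ q (i.succAbove m)) :=
      fun q => rfl
    by_cases hi : X p i = 0
    · obtain ⟨R, hR⟩ := hφ.bounded
      have hij : j ≠ i := by
        rintro rfl
        simp [X] at hi
      obtain ⟨m, rfl⟩ := Fin.exists_succAbove_eq hij
      have hev : ∀ᶠ q in nhds p, |X q i| < (|R| + 1)⁻¹ := by
        have : Filter.Tendsto (fun q => |X q i|) (nhds p) (nhds |X p i|) :=
          hXi.continuous.abs.continuousAt
        refine this.eventually_lt_const ?_
        rw [hi, abs_zero]; positivity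
      refine contDiffAt_const (c := (0 : ℂ)) |>.congr_of_eventuallyEq ?_
      filter_upwards [hev] with q hq
      rw [hval]
      split_ifs with h0
      · rfl
      · apply hR
        refine lt_of_lt_of_le ?_ (norm_le_pi_norm _ m)
        have h1 : X q (i.succAbove m) = 1 := by simp [X]
        rw [h1, one_div, norm_inv, Real.norm_eq_abs]
        refine lt_of_lt_of_le (lt_of_le_of_lt (le_abs_self R) (lt_add_one _)) ?_
        exact ((lt_inv_comm₀ (abs_pos.2 h0) (by positivity)).1 hq).le
    · have hev : ∀ᶠ q in nhds p, X q i ≠ 0 := hXi.continuous.continuousAt.eventually_ne hi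
      have hsm : ContDiffAt ℝ ∞ (fun q => (fun r : (Fin n → ℝ) × (Fin n → ℝ) => φ r.1 r.2)
          (fun m => X q (i.succAbove m) / X q i, fun m => X q i * Ξ q (i.succAbove m))) p := by
        refine hφ.smooth.contDiffAt.comp p (ContDiffAt.prodMk ?_ ?_)
        · exact contDiffAt_pi.2 fun m =>
            ((contDiff_pi.1 hX _).contDiffAt).div hXi.contDiffAt hi
        · exact contDiffAt_pi.2 fun m => (hXi.mul (contDiff_pi.1 hΞ _)).contDiffAt
      refine hsm.congr_of_eventuallyEq ?_
      filter_upwards [hev] with q hq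
      rw [hval, if_neg hq]
  · by_cases hi : x i = 0
    · exact ⟨0, MvPolynomial.isHomogeneous_zero _ _ _, fun ξ h => by
        rw [extendChart_mk, if_pos hi, map_zero]⟩
    · obtain ⟨p, hp, hp'⟩ := hφ.poly (fun m => x (i.succAbove m) / x i)
      obtain ⟨q, hq, hq'⟩ := exists_homogeneous_subst hp
        (fun m j => if j = i.succAbove m then (x i : ℂ) else 0)
      refine ⟨q, hq, fun ξ h => ?_⟩
      rw [extendChart_mk, if_neg hi, hp', hq']
      congr 2
      ext m
      simp [mul_comm]

theorem isLocalSymbol_mul_monomialFun {k : ℕ} {f : (Fin n → ℝ) → ℂ} (hf : ContDiff ℝ ∞ f)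
    {R : ℝ} (hR : ∀ y, R < ‖y‖ → f y = 0) {β : Fin n → ℕ} (hβ : ∑ m, β m = k) :
    IsLocalSymbol k (fun y η => f y * monomialFun β η) :=
  ⟨(hf.comp contDiff_fst).mul ((contDiff_monomialFun β).comp contDiff_snd),
    ⟨R, fun y η hy => by rw [hR y hy, zero_mul]⟩,
    fun y => isHomogeneousPoly_monomialFun hβ (f y)⟩

end ProjSymbols

end SymbolsInCharts

/-! ### Functionals invariant under shears depend only on the germ over [e_0] -/

noncomputable section Locality

namespace ProjSymbols

open CotangentRP

/-! ### Elements of the Borel subgroup -/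

/-- The transvection `e_{i+1} ↦ e_{i+1} + b e_0`. -/
def shear {n : ℕ} (i : Fin n) (b : ℝ) : Matrix.SpecialLinearGroup (Fin (n + 1)) ℝ :=
  ⟨Matrix.transvection 0 i.succ b, Matrix.det_transvection_of_ne _ _ (Fin.succ_ne_zero i).symm b⟩

theorem shear_inv {n : ℕ} (i : Fin n) (b : ℝ) : (shear i b)⁻¹ = shear i (-b) := by
  refine inv_eq_of_mul_eq_one_right (Subtype.ext ?_)
  change Matrix.transvection 0 i.succ b * Matrix.transvection 0 i.succ (-b) = 1
  rw [Matrix.transvection_mul_transvection_same _ _ (Fin.succ_ne_zero i).symm, add_neg_cancel,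
    Matrix.transvection_zero]

theorem shear_mulVec {n : ℕ} (i : Fin n) (b : ℝ) (x : Fin (n + 1) → ℝ) :
    (shear i b).1 *ᵥ x = x + Pi.single 0 (b * x i.succ) := by
  change Matrix.transvection 0 i.succ b *ᵥ x = _
  rw [Matrix.transvection, Matrix.add_mulVec, Matrix.one_mulVec, Matrix.single_mulVec]
  rfl

theorem vecMul_shear {n : ℕ} (i : Fin n) (b : ℝ) (ξ : Fin (n + 1) → ℝ) :
    ξ ᵥ* (shear i b).1 = ξ + Pi.single i.succ (ξ 0 * b) := by
  change ξ ᵥ* Matrix.transvection 0 i.succ b = _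
  rw [Matrix.transvection, Matrix.vecMul_add, Matrix.vecMul_one, ← Matrix.mulVec_transpose,
    Matrix.transpose_single, Matrix.single_mulVec, mul_comm]
  rfl

/-- The diagonal matrix with entries proportional to `d`. -/
def torus {n : ℕ} (d : Fin (n + 1) → ℝ) (hd : ∀ j, 0 < d j) :
    Matrix.SpecialLinearGroup (Fin (n + 1)) ℝ :=
  ⟨Matrix.diagonal fun j => (∏ i, d i) ^ (-((n + 1 : ℕ) : ℝ)⁻¹) * d j, by
    have h : 0 < ∏ i, d i := Finset.prod_pos fun i _ => hd i
    rw [Matrix.det_diagonal, Finset.prod_mul_distrib, Finset.prod_const, Finset.card_univ,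
      Fintype.card_fin, ← Real.rpow_natCast, ← Real.rpow_mul h.le, neg_mul,
      inv_mul_cancel₀ (by positivity), Real.rpow_neg_one, inv_mul_cancel₀ h.ne']⟩

/-- The factor that normalises the determinant is absorbed by the equivalence (x, ξ) ∼ (cx, c⁻¹ξ),
so positive diagonal matrices of any determinant may be used. -/
theorem torus_smul_mk {n : ℕ} (d : Fin (n + 1) → ℝ) (hd : ∀ j, 0 < d j) (x ξ : Fin (n + 1) → ℝ)
    (hx : x ≠ 0) (h : ξ ⬝ᵥ x = 0) (hx' : (fun j => d j * x j) ≠ 0)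
    (h' : (fun j => ξ j / d j) ⬝ᵥ (fun j => d j * x j) = 0) :
    torus d hd • mk x ξ hx h = mk (fun j => d j * x j) (fun j => ξ j / d j) hx' h' := by
  have hp : 0 < ∏ i, d i := Finset.prod_pos fun i _ => hd i
  set c : ℝ := (∏ i, d i) ^ (-((n + 1 : ℕ) : ℝ)⁻¹) with hc
  have hc0 : c ≠ 0 := (Real.rpow_pos_of_pos hp _).ne'
  have hinv : ((torus d hd)⁻¹).1 = Matrix.diagonal fun j => (c * d j)⁻¹ := by
    have h1 : (torus d hd).1 * (Matrix.diagonal fun j => (c * d j)⁻¹) = 1 := by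
      change Matrix.diagonal (fun j => c * d j) * _ = 1
      rw [Matrix.diagonal_mul_diagonal, ← Matrix.diagonal_one]
      congr 1
      ext j
      exact mul_inv_cancel₀ (mul_ne_zero hc0 (hd j).ne')
    have h2 : ((torus d hd)⁻¹).1 * (torus d hd).1 = 1 := by
      rw [← Matrix.SpecialLinearGroup.coe_mul, inv_mul_cancel, Matrix.SpecialLinearGroup.coe_one]
    exact left_inv_eq_right_inv h2 h1
  rw [smul_mk]
  refine Quotient.sound (s := cotangentSetoid n) ⟨c⁻¹, inv_ne_zero hc0, ?_, ?_⟩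
  · change _ = c⁻¹ • (Matrix.diagonal (fun j => c * d j) *ᵥ x)
    ext j
    simp only [Matrix.mulVec_diagonal, Pi.smul_apply, smul_eq_mul]
    field_simp
  · change _ = c⁻¹⁻¹ • (ξ ᵥ* ((torus d hd)⁻¹).1)
    rw [hinv]
    ext j
    have := (hd j).ne'
    simp only [Matrix.vecMul_diagonal, Pi.smul_apply, smul_eq_mul]
    field_simp

variable {n : ℕ}

/-- The shear adds b x_{i+1} to x_0, hence b to x_0 / x_{i+1}. It alters only the component ξ_{i+1}
of the form, which is not a fibre coordinate in this chart. -/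
theorem extendChart_shear_smul (i : Fin (n + 1)) (b : ℝ)
    (φ : (Fin (n + 1) → ℝ) → (Fin (n + 1) → ℝ) → ℂ) (z : CotangentRP (n + 1)) :
    extendChart i.succ φ (shear i b • z)
      = extendChart i.succ (fun y η => φ (y + b • Pi.single 0 1) η) z := by
  induction z using CotangentRP.ind with
  | _ x ξ hx h =>
    rw [smul_mk, extendChart_mk, extendChart_mk, shear_inv, shear_mulVec, vecMul_shear]
    have h1 : (x + Pi.single (M := fun _ => ℝ) (0 : Fin (n + 2)) (b * x i.succ)) i.succ = x i.succ := by
      simp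
    rw [h1]
    split_ifs with h0
    · rfl
    · congr 1
      · ext m
        refine Fin.cases ?_ (fun m => ?_) m
        · simp [add_div, mul_div_assoc, div_self h0]
        · simp [Fin.succ_succAbove_succ]
      · ext m
        simp

theorem extendChart_torus_smul {n : ℕ} (i : Fin (n + 1)) (d : Fin (n + 1) → ℝ) (hd : ∀ j, 0 < d j)
    (φ : (Fin n → ℝ) → (Fin n → ℝ) → ℂ) (z : CotangentRP n) :
    extendChart i φ (torus d hd • z) = extendChart i (fun y η => φ
      (fun m => d (i.succAbove m) / d i * y m) (fun m => d i / d (i.succAbove m) * η m)) z := by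
  induction z using CotangentRP.ind with
  | _ x ξ hx h =>
    have hx' : (fun j => d j * x j) ≠ 0 := fun h0 => hx <| funext fun j =>
      (mul_eq_zero.1 (congrFun h0 j)).resolve_left (hd j).ne'
    have h' : (fun j => ξ j / d j) ⬝ᵥ (fun j => d j * x j) = 0 := by
      rw [← h, dotProduct, dotProduct]
      refine Finset.sum_congr rfl fun j _ => ?_
      have := (hd j).ne'
      field_simp
    rw [torus_smul_mk d hd x ξ hx h hx' h', extendChart_mk, extendChart_mk]
    have hi := (hd i).ne'
    by_cases h0 : x i = 0
    · simp [h0]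
    · rw [if_neg (mul_ne_zero hi h0), if_neg h0]
      congr 1
      · ext m; rw [mul_div_mul_comm]
      · ext m; ring

theorem shear_smul_chart_zero {n : ℕ} (j : Fin n) (b : ℝ) (y η : Fin n → ℝ) (hb : 1 + b * y j ≠ 0) :
    shear j b • chart 0 y η = chart 0 (fun m => y m / (1 + b * y j))
      (fun m => (1 + b * y j) * (η m + Pi.single (M := fun _ => ℝ) j (b * (η ⬝ᵥ y)) m)) := by
  have h1 : (Fin.insertNth (α := fun _ => ℝ) 0 1 y + Pi.single 0 (b * y j) : Fin (n + 1) → ℝ) 0 = 1 + b * y j := by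
    simp
  have h2 : (shear j b).1 *ᵥ Fin.insertNth (α := fun _ => ℝ) 0 1 y
      = Fin.insertNth (α := fun _ => ℝ) 0 1 y + Pi.single 0 (b * y j) := by
    rw [shear_mulVec]; simp
  rw [chart, smul_mk, mk_eq_chart 0 _ _ _ _ (by rw [h2, h1]; exact hb), h2, h1, shear_inv,
    vecMul_shear]
  congr 1
  · ext m; simp
  · ext m
    simp only [Fin.zero_succAbove, Pi.add_apply, Fin.insertNth_zero, Fin.cons_succ, Fin.cons_zero]
    congr 2
    by_cases hm : m = j
    · subst hm; simp [mul_comm]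
    · rw [Pi.single_eq_of_ne hm, Pi.single_eq_of_ne (by simpa using hm)]

/-! ### The functionals -/

/-- Functionals on symbols that are invariant under the shears and have weight
`(d_0 / d_1) ^ l` under the torus. -/
structure IsBorelEigen (l : ℕ) (L : (CotangentRP (n + 1) → ℂ) →ₗ[ℂ] ℂ) : Prop where
  shear : ∀ F ∈ symbols (n + 1), ∀ (i : Fin (n + 1)) (b : ℝ), L (fun z => F (shear i b • z)) = L F
  torus : ∀ F ∈ symbols (n + 1), ∀ (d : Fin (n + 2) → ℝ) (hd : ∀ j, 0 < d j), L (fun z => F (torus d hd • z))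
    = ((d 0 / d 1 : ℝ) : ℂ) ^ l * L F

/-- The symbol `f(y) η^β` in a chart, extended by `0`. -/
def extendMonomial {n : ℕ} (i : Fin (n + 1)) (β : Fin n → ℕ) :
    ((Fin n → ℝ) → ℂ) →ₗ[ℂ] (CotangentRP n → ℂ) where
  toFun f := extendChart i fun y η => f y * monomialFun β η
  map_add' f g := by
    ext z
    induction z using CotangentRP.ind with
    | _ x ξ hx h =>
      rw [Pi.add_apply]
      simp only [extendChart_mk]
      split_ifs <;> simp [add_mul]
  map_smul' c f := by
    ext z
    induction z using CotangentRP.ind with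
    | _ x ξ hx h =>
      rw [Pi.smul_apply]
      simp only [extendChart_mk]
      split_ifs <;> simp [mul_assoc]

theorem extendMonomial_apply {n : ℕ} (i : Fin (n + 1)) (β : Fin n → ℕ) (f : (Fin n → ℝ) → ℂ) :
    extendMonomial i β f = extendChart i fun y η => f y * monomialFun β η := rfl

theorem extendMonomial_mem {n : ℕ} (i : Fin (n + 1)) (β : Fin n → ℕ) {f : (Fin n → ℝ) → ℂ}
    (hf : ContDiff ℝ ∞ f) (hc : HasCompactSupport f) :
    extendMonomial i β f ∈ symbolsOfDegree n (∑ m, β m) := by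
  obtain ⟨R, hR⟩ := hc.isCompact.isBounded.exists_norm_le
  refine (isLocalSymbol_mul_monomialFun hf (R := R) (fun y hy => ?_) rfl).extendChart_mem i
  by_contra h
  exact absurd (hR y (subset_tsupport f h)) (not_le.2 hy)

theorem mem_symbols {n k : ℕ} {F : CotangentRP n → ℂ} (hF : F ∈ symbolsOfDegree n k) :
    F ∈ symbols n := Submodule.mem_iSup_of_mem k hF

theorem monomialFun_mul {ι : Type} [Fintype ι] (β : ι → ℕ) (c η : ι → ℝ) :
    monomialFun β (fun m => c m * η m) = monomialFun β c * monomialFun β η := by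
  simp [monomialFun, mul_pow, Finset.prod_mul_distrib]

theorem norm_halving_le (n : ℕ) : ‖halving (ContinuousLinearMap.proj (R := ℝ) (φ := fun _ => ℝ)
    (0 : Fin (n + 1))) (Pi.single 0 1)‖ ≤ 1 := by
  refine ContinuousLinearMap.opNorm_le_bound _ zero_le_one fun y => ?_
  rw [one_mul, pi_norm_le_iff_of_nonneg (norm_nonneg _)]
  intro m
  have hm := norm_le_pi_norm y m
  rw [halving_apply]
  by_cases h : m = 0
  · subst h
    have : y 0 - y 0 / 2 = y 0 / 2 := by ring
    simp only [ContinuousLinearMap.proj_apply, Pi.sub_apply, Pi.smul_apply, Pi.single_eq_same,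
      smul_eq_mul, mul_one, this]
    rw [norm_div, Real.norm_two]
    linarith [norm_nonneg (y 0)]
  · simpa [h] using hm

namespace IsBorelEigen

variable {l : ℕ} {L : (CotangentRP (n + 1) → ℂ) →ₗ[ℂ] ℂ}

/-- The point [e_0] lies at infinity of this chart: shears are translations of y_0, and d_0 = 1/2
halves y_0 and doubles η_0. The resulting weight 2^(-l-β_0) is at most 1 and so is never the weight
2 of Lebesgue measure. -/
theorem extendMonomial_succ_eq_zero (hL : IsBorelEigen l L) (i : Fin (n + 1))
    (β : Fin (n + 1) → ℕ) {f : (Fin (n + 1) → ℝ) → ℂ} (hf : ContDiff ℝ ∞ f)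
    (hc : HasCompactSupport f) : L (extendMonomial i.succ β f) = 0 := by
  let ℓ : (Fin (n + 1) → ℝ) →L[ℝ] ℝ := ContinuousLinearMap.proj (R := ℝ) (φ := fun _ => ℝ) 0
  have hq : (0 : ℝ) < 2⁻¹ ^ (l + β 0) := by positivity
  have hq2 : (2⁻¹ : ℝ) ^ (l + β 0) ≠ 2 :=
    ((pow_le_one₀ (by norm_num) (by norm_num)).trans_lt one_lt_two).ne
  have hμ : IsTransferEigen ℓ (Pi.single 0 1) (2⁻¹ ^ (l + β 0)) (L ∘ₗ extendMonomial i.succ β) := by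
    refine ⟨fun f hf hc => ?_, fun f hf hc => ?_⟩
    · have h := hL.shear _ (mem_symbols (extendMonomial_mem i.succ β hf hc)) i 1
      simp only [extendMonomial_apply, extendChart_shear_smul, one_smul] at h
      exact h
    · let d : Fin (n + 2) → ℝ := Fin.cons 2⁻¹ fun _ => 1
      have hd : ∀ j, 0 < d j := fun j => by
        refine Fin.cases ?_ (fun j => ?_) j <;> simp [d]
      have h := hL.torus _ (mem_symbols (extendMonomial_mem i.succ β hf hc)) d hd
      have h1 : (fun z => extendMonomial i.succ β f (ProjSymbols.torus d hd • z))
          = (2 : ℂ) ^ β 0 • extendMonomial i.succ β (fun y => f (halving ℓ (Pi.single 0 1) y)) := by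
        rw [← map_smul]
        ext z
        rw [extendMonomial_apply, extendMonomial_apply, extendChart_torus_smul]
        congr 1
        ext y η
        have e1 : (fun m => d (i.succ.succAbove m) / d i.succ * y m)
            = halving ℓ (Pi.single 0 1) y := by
          rw [halving_apply]
          ext m
          refine Fin.cases ?_ (fun m => ?_) m
          · simp [d, ℓ]; ring
          · simp [d, ℓ, Fin.succ_succAbove_succ]
        have e2 : monomialFun β (fun m => d i.succ / d (i.succ.succAbove m)) = 2 ^ β 0 := by
          rw [monomialFun, Fin.prod_univ_succ]
          simp [d, Fin.succ_succAbove_succ]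
        rw [e1, monomialFun_mul, e2]
        simp only [Pi.smul_apply, smul_eq_mul]
        ring
      rw [h1, map_smul, smul_eq_mul] at h
      have h2 : d 0 / d 1 = 2⁻¹ := by
        have : d 1 = 1 := rfl
        rw [this]; simp [d]
      rw [h2] at h
      simp only [LinearMap.comp_apply]
      push_cast at h ⊢
      have h3 : ((2 : ℂ)⁻¹) ^ β 0 * 2 ^ β 0 = 1 := by
        rw [← mul_pow]; norm_num
      rw [pow_add]
      linear_combination (2⁻¹ : ℂ) ^ β 0 * h
        - L (extendMonomial i.succ β fun y => f (halving ℓ (Pi.single 0 1) y)) * h3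
  exact hμ.eq_zero (by simp [ℓ]) (norm_halving_le n) hq hq2 hf hc

end IsBorelEigen

/-! ### Cutoff functions -/

/-- The function `x_i² / |x|²`. -/
def coordRatio {n : ℕ} (i : Fin (n + 1)) : CotangentRP n → ℝ :=
  Quotient.lift (s := cotangentSetoid n) (fun z => z.1.1 i ^ 2 / ∑ j, z.1.1 j ^ 2) (by
    rintro z w ⟨c, hc, h1, h2⟩
    simp only [h1, Pi.smul_apply, smul_eq_mul, mul_pow, ← Finset.mul_sum]
    rw [mul_div_mul_left _ _ (pow_ne_zero 2 hc)])

theorem coordRatio_mk {n : ℕ} (i : Fin (n + 1)) (x ξ : Fin (n + 1) → ℝ) (hx : x ≠ 0)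
    (h : ξ ⬝ᵥ x = 0) : coordRatio i (mk x ξ hx h) = x i ^ 2 / ∑ j, x j ^ 2 := rfl

theorem sum_sq_pos {ι : Type*} [Fintype ι] {x : ι → ℝ} (hx : x ≠ 0) : 0 < ∑ j, x j ^ 2 := by
  obtain ⟨j, hj⟩ := Function.ne_iff.1 hx
  exact Finset.sum_pos' (fun j _ => sq_nonneg _) ⟨j, Finset.mem_univ _, by
    have : x j ≠ 0 := hj
    positivity⟩

theorem sum_coordRatio {n : ℕ} (z : CotangentRP n) : ∑ i, coordRatio i z = 1 := by
  induction z using CotangentRP.ind with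
  | _ x ξ hx h =>
    simp only [coordRatio_mk]
    rw [← Finset.sum_div, div_self (sum_sq_pos hx).ne']

theorem coordRatio_chart {n : ℕ} (i : Fin (n + 1)) (y η : Fin n → ℝ) :
    coordRatio i (chart i y η) = 1 / (1 + ∑ m, y m ^ 2) := by
  rw [chart, coordRatio_mk, Fin.sum_univ_succAbove _ i]
  simp

theorem mul_coordRatio_mem {n k : ℕ} {F : CotangentRP n → ℂ} (hF : F ∈ symbolsOfDegree n k)
    (i : Fin (n + 1)) {θ : ℝ → ℝ} (hθ : ContDiff ℝ ∞ θ) :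
    (fun z => (θ (coordRatio i z) : ℂ) * F z) ∈ symbolsOfDegree n k := by
  refine ⟨fun j => ?_, fun x hx => ?_⟩
  · have hX : ContDiff ℝ ∞ (fun q : (Fin n → ℝ) × (Fin n → ℝ) =>
        j.insertNth (α := fun _ => ℝ) 1 q.1) := contDiff_insertNth j contDiff_const contDiff_fst
    have h1 : ContDiff ℝ ∞ (fun q : (Fin n → ℝ) × (Fin n → ℝ) => coordRatio i (chart j q.1 q.2)) := by
      simp only [chart, coordRatio_mk]
      exact ((contDiff_pi.1 hX i).pow 2).div
        (ContDiff.sum fun m _ => (contDiff_pi.1 hX m).pow 2)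
        (fun q => (sum_sq_pos (insertNth_ne_zero j q.1)).ne')
    exact (Complex.ofRealCLM.contDiff.comp (hθ.comp h1)).mul (hF.1 j)
  · obtain ⟨p, hp, hp'⟩ := hF.2 x hx
    refine ⟨MvPolynomial.C (θ (x i ^ 2 / ∑ j, x j ^ 2) : ℂ) * p,
      by simpa using (MvPolynomial.isHomogeneous_C _ _).mul hp, fun ξ h => ?_⟩
    simp only [coordRatio_mk]
    rw [hp', map_mul, MvPolynomial.eval_C]

/-- A symbol supported in a compact part of a chart is a sum of monomial symbols. -/
theorem exists_eq_sum_extendMonomial {n k : ℕ} {F : CotangentRP n → ℂ}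
    (hF : F ∈ symbolsOfDegree n k) (i : Fin (n + 1)) {c : ℝ} (hc : 0 < c)
    (h : ∀ z, coordRatio i z < c → F z = 0) :
    ∃ f : (Fin n → ℕ) → (Fin n → ℝ) → ℂ, (∀ β, ContDiff ℝ ∞ (f β)) ∧
      (∀ β, HasCompactSupport (f β)) ∧
      F = ∑ β ∈ Finset.piAntidiag Finset.univ k, extendMonomial i β (f β) := by
  obtain ⟨f, hf, hFf, hf0⟩ := exists_chart_coefficients hF i
  refine ⟨f, hf, fun β => ?_, ?_⟩
  -- A coordinate larger than 1/c + 1 in absolute value has a square larger than 1/c, which forces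
  -- the ratio 1/(1 + ∑ y_m²) below c.
  · refine HasCompactSupport.intro (isCompact_closedBall (0 : Fin n → ℝ) (1 / c + 1))
      fun y hy => hf0 β y fun η => h _ ?_
    rw [coordRatio_chart]
    have hy' : 1 / c + 1 < ‖y‖ := by simpa using hy
    have h1c : 0 < 1 / c := by positivity
    obtain ⟨m, hm⟩ : ∃ m, 1 / c + 1 < ‖y m‖ := by
      by_contra! hcon
      exact absurd hy' (not_lt.2 ((pi_norm_le_iff_of_nonneg (by positivity)).2 hcon))
    have h2 : y m ^ 2 ≤ ∑ m, y m ^ 2 :=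
      Finset.single_le_sum (f := fun m => y m ^ 2) (fun j _ => sq_nonneg _) (Finset.mem_univ m)
    have h3 : 1 / c < 1 + ∑ m, y m ^ 2 := by
      have : y m ^ 2 = ‖y m‖ ^ 2 := by rw [Real.norm_eq_abs, sq_abs]
      nlinarith
    rw [one_div_lt (by linarith) hc]
    exact h3
  · have h1 : F = extendChart i (fun y η => ∑ β ∈ Finset.piAntidiag Finset.univ k,
        f β y * monomialFun β η) := by
      refine eq_extendChart hFf fun x ξ hx hh hxi => h _ ?_
      rw [coordRatio_mk, hxi]
      simpa using hc
    rw [h1]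
    ext z
    induction z using CotangentRP.ind with
    | _ x ξ hx h =>
      simp only [Finset.sum_apply, extendMonomial_apply, extendChart_mk]
      split_ifs <;> simp

namespace IsBorelEigen

variable {l : ℕ} {L : (CotangentRP (n + 1) → ℂ) →ₗ[ℂ] ℂ}

theorem eq_zero_of_coordRatio (hL : IsBorelEigen l L) {k : ℕ} {F : CotangentRP (n + 1) → ℂ}
    (hF : F ∈ symbolsOfDegree (n + 1) k) (i : Fin (n + 1)) {c : ℝ} (hc : 0 < c)
    (h : ∀ z, coordRatio i.succ z < c → F z = 0) : L F = 0 := by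
  obtain ⟨f, hf, hfc, rfl⟩ := exists_eq_sum_extendMonomial hF i.succ hc h
  rw [map_sum]
  exact Finset.sum_eq_zero fun β _ => hL.extendMonomial_succ_eq_zero i β (hf β) (hfc β)

/-- A partition of unity, one chart at a time: θF lives in a compact part of the chart and is
killed, while F - θF vanishes wherever the ratios of the remaining charts are small. -/
theorem eq_zero_of_forall_coordRatio (hL : IsBorelEigen l L) {k : ℕ} {c : ℝ} (hc : 0 < c)
    (S : Finset (Fin (n + 1))) {F : CotangentRP (n + 1) → ℂ}
    (hF : F ∈ symbolsOfDegree (n + 1) k)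
    (h : ∀ z, (∀ i ∈ S, coordRatio i.succ z < c) → F z = 0) : L F = 0 := by
  induction S using Finset.induction_on generalizing F with
  | empty =>
    have : F = 0 := funext fun z => h z (by simp)
    rw [this, map_zero]
  | insert i S _ ih =>
    -- Zero up to c/2 and one from c on.
    let θ : ℝ → ℝ := fun t => Real.smoothTransition (2 * t / c - 1)
    have hθ : ContDiff ℝ ∞ θ := Real.smoothTransition.contDiff.comp (by fun_prop)
    have h1 := mul_coordRatio_mem hF i.succ hθ
    have h2 := (symbolsOfDegree (n + 1) k).sub_mem hF h1
    have h3 : L (fun z => (θ (coordRatio i.succ z) : ℂ) * F z) = 0 := by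
      refine hL.eq_zero_of_coordRatio h1 i (half_pos hc) fun z hz => ?_
      have : θ (coordRatio i.succ z) = 0 := Real.smoothTransition.zero_of_nonpos (by
        rw [sub_nonpos, div_le_one hc]; linarith)
      rw [this, Complex.ofReal_zero, zero_mul]
    have h4 := ih h2 fun z hz => by
      simp only [Pi.sub_apply]
      by_cases hzi : coordRatio i.succ z < c
      · rw [h z (by simpa [hzi] using hz), mul_zero, sub_zero]
      · have : θ (coordRatio i.succ z) = 1 := Real.smoothTransition.one_of_one_le (by
          rw [le_sub_iff_add_le, le_div_iff₀ hc]; linarith)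
        rw [this, Complex.ofReal_one, one_mul, sub_self]
    rw [map_sub, h3, sub_zero] at h4
    exact h4

/-- The functionals only depend on the germ of a symbol over the point `[e_0]`. -/
theorem eq_zero_of_germ (hL : IsBorelEigen l L) {k : ℕ} {F : CotangentRP (n + 1) → ℂ}
    (hF : F ∈ symbolsOfDegree (n + 1) k) {r : ℝ} (hr : 0 < r)
    (h : ∀ y, ‖y‖ < r → ∀ η, F (chart 0 y η) = 0) : L F = 0 := by
  have hN : (0 : ℝ) < (n + 1 : ℕ) := by positivity
  have hδ : 0 < 1 - 1 / (1 + r ^ 2) := by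
    rw [sub_pos, div_lt_one (by positivity)]
    nlinarith [sq_nonneg r, pow_pos hr 2]
  -- The threshold is chosen so that, if all n + 1 ratios other than the 0-th are below it, the 0-th
  -- exceeds 1/(1 + r²), that is ∑ y_m² < r².
  refine hL.eq_zero_of_forall_coordRatio (div_pos hδ hN) Finset.univ hF fun z hz => ?_
  have h1 := sum_coordRatio z
  rw [Fin.sum_univ_succ] at h1
  have h2 : ∑ i : Fin (n + 1), coordRatio i.succ z < 1 - 1 / (1 + r ^ 2) := by
    calc _ < ∑ i : Fin (n + 1), (1 - 1 / (1 + r ^ 2)) / (n + 1 : ℕ) :=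
          Finset.sum_lt_sum_of_nonempty Finset.univ_nonempty hz
      _ = _ := by
          rw [Finset.sum_const, Finset.card_univ, Fintype.card_fin, nsmul_eq_mul]
          field_simp
  have h3 : 1 / (1 + r ^ 2) < coordRatio 0 z := by linarith
  induction z using CotangentRP.ind with
  | _ x ξ hx hh =>
    have hx0 : x 0 ≠ 0 := by
      intro h0
      rw [coordRatio_mk, h0, zero_pow two_ne_zero, zero_div] at h3
      exact absurd h3 (not_lt.2 (by positivity))
    rw [mk_eq_chart 0 x ξ hx hh hx0] at h3 ⊢
    rw [coordRatio_chart] at h3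
    refine h _ ?_ _
    set y : Fin (n + 1) → ℝ := fun m => x ((0 : Fin (n + 2)).succAbove m) / x 0
    have hpos : 0 ≤ ∑ m, y m ^ 2 := Finset.sum_nonneg fun m _ => sq_nonneg _
    rw [one_div_lt_one_div (by positivity) (by positivity)] at h3
    rw [pi_norm_lt_iff hr]
    intro m
    have h5 : y m ^ 2 ≤ ∑ m, y m ^ 2 :=
      Finset.single_le_sum (f := fun m => y m ^ 2) (fun j _ => sq_nonneg _) (Finset.mem_univ m)
    exact abs_lt_of_sq_lt_sq (by linarith) hr.le

end IsBorelEigen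

end ProjSymbols

end Locality

/-! ### Functionals on germs of symbols over [e_0] -/

noncomputable section Germs

namespace ProjSymbols

open CotangentRP

variable {n : ℕ}

/-- A cutoff function around the origin. -/
def originBump (n : ℕ) : ContDiffBump (0 : Fin (n + 1) → ℝ) := ⟨1, 2, one_pos, one_lt_two⟩

theorem originBump_eq_one {y : Fin (n + 1) → ℝ} (hy : ‖y‖ ≤ 1) : originBump n y = 1 :=
  (originBump n).one_of_mem_closedBall (by simpa [originBump] using hy)

theorem contDiff_originBump : ContDiff ℝ ∞ (fun y => (originBump n y : ℂ)) :=
  Complex.ofRealCLM.contDiff.comp (originBump n).contDiff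

theorem hasCompactSupport_originBump : HasCompactSupport (fun y => (originBump n y : ℂ)) :=
  (originBump n).hasCompactSupport.comp_left Complex.ofReal_zero

theorem originBump_eq_zero {y : Fin (n + 1) → ℝ} (hy : 2 < ‖y‖) : originBump n y = 0 :=
  (originBump n).zero_of_le_dist (by simpa [originBump] using hy.le)

/-- Smooth functions of `(y, η)` that are homogeneous polynomials of degree `k` in `η`. -/
structure IsGermSymbol (k : ℕ) (φ : (Fin n → ℝ) → (Fin n → ℝ) → ℂ) : Prop where
  smooth : ContDiff ℝ ∞ (fun p : (Fin n → ℝ) × (Fin n → ℝ) => φ p.1 p.2)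
  poly : ∀ y, IsHomogeneousPoly k (φ y)

theorem isGermSymbol_mul_monomialFun {k : ℕ} {f : (Fin n → ℝ) → ℂ} (hf : ContDiff ℝ ∞ f)
    {β : Fin n → ℕ} (hβ : ∑ m, β m = k) : IsGermSymbol k (fun y η => f y * monomialFun β η) :=
  ⟨(hf.comp contDiff_fst).mul ((contDiff_monomialFun β).comp contDiff_snd),
    fun y => isHomogeneousPoly_monomialFun hβ (f y)⟩

theorem IsGermSymbol.sum {k : ℕ} {ι : Type*} {s : Finset ι}
    {φ : ι → (Fin n → ℝ) → (Fin n → ℝ) → ℂ} (h : ∀ i ∈ s, IsGermSymbol k (φ i)) :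
    IsGermSymbol k (∑ i ∈ s, φ i) := by
  refine ⟨?_, fun y => ?_⟩
  · simp only [Finset.sum_apply]
    exact ContDiff.sum fun i hi => (h i hi).smooth
  · have h' : ∀ i, ∃ p : MvPolynomial (Fin n) ℂ, p.IsHomogeneous k ∧ (i ∈ s → ∀ η, φ i y η =
        MvPolynomial.eval (fun j => (η j : ℂ)) p) := fun i => by
      by_cases hi : i ∈ s
      · obtain ⟨p, hp, hp'⟩ := (h i hi).poly y
        exact ⟨p, hp, fun _ => hp'⟩
      · exact ⟨0, MvPolynomial.isHomogeneous_zero _ _ _, fun h => absurd h hi⟩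
    choose p hp hp' using h'
    refine ⟨∑ i ∈ s, p i, MvPolynomial.IsHomogeneous.sum _ _ _ fun i _ => hp i, fun η => ?_⟩
    rw [map_sum, Finset.sum_apply, Finset.sum_apply]
    exact Finset.sum_congr rfl fun i hi => hp' i hi η

theorem IsGermSymbol.const_smul {k : ℕ} {φ : (Fin n → ℝ) → (Fin n → ℝ) → ℂ}
    (h : IsGermSymbol k φ) (c : ℂ) : IsGermSymbol k (c • φ) := by
  refine ⟨contDiff_const.mul h.smooth, fun y => ?_⟩
  obtain ⟨p, hp, hp'⟩ := h.poly y
  refine ⟨MvPolynomial.C c * p, by simpa using (MvPolynomial.isHomogeneous_C _ c).mul hp,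
    fun η => ?_⟩
  simp [hp']

theorem IsGermSymbol.isLocalSymbol {k : ℕ} {φ : (Fin (n + 1) → ℝ) → (Fin (n + 1) → ℝ) → ℂ}
    (h : IsGermSymbol k φ) : IsLocalSymbol k (fun y η => (originBump n y : ℂ) * φ y η) := by
  refine ⟨(contDiff_originBump.comp contDiff_fst).mul h.smooth, ⟨2, fun y η hy => ?_⟩, fun y => ?_⟩
  · rw [originBump_eq_zero hy, Complex.ofReal_zero, zero_mul]
  · obtain ⟨p, hp, hp'⟩ := h.poly y
    refine ⟨MvPolynomial.C (originBump n y : ℂ) * p,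
      by simpa using (MvPolynomial.isHomogeneous_C _ _).mul hp, fun η => ?_⟩
    simp [hp']

/-- The functional `L` on germs of symbols over the point `[e_0]`. -/
def germFunctional (L : (CotangentRP (n + 1) → ℂ) →ₗ[ℂ] ℂ) :
    ((Fin (n + 1) → ℝ) → (Fin (n + 1) → ℝ) → ℂ) →ₗ[ℂ] ℂ where
  toFun φ := L (extendChart 0 fun y η => (originBump n y : ℂ) * φ y η)
  map_add' φ ψ := by
    rw [← map_add]
    congr 1
    ext z
    induction z using CotangentRP.ind with
    | _ x ξ hx h =>
      rw [Pi.add_apply]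
      simp only [extendChart_mk]
      split_ifs <;> simp [mul_add]
  map_smul' c φ := by
    rw [RingHom.id_apply, ← map_smul]
    congr 1
    ext z
    induction z using CotangentRP.ind with
    | _ x ξ hx h =>
      rw [Pi.smul_apply]
      simp only [extendChart_mk]
      split_ifs <;> simp [mul_left_comm]

theorem monomialFun_add {ι : Type} [Fintype ι] (α β : ι → ℕ) (η : ι → ℝ) :
    monomialFun (α + β) η = monomialFun α η * monomialFun β η := by
  simp [monomialFun, pow_add, Finset.prod_mul_distrib]

theorem monomialFun_single {ι : Type} [Fintype ι] [DecidableEq ι] (i : ι) (q : ℕ) (η : ι → ℝ) :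
    monomialFun (Pi.single i q) η = (η i : ℂ) ^ q := by
  rw [monomialFun, Finset.prod_eq_single i (fun j _ hj => by simp [hj]) (by simp)]
  simp

theorem monomialFun_const {ι : Type} [Fintype ι] (β : ι → ℕ) (c : ℝ) :
    monomialFun β (fun _ => c) = (c : ℂ) ^ ∑ m, β m := by
  rw [monomialFun, Finset.prod_pow_eq_pow_sum]

namespace IsBorelEigen

variable {l k : ℕ} {L : (CotangentRP (n + 1) → ℂ) →ₗ[ℂ] ℂ}
  {φ ψ : (Fin (n + 1) → ℝ) → (Fin (n + 1) → ℝ) → ℂ}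

/-- By locality the cutoff in `germFunctional` is immaterial, and a global symbol may be replaced by
any expression that agrees with it near the origin of the chart. -/
theorem eq_germFunctional (hL : IsBorelEigen l L) {F : CotangentRP (n + 1) → ℂ}
    (hF : F ∈ symbolsOfDegree (n + 1) k) (hφ : IsGermSymbol k φ) {r : ℝ} (hr : 0 < r)
    (h : ∀ y, ‖y‖ < r → ∀ η, F (chart 0 y η) = φ y η) : L F = germFunctional L φ := by
  refine sub_eq_zero.1 ?_
  change L F - L _ = 0
  rw [← map_sub]
  refine hL.eq_zero_of_germ ((symbolsOfDegree (n + 1) k).sub_mem hF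
    (hφ.isLocalSymbol.extendChart_mem 0)) (lt_min hr one_pos) fun y hy η => ?_
  rw [Pi.sub_apply, extendChart_chart, h y (hy.trans_le (min_le_left _ _)),
    originBump_eq_one (hy.trans_le (min_le_right _ _)).le]
  simp

theorem germFunctional_congr (hL : IsBorelEigen l L) (hφ : IsGermSymbol k φ)
    (hψ : IsGermSymbol k ψ) {r : ℝ} (hr : 0 < r) (h : ∀ y, ‖y‖ < r → ∀ η, φ y η = ψ y η) :
    germFunctional L φ = germFunctional L ψ := by
  refine hL.eq_germFunctional (hφ.isLocalSymbol.extendChart_mem 0) hψ (lt_min hr one_pos)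
    fun y hy η => ?_
  rw [extendChart_chart, h y (hy.trans_le (min_le_left _ _)),
    originBump_eq_one (hy.trans_le (min_le_right _ _)).le]
  simp

theorem germFunctional_torus (hL : IsBorelEigen l L) (hφ : IsGermSymbol k φ)
    {t : Fin (n + 1) → ℝ} (ht : ∀ m, 0 < t m)
    (hψ : IsGermSymbol k fun y η => φ (fun m => t m * y m) (fun m => (t m)⁻¹ * η m)) :
    germFunctional L (fun y η => φ (fun m => t m * y m) (fun m => (t m)⁻¹ * η m))
      = ((t 0 : ℂ)⁻¹) ^ l * germFunctional L φ := by
  let d : Fin (n + 2) → ℝ := Fin.cons 1 t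
  have hd : ∀ j, 0 < d j := fun j => by
    refine Fin.cases ?_ (fun j => ?_) j
    · simp [d]
    · simpa [d] using ht j
  have hmem := hφ.isLocalSymbol.extendChart_mem 0
  have h := hL.torus _ (mem_symbols hmem) d hd
  have h2 : d 0 / d 1 = (t 0)⁻¹ := by
    have : d 1 = t 0 := rfl
    rw [this]; simp [d]
  rw [h2] at h
  push_cast at h
  refine Eq.trans ?_ h
  symm
  have hT : ContinuousAt (fun y : Fin (n + 1) → ℝ => fun m => t m * y m) 0 :=
    Continuous.continuousAt (continuous_pi fun m => by fun_prop)
  obtain ⟨r, hr, hr'⟩ := Metric.continuousAt_iff.1 hT 1 one_pos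
  refine hL.eq_germFunctional (k := k)
    ⟨hmem.1.comp_smul (ProjSymbols.torus d hd), hmem.2.comp_smul (ProjSymbols.torus d hd)⟩ hψ hr
    fun y hy η => ?_
  rw [extendChart_torus_smul, extendChart_chart]
  have h3 := hr' (x := y) (by simpa using hy)
  simp only [Pi.zero_apply, mul_zero] at h3
  have h4 : ‖fun m => t m * y m‖ < 1 := by
    have : (fun _ : Fin (n + 1) => (0 : ℝ)) = 0 := rfl
    rwa [this, dist_zero_right] at h3
  have e1 : (fun m => d ((0 : Fin (n + 2)).succAbove m) / d 0 * y m) = fun m => t m * y m := by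
    ext m; simp [d]
  have e2 : (fun m => d 0 / d ((0 : Fin (n + 2)).succAbove m) * η m) = fun m => (t m)⁻¹ * η m := by
    ext m; simp [d]
  rw [e1, e2, originBump_eq_one h4.le]
  simp

/-- A shear acts on this chart by a projective map that is singular where 1 + b y_j = 0. The
pullback of φ is therefore represented by a separate globally smooth ψ. -/
theorem germFunctional_shear (hL : IsBorelEigen l L) (hφ : IsGermSymbol k φ)
    (hψ : IsGermSymbol k ψ) (j : Fin (n + 1)) (b : ℝ)
    (h : ∀ y η, 1 + b * y j ≠ 0 → ψ y η = φ (fun m => y m / (1 + b * y j))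
      (fun m => (1 + b * y j) * (η m + Pi.single (M := fun _ => ℝ) j (b * (η ⬝ᵥ y)) m))) :
    germFunctional L ψ = germFunctional L φ := by
  have hmem := hφ.isLocalSymbol.extendChart_mem 0
  refine Eq.trans ?_ (hL.shear _ (mem_symbols hmem) j b)
  symm
  refine hL.eq_germFunctional (k := k)
    ⟨hmem.1.comp_smul (ProjSymbols.shear j b), hmem.2.comp_smul (ProjSymbols.shear j b)⟩ hψ
    -- On this ball |b y_j| ≤ 1/2, so the denominator is at least 1/2 and the image stays in the
    -- unit ball, where the cutoff is 1.
    (r := 1 / (2 * (|b| + 1))) (by positivity) fun y hy η => ?_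
  have hb : (0 : ℝ) < |b| + 1 := by positivity
  have h1 : ‖y‖ * (2 * (|b| + 1)) < 1 := by rwa [lt_div_iff₀ (by positivity)] at hy
  have h2 : |b * y j| ≤ 2⁻¹ := by
    rw [abs_mul]
    have := norm_le_pi_norm y j
    rw [Real.norm_eq_abs] at this
    nlinarith [abs_nonneg b, abs_nonneg (y j)]
  have h3 : 2⁻¹ ≤ 1 + b * y j := by linarith [(abs_le.1 h2).1]
  have h4 : 1 + b * y j ≠ 0 := by linarith
  have h5 : ‖fun m => y m / (1 + b * y j)‖ ≤ 1 := by
    rw [pi_norm_le_iff_of_nonneg zero_le_one]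
    intro m
    rw [norm_div, Real.norm_of_nonneg (r := 1 + b * y j) (by linarith), div_le_one (by linarith)]
    have := norm_le_pi_norm y m
    nlinarith [abs_nonneg b, norm_nonneg y]
  rw [shear_smul_chart_zero j b y η h4, extendChart_chart, originBump_eq_one h5, h y η h4]
  simp

/-- The torus kills all monomials that are not of the right weight. -/
theorem germFunctional_monomial_of_ne (hL : IsBorelEigen l L) (α β : Fin (n + 1) → ℕ)
    (h : β ≠ α + Pi.single 0 l) :
    germFunctional L (fun y η => monomialFun α y * monomialFun β η) = 0 := by
  obtain ⟨i, hi⟩ := Function.ne_iff.1 h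
  -- Doubling only a coordinate in which the exponents disagree separates the two weights as
  -- distinct powers of 2.
  let t : Fin (n + 1) → ℝ := fun m => if m = i then 2 else 1
  have ht : ∀ m, 0 < t m := fun m => by
    simp only [t]; split_ifs <;> norm_num
  have hg := isGermSymbol_mul_monomialFun (contDiff_monomialFun α) (rfl : ∑ m, β m = ∑ m, β m)
  have e1 : monomialFun α t = 2 ^ α i := by
    rw [monomialFun, Finset.prod_eq_single i (fun j _ hj => by simp [t, hj]) (by simp)]
    simp [t]
  have e2 : monomialFun β (fun m => (t m)⁻¹) = 2⁻¹ ^ β i := by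
    rw [monomialFun, Finset.prod_eq_single i (fun j _ hj => by simp [t, hj]) (by simp)]
    simp [t]
  have e3 : (fun y η : Fin (n + 1) → ℝ => monomialFun α (fun m => t m * y m)
      * monomialFun β (fun m => (t m)⁻¹ * η m))
      = ((2 : ℂ) ^ α i * 2⁻¹ ^ β i) • fun y η => monomialFun α y * monomialFun β η := by
    ext y η
    rw [monomialFun_mul, monomialFun_mul, e1, e2]
    simp only [Pi.smul_apply, smul_eq_mul]
    ring
  have h1 := hL.germFunctional_torus hg ht (by rw [e3]; exact hg.const_smul _)
  rw [e3, map_smul, smul_eq_mul] at h1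
  have h2 : (((t 0 : ℝ) : ℂ)⁻¹) ^ l = 2⁻¹ ^ (Pi.single (M := fun _ => ℕ) 0 l i) := by
    by_cases h0 : i = 0
    · subst h0; simp [t]
    · simp [t, h0, Ne.symm h0]
  rw [h2] at h1
  by_contra hne
  have h3 := mul_right_cancel₀ hne h1
  have h4 : (2 : ℂ) ^ (α i + Pi.single (M := fun _ => ℕ) 0 l i) = 2 ^ β i := by
    have h5 : ∀ m : ℕ, (2 : ℂ) ^ m * 2⁻¹ ^ m = 1 := fun m => by rw [← mul_pow]; norm_num
    rw [pow_add]
    linear_combination (2 : ℂ) ^ β i * 2 ^ (Pi.single (M := fun _ => ℕ) 0 l i) * h3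
      - (2 : ℂ) ^ α i * 2 ^ (Pi.single (M := fun _ => ℕ) 0 l i) * h5 (β i)
      + 2 ^ β i * h5 (Pi.single (M := fun _ => ℕ) 0 l i)
  have h6 : (2 : ℕ) ^ (α i + Pi.single (M := fun _ => ℕ) 0 l i) = 2 ^ β i := by exact_mod_cast h4
  exact hi (Nat.pow_right_injective le_rfl h6).symm

end IsBorelEigen

/-- If `∑ a_{pq} b^{p+q}` does not depend on `b`, its linear coefficient vanishes. -/
theorem linear_coefficient_eq_zero {N K : ℕ} (a : ℕ → ℕ → ℂ) (C : ℂ)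
    (h : ∀ b : ℝ, ∑ p ∈ Finset.range (N + 2), ∑ q ∈ Finset.range (K + 2),
      (b : ℂ) ^ (p + q) * a p q = C) : a 1 0 + a 0 1 = 0 := by
  let P : Polynomial ℂ := ∑ p ∈ Finset.range (N + 2), ∑ q ∈ Finset.range (K + 2),
    Polynomial.monomial (p + q) (a p q)
  have hP : P = Polynomial.C C := by
    refine Polynomial.eq_of_infinite_eval_eq _ _
      ((Set.infinite_range_of_injective Complex.ofReal_injective).mono ?_)
    rintro _ ⟨b, rfl⟩
    simp only [P, Polynomial.eval_finsetSum, Polynomial.eval_monomial, Set.mem_ofPred_eq,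
      Polynomial.eval_C, ← h b, mul_comm]
  have h1 := congrArg (fun P => Polynomial.coeff P 1) hP
  simp only [P, Polynomial.finsetSum_coeff, Polynomial.coeff_monomial, Polynomial.coeff_C,
    one_ne_zero, if_false] at h1
  rw [Finset.sum_range_succ', Finset.sum_range_succ'] at h1
  have h2 : ∑ p ∈ Finset.range N, ∑ q ∈ Finset.range (K + 2),
      (if p + 1 + 1 + q = 1 then a (p + 1 + 1) q else 0) = 0 :=
    Finset.sum_eq_zero fun p _ => Finset.sum_eq_zero fun q _ => if_neg (by omega)
  rw [h2, zero_add, Finset.sum_eq_single 0 (fun q _ hq => if_neg (by omega)) (by simp),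
    Finset.sum_eq_single 1 (fun q _ hq => if_neg (by omega)) (by simp)] at h1
  simpa using h1

namespace IsBorelEigen

variable {l k : ℕ} {L : (CotangentRP (n + 1) → ℂ) →ₗ[ℂ] ℂ}

/-- The infinitesimal form of the invariance under shears, on monomials. -/
theorem germFunctional_shear_relation (hL : IsBorelEigen l L) (α : Fin (n + 1) → ℕ)
    (j : Fin (n + 1)) :
    (l + 1 : ℂ) * germFunctional L (fun y η => monomialFun (α + Pi.single j 1) y
        * monomialFun (α + Pi.single j 1 + Pi.single 0 l) η)
      + ((α + Pi.single 0 l : Fin (n + 1) → ℕ) j + 1 : ℕ) * ∑ i, germFunctional L (fun y η =>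
        monomialFun (α + Pi.single i 1) y * monomialFun (α + Pi.single i 1 + Pi.single 0 l) η)
      = 0 := by
  set γ : Fin (n + 1) → ℕ := α + Pi.single 0 l with hγ
  have hγi : ∀ i, α + Pi.single i 1 + Pi.single 0 l = γ + Pi.single i 1 := fun i => by
    rw [hγ]; abel
  simp only [hγi]
  -- The exponent of η_j is split off because η_j is the only fibre coordinate that the shear
  -- changes other than by the common factor 1 + b y_j.
  let γ' : Fin (n + 1) → ℕ := Function.update γ j 0
  have hγ' : γ = γ' + Pi.single j (γ j) := by
    ext m
    by_cases hm : m = j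
    · subst hm; simp [γ']
    · simp [γ', hm]
  have hsum1 : ∀ (δ : Fin (n + 1) → ℕ) i q, ∑ m, (δ + Pi.single i q : Fin (n + 1) → ℕ) m = (∑ m, δ m) + q := by
    intro δ i q
    simp [Finset.sum_add_distrib]
  have hsγ : ∑ m, γ m = (∑ m, α m) + l := hsum1 _ _ _
  have hsγ' : ∑ m, γ m = (∑ m, γ' m) + γ j := by
    conv_lhs => rw [hγ']
    exact hsum1 _ _ _
  let k := (∑ m, α m) + l + 1
  let ψ : ℕ → ℕ → (Fin (n + 1) → ℝ) → (Fin (n + 1) → ℝ) → ℂ := fun p q y η =>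
    (y j : ℂ) ^ p * monomialFun α y * ((η ⬝ᵥ y : ℝ) : ℂ) ^ q
      * ((η j : ℂ) ^ (γ j + 1 - q) * monomialFun γ' η)
  -- The bound on q keeps the truncated subtraction in the exponent of η_j honest, which the degree
  -- count needs.
  have hψ : ∀ p q, q ≤ γ j + 1 → IsGermSymbol k (ψ p q) := by
    intro p q hq
    refine ⟨?_, fun y => ?_⟩
    · have c0 : ContDiff ℝ ∞ fun p : (Fin (n + 1) → ℝ) × (Fin (n + 1) → ℝ) => p.2 ⬝ᵥ p.1 := by
        simp only [dotProduct]; fun_prop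
      have c1 : ContDiff ℝ ∞ fun p : (Fin (n + 1) → ℝ) × (Fin (n + 1) → ℝ) => ((p.1 j : ℝ) : ℂ) :=
        Complex.ofRealCLM.contDiff.comp (by fun_prop)
      have c2 : ContDiff ℝ ∞ fun p : (Fin (n + 1) → ℝ) × (Fin (n + 1) → ℝ) => ((p.2 j : ℝ) : ℂ) :=
        Complex.ofRealCLM.contDiff.comp (by fun_prop)
      have c3 : ContDiff ℝ ∞ fun p : (Fin (n + 1) → ℝ) × (Fin (n + 1) → ℝ) =>
          ((p.2 ⬝ᵥ p.1 : ℝ) : ℂ) :=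
        Complex.ofRealCLM.contDiff.comp c0
      exact (((c1.pow p).mul ((contDiff_monomialFun α).comp contDiff_fst)).mul (c3.pow q)).mul
        ((c2.pow _).mul ((contDiff_monomialFun γ').comp contDiff_snd))
    · let P : MvPolynomial (Fin (n + 1)) ℂ := MvPolynomial.C ((y j : ℂ) ^ p * monomialFun α y) *
        ((∑ m, MvPolynomial.X m * MvPolynomial.C (y m : ℂ)) ^ q *
          (MvPolynomial.X j ^ (γ j + 1 - q) * ∏ m, MvPolynomial.X m ^ γ' m))
      refine ⟨P, ?_, fun η => ?_⟩
      · have h1 : (∑ m, (MvPolynomial.X m * MvPolynomial.C (y m : ℂ) :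
            MvPolynomial (Fin (n + 1)) ℂ)).IsHomogeneous 1 :=
          MvPolynomial.IsHomogeneous.sum _ _ _ fun m _ => by
            simpa using (MvPolynomial.isHomogeneous_X ℂ m).mul
              (MvPolynomial.isHomogeneous_C (Fin (n + 1)) (y m : ℂ))
        have h2 := MvPolynomial.IsHomogeneous.prod (R := ℂ) Finset.univ
          (fun m : Fin (n + 1) => MvPolynomial.X m ^ γ' m) γ'
          (fun m _ => MvPolynomial.isHomogeneous_X_pow m (γ' m))
        have h3 := (MvPolynomial.isHomogeneous_C (Fin (n + 1)) ((y j : ℂ) ^ p * monomialFun α y)).mul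
          ((h1.pow q).mul ((MvPolynomial.isHomogeneous_X_pow (R := ℂ) j (γ j + 1 - q)).mul h2))
        have h4 : 0 + (1 * q + (γ j + 1 - q + ∑ m, γ' m)) = k := by
          simp only [k]; omega
        rwa [h4] at h3
      · simp [P, ψ, monomialFun, dotProduct]
        ring
  -- The binomial expansion in b of the pullback of y^α η^(γ + e_j) under the shear. The powers of 1
  -- + b y_j from y and η combine to |γ| + 1 - |α| = l + 1, so the pullback is polynomial in b and
  -- extends across 1 + b y_j = 0.
  let φ : ℝ → (Fin (n + 1) → ℝ) → (Fin (n + 1) → ℝ) → ℂ := fun b =>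
    ∑ p ∈ Finset.range (l + 2), ∑ q ∈ Finset.range (γ j + 2),
      ((b : ℂ) ^ (p + q) * ((l + 1).choose p * (γ j + 1).choose q)) • ψ p q
  have hφ : ∀ b, IsGermSymbol k (φ b) := fun b =>
    IsGermSymbol.sum fun p _ => IsGermSymbol.sum fun q hq =>
      (hψ p q (by rw [Finset.mem_range] at hq; omega)).const_smul _
  have hφ_apply : ∀ b y η, φ b y η = (1 + b * y j : ℂ) ^ (l + 1) * monomialFun α y *
      ((η j + b * (η ⬝ᵥ y : ℝ) : ℂ) ^ (γ j + 1) * monomialFun γ' η) := by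
    intro b y η
    rw [add_comm (1 : ℂ), add_comm (η j : ℂ), mul_mul_mul_comm, add_pow, add_pow,
      Finset.sum_mul_sum]
    simp only [φ, Finset.sum_apply, Pi.smul_apply, smul_eq_mul, ψ, Finset.sum_mul]
    refine Finset.sum_congr rfl fun p _ => Finset.sum_congr rfl fun q _ => ?_
    rw [mul_pow, mul_pow, pow_add, one_pow]
    ring
  have hinv : ∀ b, germFunctional L (φ b) = germFunctional L (φ 0) := by
    intro b
    refine hL.germFunctional_shear (hφ 0) (hφ b) j b fun y η hb => ?_
    have hbc : (1 + b * y j : ℂ) ≠ 0 := by exact_mod_cast hb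
    rw [hφ_apply, hφ_apply]
    have m1 : monomialFun α (fun m => y m / (1 + b * y j))
        = monomialFun α y * ((1 + b * y j : ℂ)⁻¹) ^ ∑ m, α m := by
      have : (fun m => y m / (1 + b * y j)) = fun m => y m * (fun _ => (1 + b * y j)⁻¹) m := by
        ext m; rw [div_eq_mul_inv]
      rw [this, monomialFun_mul, monomialFun_const]
      push_cast
      rfl
    have m2 : monomialFun γ' (fun m => (1 + b * y j) *
        (η m + Pi.single (M := fun _ => ℝ) j (b * (η ⬝ᵥ y)) m))
        = (1 + b * y j : ℂ) ^ (∑ m, γ' m) * monomialFun γ' η := by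
      have h1 := monomialFun_mul γ' (fun _ => 1 + b * y j)
        (fun m => η m + Pi.single (M := fun _ => ℝ) j (b * (η ⬝ᵥ y)) m)
      rw [h1, monomialFun_const]
      push_cast
      congr 1
      refine Finset.prod_congr rfl fun m _ => ?_
      by_cases hm : m = j
      · subst hm; simp [γ']
      · simp [hm]
    rw [m1, m2]
    simp only [Pi.single_eq_same, Complex.ofReal_zero, zero_mul, add_zero, one_pow, one_mul]
    push_cast
    rw [mul_pow]
    have h3 : (1 + b * y j : ℂ) ^ (l + 1) = ((1 + b * y j : ℂ)⁻¹) ^ (∑ m, α m) *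
        ((1 + b * y j : ℂ) ^ (γ j + 1) * (1 + b * y j : ℂ) ^ ∑ m, γ' m) := by
      rw [← pow_add]
      have : γ j + 1 + ∑ m, γ' m = (∑ m, α m) + (l + 1) := by omega
      rw [this, pow_add _ (∑ m, α m), ← mul_assoc, ← mul_pow, inv_mul_cancel₀ hbc, one_pow, one_mul]
    rw [h3]
    ring
  have h0 := linear_coefficient_eq_zero (N := l) (K := γ j)
    (fun p q => ((l + 1).choose p * (γ j + 1).choose q : ℂ) * germFunctional L (ψ p q))
    (germFunctional L (φ 0)) (fun b => by
      rw [← hinv b]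
      simp only [φ, map_sum, map_smul, smul_eq_mul, mul_assoc])
  have e10 : ψ 1 0 = fun y η => monomialFun (α + Pi.single j 1) y
      * monomialFun (γ + Pi.single j 1) η := by
    ext y η
    simp only [ψ]
    conv_rhs => rw [hγ']
    simp only [monomialFun_add, monomialFun_single, Nat.sub_zero, pow_succ, pow_zero]
    ring
  have e01 : ψ 0 1 = ∑ i, fun y η => monomialFun (α + Pi.single i 1) y
      * monomialFun (γ + Pi.single i 1) η := by
    ext y η
    simp only [Finset.sum_apply, ψ, monomialFun_add, monomialFun_single, pow_one]
    have : monomialFun γ η = monomialFun γ' η * (η j : ℂ) ^ γ j := by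
      conv_lhs => rw [hγ']
      rw [monomialFun_add, monomialFun_single]
    rw [this, Nat.add_sub_cancel]
    simp only [dotProduct, Complex.ofReal_sum, Complex.ofReal_mul, Finset.mul_sum, Finset.sum_mul]
    refine Finset.sum_congr rfl fun i _ => ?_
    ring
  rw [e10, e01, map_sum] at h0
  simp only [Nat.choose_one_right, Nat.choose_zero_right] at h0
  push_cast at h0 ⊢
  linear_combination h0

/-- After the torus only u_j, the value on y^(α+e_j) η^(α+e_j+l e_0), is in doubt. The shear
relations read (l + 1) u_j + (γ_j + 1) S = 0 with S = ∑ u_i and γ = α + l e_0. Summing over j gives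
a positive multiple of S, so S = 0 and then every u_j = 0. -/
theorem germFunctional_monomial (hL : IsBorelEigen l L) (α β : Fin (n + 1) → ℕ)
    (h : ¬ (α = 0 ∧ β = Pi.single 0 l)) :
    germFunctional L (fun y η => monomialFun α y * monomialFun β η) = 0 := by
  by_cases hβ : β = α + Pi.single 0 l
  · have hα : α ≠ 0 := fun h0 => h ⟨h0, by simpa [h0] using hβ⟩
    obtain ⟨j, hj⟩ := Function.ne_iff.1 hα
    obtain ⟨α', rfl⟩ : ∃ α' : Fin (n + 1) → ℕ, α = α' + Pi.single j 1 := by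
      refine ⟨α - Pi.single j 1, ?_⟩
      ext m
      by_cases hm : m = j
      · subst hm
        simp only [Pi.add_apply, Pi.sub_apply, Pi.single_eq_same]
        have : α m ≠ 0 := hj
        omega
      · simp [hm]
    subst hβ
    have hrel := hL.germFunctional_shear_relation α'
    set S := ∑ i, germFunctional L (fun y η =>
      monomialFun (α' + Pi.single i 1) y * monomialFun (α' + Pi.single i 1 + Pi.single 0 l) η) with hS
    have hsum : (l + 1 : ℂ) * S + (∑ i, ((α' + Pi.single 0 l : Fin (n + 1) → ℕ) i + 1) : ℕ) * S = 0 := by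
      have := Finset.sum_eq_zero (s := Finset.univ) fun i _ => hrel i
      rw [Finset.sum_add_distrib, ← Finset.mul_sum, ← Finset.sum_mul, ← hS] at this
      push_cast at this ⊢
      exact this
    have hS0 : S = 0 := by
      rw [← add_mul] at hsum
      refine (mul_eq_zero.1 hsum).resolve_left ?_
      have : ((l + 1 + ∑ i, ((α' + Pi.single 0 l : Fin (n + 1) → ℕ) i + 1) : ℕ) : ℂ) ≠ 0 :=
        Nat.cast_ne_zero.2 (by omega)
      push_cast at this ⊢
      exact this
    have h1 := hrel j
    rw [hS0, mul_zero, add_zero] at h1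
    exact (mul_eq_zero.1 h1).resolve_left (by exact_mod_cast Nat.succ_ne_zero l)
  · exact hL.germFunctional_monomial_of_ne α β hβ

/-- The functionals vanish on symbols that are sufficiently flat at `[e_0]`. -/
theorem germFunctional_flat (hL : IsBorelEigen l L) {γ β : Fin (n + 1) → ℕ}
    (hγ : ∑ m, β m < ∑ m, γ m) {f : (Fin (n + 1) → ℝ) → ℂ} (hf : ContDiff ℝ ∞ f) :
    germFunctional L (fun y η => monomialFun γ y * f y * monomialFun β η) = 0 := by
  set k := ∑ m, β m with hk
  have hgerm : ∀ {g : (Fin (n + 1) → ℝ) → ℂ}, ContDiff ℝ ∞ g →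
      IsGermSymbol k (fun y η => monomialFun γ y * g y * monomialFun β η) := fun hg =>
    isGermSymbol_mul_monomialFun ((contDiff_monomialFun γ).mul hg) rfl
  -- The cutoff makes all derivatives bounded, as the series of dilates requires.
  let g : (Fin (n + 1) → ℝ) → ℂ := fun y => (originBump n y : ℂ) * f y
  have hg : ContDiff ℝ ∞ g := contDiff_originBump.mul hf
  have hgc : HasCompactSupport g := hasCompactSupport_originBump.mul_right
  have hfg : germFunctional L (fun y η => monomialFun γ y * f y * monomialFun β η)
      = germFunctional L (fun y η => monomialFun γ y * g y * monomialFun β η) :=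
    hL.germFunctional_congr (hgerm hf) (hgerm hg) one_pos fun y hy η => by
      simp [g, originBump_eq_one hy.le]
  rw [hfg]
  obtain ⟨s, hs⟩ : ∃ s, ∑ m, γ m + l = k + 1 + s := ⟨∑ m, γ m + l - (k + 1), by omega⟩
  -- Here s + 1 = |γ| + l - |β|, so c is the factor by which the dilation y ↦ y/2 relates the values
  -- on y^γ h(y) η^β and y^γ h(y/2) η^β. The condition |β| < |γ| makes |c| < 1.
  let c : ℂ := 2⁻¹ ^ (s + 1)
  have hc : ‖c‖ < 1 := by
    simp only [c, norm_pow, norm_inv, Complex.norm_ofNat]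
    exact pow_lt_one₀ (by norm_num) (by norm_num) (by omega)
  have hcs : Summable fun i : ℕ => ‖c ^ i‖ := by
    simp only [norm_pow]
    exact summable_geometric_of_lt_one (norm_nonneg _) hc
  let A : ℕ → (Fin (n + 1) → ℝ) →L[ℝ] (Fin (n + 1) → ℝ) := fun i =>
    ((2⁻¹ : ℝ) ^ i) • ContinuousLinearMap.id ℝ _
  have hA : ∀ i, ‖A i‖ ≤ 1 := fun i => by
    refine ContinuousLinearMap.opNorm_le_bound _ zero_le_one fun y => ?_
    simp only [A, smul_apply, ContinuousLinearMap.id_apply, norm_smul]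
    refine mul_le_mul_of_nonneg_right ?_ (norm_nonneg _)
    rw [norm_pow]
    exact pow_le_one₀ (norm_nonneg _) (by norm_num)
  have hgb := exists_bound_iteratedFDeriv_of_hasCompactSupport hg hgc
  -- The solution of h(y) - c h(y/2) = g(y); by the choice of c the functional takes equal values on
  -- the two terms on the left, hence 0 on g.
  let h : (Fin (n + 1) → ℝ) → ℂ := fun y => ∑' i, c ^ i * g (A i y)
  have hh : ContDiff ℝ ∞ h := contDiff_tsum_comp_linear hg hgb hcs A hA
  have hsm : ∀ y, Summable fun i => c ^ i * g (A i y) := by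
    obtain ⟨B, hB⟩ := hgc.exists_bound_of_continuous hg.continuous
    intro y
    refine Summable.of_norm_bounded (hcs.mul_right B) fun i => ?_
    rw [norm_mul]
    exact mul_le_mul_of_nonneg_left (hB _) (norm_nonneg _)
  have hrec : ∀ y, h y = g y + c * h (fun m => 2⁻¹ * y m) := by
    intro y
    simp only [h]
    rw [(hsm y).tsum_eq_zero_add, ← tsum_mul_left]
    congr 1
    · simp [A]
    · refine tsum_congr fun i => ?_
      rw [pow_succ', mul_assoc]
      congr 3
      ext m
      simp only [A, smul_apply, ContinuousLinearMap.id_apply, Pi.smul_apply,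
        smul_eq_mul, pow_succ]
      ring
  have hh2 : ContDiff ℝ ∞ (fun y : Fin (n + 1) → ℝ => h fun m => 2⁻¹ * y m) :=
    hh.comp (contDiff_pi.2 fun m => by fun_prop)
  have hT : (fun y η : Fin (n + 1) → ℝ => monomialFun γ (fun m => 2⁻¹ * y m) *
      h (fun m => 2⁻¹ * y m) * monomialFun β (fun m => (2⁻¹ : ℝ)⁻¹ * η m))
      = ((2⁻¹ : ℂ) ^ (∑ m, γ m) * 2 ^ k) • fun y η : Fin (n + 1) → ℝ =>
        monomialFun γ y * h (fun m => 2⁻¹ * y m) * monomialFun β η := by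
    ext y η
    rw [monomialFun_mul γ (fun _ => 2⁻¹), monomialFun_mul β (fun _ => (2⁻¹ : ℝ)⁻¹),
      monomialFun_const, monomialFun_const]
    simp only [Pi.smul_apply, smul_eq_mul, inv_inv]
    push_cast
    ring
  have h1 := hL.germFunctional_torus (hgerm hh) (t := fun _ => 2⁻¹) (fun _ => by norm_num)
    (by rw [hT]; exact (hgerm hh2).const_smul _)
  rw [hT, map_smul, smul_eq_mul] at h1
  have h2 : (fun y η : Fin (n + 1) → ℝ => monomialFun γ y * h y * monomialFun β η)
      = (fun y η => monomialFun γ y * g y * monomialFun β η) +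
        c • (fun y η => monomialFun γ y * h (fun m => 2⁻¹ * y m) * monomialFun β η) := by
    ext y η
    simp only [Pi.add_apply, Pi.smul_apply, smul_eq_mul]
    rw [hrec y]
    ring
  have h3 := congrArg (germFunctional L) h2
  rw [map_add, map_smul, smul_eq_mul] at h3
  push_cast at h1
  rw [inv_inv] at h1
  have h4 : c = 2⁻¹ ^ l * ((2⁻¹ : ℂ) ^ (∑ m, γ m) * 2 ^ k) := by
    have h5 : (2⁻¹ : ℂ) ^ k * 2 ^ k = 1 := by rw [← mul_pow]; norm_num
    rw [← mul_assoc, ← pow_add, add_comm l, hs, add_assoc, add_comm 1 s, pow_add]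
    linear_combination -c * h5
  have h6 : (2⁻¹ : ℂ) ^ l * 2 ^ l = 1 := by rw [← mul_pow]; norm_num
  rw [h4, mul_assoc, h1, ← mul_assoc, h6, one_mul] at h3
  linear_combination -h3

/-- Hadamard's lemma reduces smooth coefficients to monomials. -/
theorem germFunctional_smooth (hL : IsBorelEigen l L) {β : Fin (n + 1) → ℕ}
    (γ : Fin (n + 1) → ℕ) (h : ∀ α, γ ≤ α →
      germFunctional L (fun y η => monomialFun α y * monomialFun β η) = 0)
    {f : (Fin (n + 1) → ℝ) → ℂ} (hf : ContDiff ℝ ∞ f) :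
    germFunctional L (fun y η => monomialFun γ y * f y * monomialFun β η) = 0 := by
  -- The induction is on the number of Hadamard expansions still needed to bring |γ| above |β|,
  -- where `germFunctional_flat` takes over.
  obtain ⟨d, hd⟩ : ∃ d, ∑ m, β m < ∑ m, γ m + d := ⟨∑ m, β m + 1, by omega⟩
  induction d generalizing γ f with
  | zero => exact hL.germFunctional_flat (by simpa using hd) hf
  | succ d ih =>
    obtain ⟨g, hg, hfg⟩ := exists_eq_add_sum_mul hf
    have h1 : (fun y η : Fin (n + 1) → ℝ => monomialFun γ y * f y * monomialFun β η)
        = f 0 • (fun y η => monomialFun γ y * monomialFun β η) +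
          ∑ i, fun y η => monomialFun (γ + Pi.single i 1) y * g i y * monomialFun β η := by
      ext y η
      simp only [Pi.add_apply, Pi.smul_apply, smul_eq_mul, Finset.sum_apply, monomialFun_add,
        monomialFun_single, pow_one]
      rw [hfg y, mul_add, add_mul, Finset.mul_sum, Finset.sum_mul]
      congr 1
      · ring
      · exact Finset.sum_congr rfl fun i _ => by ring
    rw [h1, map_add, map_smul, h γ le_rfl, smul_zero, zero_add, map_sum]
    refine Finset.sum_eq_zero fun i _ => ih _ (fun α hα => h α ?_) (hg i) ?_
    · exact le_trans (by intro m; simp) hα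
    · simp only [Pi.add_apply, Finset.sum_add_distrib, Finset.sum_pi_single', Finset.mem_univ,
        if_true]
      omega

/-- The only monomial not killed is η_0^l with constant coefficient. If β = l e_0, the condition
f(0) = 0 lets f be divided by the coordinates, and no constant term remains. -/
theorem germFunctional_mul_monomialFun (hL : IsBorelEigen l L) {β : Fin (n + 1) → ℕ}
    {f : (Fin (n + 1) → ℝ) → ℂ} (hf : ContDiff ℝ ∞ f) (h : β = Pi.single 0 l → f 0 = 0) :
    germFunctional L (fun y η => f y * monomialFun β η) = 0 := by
  by_cases hβ : β = Pi.single 0 l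
  · obtain ⟨g, hg, hfg⟩ := exists_eq_add_sum_mul hf
    have h1 : (fun y η : Fin (n + 1) → ℝ => f y * monomialFun β η)
        = ∑ i, fun y η => monomialFun (Pi.single i 1) y * g i y * monomialFun β η := by
      ext y η
      simp only [Finset.sum_apply, monomialFun_single, pow_one]
      rw [hfg y, h hβ, zero_add, Finset.sum_mul]
    rw [h1, map_sum]
    refine Finset.sum_eq_zero fun i _ => hL.germFunctional_smooth _ (fun α hα => ?_) (hg i)
    refine hL.germFunctional_monomial α β fun h0 => ?_
    have := hα i
    simp [h0.1] at this
  · have h1 := hL.germFunctional_smooth 0 (fun α _ => hL.germFunctional_monomial α β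
      fun h0 => hβ h0.2) hf
    simpa [monomialFun] using h1

/-- On symbols of degree `k`, a functional of weight `l` vanishes if `l ≠ k`, and for `l = k` it
vanishes on the symbols that are zero at the covector `dy_0` over `[e_0]`. -/
theorem eq_zero (hL : IsBorelEigen l L) {F : CotangentRP (n + 1) → ℂ}
    (hF : F ∈ symbolsOfDegree (n + 1) k) (h : l = k → F (chart 0 0 (Pi.single 0 1)) = 0) :
    L F = 0 := by
  obtain ⟨f, hf, hFf, -⟩ := exists_chart_coefficients hF 0
  have h1 : ∀ β ∈ Finset.piAntidiag Finset.univ k,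
      IsGermSymbol k (fun (y η : Fin (n + 1) → ℝ) => f β y * monomialFun β η) := fun β hβ =>
    isGermSymbol_mul_monomialFun (hf β) (by simpa using hβ)
  rw [hL.eq_germFunctional hF (IsGermSymbol.sum h1) one_pos (fun y _ η => by
    rw [hFf]; simp), map_sum]
  refine Finset.sum_eq_zero fun β hβ => hL.germFunctional_mul_monomialFun (hf β) fun hβl => ?_
  have hk : ∑ m, β m = k := by simpa using hβ
  have hlk : l = k := by rw [← hk, hβl]; simp
  have h2 := h hlk
  rw [hFf, Finset.sum_eq_single β] at h2
  · have : monomialFun β (Pi.single 0 1) = 1 := by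
      rw [hβl, monomialFun_single]; simp
    rwa [this, mul_one] at h2
  -- A monomial of degree k other than η_0^k contains some η_m with m ≠ 0 and vanishes at dy_0, so
  -- the value of F there is exactly f_β(0).
  · intro δ hδ hne
    have : ∃ m, m ≠ 0 ∧ δ m ≠ 0 := by
      by_contra! hcon
      apply hne
      have hδk : ∑ m, δ m = k := by simpa using hδ
      rw [Finset.sum_eq_single 0 (fun m _ hm => hcon m hm) (by simp)] at hδk
      rw [hβl]
      ext m
      by_cases hm : m = 0
      · subst hm; simp [hδk, hlk]
      · simp [hm, hcon m hm]
    obtain ⟨m, hm, hδm⟩ := this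
    rw [monomialFun, Finset.prod_eq_zero (Finset.mem_univ m), mul_zero]
    simp [hm, hδm]
  · intro h3; exact absurd hβ h3

end IsBorelEigen

end ProjSymbols

end Germs

/-! ### Normal form of covectors, and scalar action on each degree -/

noncomputable section Commutant

namespace ProjSymbols

open CotangentRP

variable {n : ℕ}

/-- The determinant is corrected by rescaling the basis vector e_1, which leaves the image of e_0
alone and only changes the multiple s. A free scalar s in the normal form is what permits
determinant 1. -/
theorem exists_sl_of_injective (h : (Fin (n + 2) → ℝ) →ₗ[ℝ] (Fin (n + 2) → ℝ))
    (hh : Function.Injective h) {x ξ : Fin (n + 2) → ℝ} {r : ℝ} (hx : h (Pi.single 0 1) = x)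
    (hξ : ∀ v, ξ ⬝ᵥ h v = r * v 1) :
    ∃ (g : Matrix.SpecialLinearGroup (Fin (n + 2)) ℝ) (s : ℝ), g.1 *ᵥ Pi.single 0 1 = x ∧
      ξ ᵥ* g.1 = Pi.single 1 s := by
  let H := LinearMap.toMatrix' h
  have hH : ∀ v, H *ᵥ v = h v := fun v => LinearMap.toMatrix'_mulVec h v
  have hdet : H.det ≠ 0 := by
    have : Function.Injective H.mulVec := by
      have e : H.mulVec = h := funext hH
      rwa [e]
    exact ((Matrix.isUnit_iff_isUnit_det H).1 (Matrix.mulVec_injective_iff_isUnit.1 this)).ne_zero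
  let d : Fin (n + 2) → ℝ := Function.update 1 1 H.det⁻¹
  refine ⟨⟨H * Matrix.diagonal d, ?_⟩, r * H.det⁻¹, ?_, ?_⟩
  · rw [Matrix.det_mul, Matrix.det_diagonal, Finset.prod_update_of_mem (Finset.mem_univ _)]
    simp [hdet]
  · change (H * Matrix.diagonal d) *ᵥ Pi.single 0 1 = x
    rw [← Matrix.mulVec_mulVec]
    have : Matrix.diagonal d *ᵥ Pi.single 0 1 = Pi.single 0 1 := by
      ext m
      rw [Matrix.mulVec_diagonal]
      by_cases hm : m = 0
      · subst hm; simp [d]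
      · simp [hm]
    rw [this, hH, hx]
  · change ξ ᵥ* (H * Matrix.diagonal d) = _
    have h1 : ξ ᵥ* H = Pi.single 1 r := by
      ext m
      have := hξ (Pi.single m 1)
      rw [← hH, Matrix.dotProduct_mulVec] at this
      simp only [dotProduct_single, mul_one] at this
      rw [this]
      by_cases hm : m = 1
      · subst hm; simp
      · simp [hm, Ne.symm hm]
    rw [← Matrix.vecMul_vecMul, h1]
    ext m
    rw [Matrix.vecMul_diagonal]
    by_cases hm : m = 1
    · subst hm; simp [d]
    · simp [hm]

/-- Any pair of a nonzero vector and a linear form that vanishes on it can be brought to the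
normal form `(e_0, s ε_1)`. -/
theorem exists_sl_normal_form {x ξ : Fin (n + 2) → ℝ} (hx : x ≠ 0) (hξ : ξ ⬝ᵥ x = 0) :
    ∃ (g : Matrix.SpecialLinearGroup (Fin (n + 2)) ℝ) (s : ℝ), g.1 *ᵥ Pi.single 0 1 = x ∧
      ξ ᵥ* g.1 = Pi.single 1 s := by
  obtain ⟨B, hB⟩ := SeparatingDual.exists_continuousLinearEquiv_apply_eq (R := ℝ)
    (x := (Pi.single 0 1 : Fin (n + 2) → ℝ)) (by simp) hx
  by_cases hξ0 : ξ = 0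
  · exact exists_sl_of_injective (r := 0) B.toLinearEquiv.toLinearMap B.injective hB
      (fun v => by simp [hξ0])
  · let f : (Fin (n + 2) → ℝ) →ₗ[ℝ] ℝ :=
      (dotProductBilin ℝ ℝ ξ) ∘ₗ B.toLinearEquiv.toLinearMap
    have hf : ∀ v, f v = ξ ⬝ᵥ B v := fun v => rfl
    have hf0 : f (Pi.single 0 1) = 0 := by rw [hf, hB, hξ]
    -- Two nonzero forms, v ↦ v_1 and f, do not vanish simultaneously on a union of hyperplanes:
    -- some vector lies outside both kernels.
    obtain ⟨w, hw1, hw⟩ : ∃ w : Fin (n + 2) → ℝ, w 1 ≠ 0 ∧ f w ≠ 0 := by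
      by_cases h1 : f (Pi.single 1 1) = 0
      · obtain ⟨v, hv⟩ : ∃ v, f v ≠ 0 := by
          by_contra! hcon
          refine hξ0 (dotProduct_eq_zero _ fun v => ?_)
          have := hcon (B.symm v)
          rwa [hf, ContinuousLinearEquiv.apply_symm_apply] at this
        by_cases hv1 : v 1 = 0
        · exact ⟨Pi.single 1 1 + v, by simp [hv1], by rwa [map_add, h1, zero_add]⟩
        · exact ⟨v, hv1, hv⟩
      · exact ⟨Pi.single 1 1, by simp, h1⟩
    -- A rank one correction of the identity that turns f into the coordinate v_1. It fixes e_0,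
    -- where both forms vanish; f(w) ≠ 0 allows the division and w_1 ≠ 0 gives injectivity.
    let T : (Fin (n + 2) → ℝ) →ₗ[ℝ] (Fin (n + 2) → ℝ) :=
      LinearMap.id + (((f w)⁻¹ • (LinearMap.proj 1 - f)).smulRight w)
    have hT : ∀ v, T v = v + ((f w)⁻¹ * (v 1 - f v)) • w := fun v => rfl
    have hfT : ∀ v, f (T v) = v 1 := fun v => by
      rw [hT, map_add, map_smul, smul_eq_mul]
      field_simp
      ring
    have hTinj : Function.Injective T := by
      refine (injective_iff_map_eq_zero T).2 fun v hv => ?_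
      have h1 : v 1 = 0 := by rw [← hfT v, hv, map_zero]
      have h2 := hT v
      rw [hv, h1] at h2
      have h3 := congrFun h2 1
      simp only [Pi.zero_apply, Pi.add_apply, Pi.smul_apply, smul_eq_mul, h1, zero_add] at h3
      have h4 := (mul_eq_zero.1 h3.symm).resolve_right hw1
      rw [h4, zero_smul, add_zero] at h2
      exact h2.symm
    refine exists_sl_of_injective (r := 1) (B.toLinearEquiv.toLinearMap ∘ₗ T)
      (B.injective.comp hTinj) ?_ fun v => ?_
    · have : T (Pi.single 0 1) = Pi.single 0 1 := by rw [hT, hf0]; simp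
      rw [LinearMap.comp_apply, this]
      exact hB
    · rw [one_mul]
      exact hfT _

/-- The base covector `dy_0` at the point `[e_0]`. -/
def basePoint (n : ℕ) : CotangentRP (n + 1) := chart 0 0 (Pi.single 0 1)

theorem basePoint_eq : basePoint n = mk (Pi.single 0 1) (Pi.single 1 1) (by simp) (by simp) := by
  have h1 : Fin.insertNth (α := fun _ => ℝ) (0 : Fin (n + 2)) 1 (0 : Fin (n + 1) → ℝ)
      = Pi.single 0 1 := by
    ext m; refine Fin.cases ?_ (fun m => ?_) m <;> simp
  have h2 : Fin.insertNth (α := fun _ => ℝ) (0 : Fin (n + 2))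
      (-((Pi.single 0 1 : Fin (n + 1) → ℝ) ⬝ᵥ 0)) (Pi.single 0 1 : Fin (n + 1) → ℝ)
      = Pi.single 1 1 := by
    ext m
    refine Fin.cases ?_ (fun m => ?_) m
    · simp
    · by_cases hm : m = 0
      · subst hm; simp
      · have : m.succ ≠ 1 := fun h => hm (Fin.succ_injective _ h)
        simp [hm, this]
  simp only [basePoint, chart, h1, h2]

/-- An equivariant operator is thus determined by the values of its images on one line in one fibre.
-/
theorem exists_smul_fiberScale_basePoint (z : CotangentRP (n + 1)) :
    ∃ (g : Matrix.SpecialLinearGroup (Fin (n + 2)) ℝ) (s : ℝ),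
      g • fiberScale s (basePoint n) = z := by
  induction z using CotangentRP.ind with
  | _ x ξ hx h =>
    obtain ⟨g, s, h1, h2⟩ := exists_sl_normal_form hx h
    refine ⟨g, s, ?_⟩
    rw [basePoint_eq, fiberScale_mk, smul_mk]
    have h3 : (s • Pi.single 1 1 : Fin (n + 2) → ℝ) ᵥ* (g⁻¹).1 = ξ := by
      have : (s • Pi.single 1 1 : Fin (n + 2) → ℝ) = Pi.single 1 s := by
        rw [← Pi.single_smul, smul_eq_mul, mul_one]
      rw [this, ← h2, Matrix.vecMul_vecMul, ← Matrix.SpecialLinearGroup.coe_mul, mul_inv_cancel]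
      simp
    simp only [h1, h3]

theorem shear_smul_basePoint (i : Fin (n + 1)) (b : ℝ) :
    shear i b • basePoint n = basePoint n := by
  rw [basePoint, shear_smul_chart_zero i b _ _ (by simp)]
  congr 1
  · ext m; simp
  · ext m; simp

theorem torus_smul_basePoint (d : Fin (n + 2) → ℝ) (hd : ∀ j, 0 < d j) :
    torus d hd • basePoint n = fiberScale (d 0 / d 1) (basePoint n) := by
  have e1 : (fun j => d j * (Pi.single 0 1 : Fin (n + 2) → ℝ) j) = d 0 • Pi.single 0 1 := by
    ext j
    by_cases hj : j = 0
    · subst hj; simp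
    · simp [hj]
  have e2 : (fun j => (Pi.single 1 1 : Fin (n + 2) → ℝ) j / d j) = (d 1)⁻¹ • Pi.single 1 1 := by
    ext j
    by_cases hj : j = 1
    · subst hj; simp
    · simp [hj]
  rw [basePoint_eq, fiberScale_mk, torus_smul_mk d hd _ _ _ _
    (by rw [e1]; simp [(hd 0).ne']) (by rw [e1, e2]; simp)]
  refine Quotient.sound (s := cotangentSetoid (n + 1)) ⟨(d 0)⁻¹, inv_ne_zero (hd 0).ne', ?_, ?_⟩
  · change Pi.single 0 1 = (d 0)⁻¹ • (fun j => d j * (Pi.single 0 1 : Fin (n + 2) → ℝ) j)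
    rw [e1, smul_smul, inv_mul_cancel₀ (hd 0).ne', one_smul]
  · change (d 0 / d 1) • (Pi.single 1 1 : Fin (n + 2) → ℝ)
      = (d 0)⁻¹⁻¹ • (fun j => (Pi.single 1 1 : Fin (n + 2) → ℝ) j / d j)
    rw [e2, smul_smul, inv_inv, div_eq_mul_inv]

/-! ### The restriction of a symbol to a line in a fibre -/

theorem exists_polynomial_fiberScale {n : ℕ} {G : CotangentRP n → ℂ} (hG : G ∈ symbols n)
    (z : CotangentRP n) : ∃ P : Polynomial ℂ, ∀ t : ℝ, G (fiberScale t z) = P.eval (t : ℂ) := by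
  induction hG using Submodule.iSup_induction' with
  | mem k F hF =>
    exact ⟨Polynomial.monomial k (F z), fun t => by
      rw [fiberScale_of_homogeneous hF.2, Polynomial.eval_monomial, mul_comm]⟩
  | zero => exact ⟨0, fun t => by simp⟩
  | add F G _ _ hF hG =>
    obtain ⟨P, hP⟩ := hF
    obtain ⟨Q, hQ⟩ := hG
    exact ⟨P + Q, fun t => by simp [hP, hQ]⟩

theorem polynomial_ext_real {P Q : Polynomial ℂ} (h : ∀ t : ℝ, P.eval (t : ℂ) = Q.eval (t : ℂ)) :
    P = Q :=
  Polynomial.eq_of_infinite_eval_eq _ _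
    ((Set.infinite_range_of_injective Complex.ofReal_injective).mono (by
      rintro _ ⟨t, rfl⟩; exact h t))

/-- The polynomial `t ↦ G(t z)`. -/
def fiberPolynomial {n : ℕ} (z : CotangentRP n) : symbols n →ₗ[ℂ] Polynomial ℂ where
  toFun G := (exists_polynomial_fiberScale G.2 z).choose
  map_add' F G := polynomial_ext_real fun t => by
    rw [Polynomial.eval_add, ← (exists_polynomial_fiberScale F.2 z).choose_spec,
      ← (exists_polynomial_fiberScale G.2 z).choose_spec,
      ← (exists_polynomial_fiberScale (F + G).2 z).choose_spec]
    rfl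
  map_smul' c F := polynomial_ext_real fun t => by
    rw [RingHom.id_apply, Polynomial.eval_smul, ← (exists_polynomial_fiberScale F.2 z).choose_spec,
      ← (exists_polynomial_fiberScale (c • F).2 z).choose_spec]
    rfl

theorem eval_fiberPolynomial {n : ℕ} (z : CotangentRP n) (G : symbols n) (t : ℝ) :
    (fiberPolynomial z G).eval (t : ℂ) = G.1 (fiberScale t z) :=
  ((exists_polynomial_fiberScale G.2 z).choose_spec t).symm

theorem fiberPolynomial_liftedAction {n : ℕ} {z : CotangentRP n}
    {g : Matrix.SpecialLinearGroup (Fin (n + 1)) ℝ} {r : ℝ} (h : g⁻¹ • z = fiberScale r z)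
    (G : symbols n) : fiberPolynomial z (liftedAction n g G)
      = (fiberPolynomial z G).comp (Polynomial.C (r : ℂ) * Polynomial.X) := by
  refine polynomial_ext_real fun t => ?_
  have h1 : fiberScale t (fiberScale r z) = fiberScale (r * t) z := by
    induction z using CotangentRP.ind with
    | _ x ξ hx hh => simp only [fiberScale_mk, smul_smul, mul_comm]
  rw [eval_fiberPolynomial, Polynomial.eval_comp, Polynomial.eval_mul, Polynomial.eval_C,
    Polynomial.eval_X, ← Complex.ofReal_mul, eval_fiberPolynomial, ← h1, ← h, ← smul_fiberScale]
  rfl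

theorem mem_commutant_iff {n : ℕ} {A : Module.End ℂ (symbols n)} :
    A ∈ commutant n ↔ ∀ g F, A (liftedAction n g F) = liftedAction n g (A F) := by
  rw [commutant, Subalgebra.mem_centralizer_iff]
  constructor
  · intro h g F
    exact (congrArg (fun T => T F) (h _ ⟨g, rfl⟩)).symm
  · rintro h _ ⟨g, rfl⟩
    exact LinearMap.ext fun F => (h g F).symm

/-- Shears fix dy_0 and diagonal matrices rescale it by r = d_0/d_1, so the l-th coefficient of t ↦
(AF)(t dy_0) is multiplied by r^l. All l are considered, since AF may a priori mix degrees even if F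
is homogeneous. -/
theorem exists_isBorelEigen {A : Module.End ℂ (symbols (n + 1))} (hA : A ∈ commutant (n + 1))
    (l : ℕ) : ∃ L : (CotangentRP (n + 1) → ℂ) →ₗ[ℂ] ℂ, IsBorelEigen l L ∧
      ∀ F : symbols (n + 1), L F.1 = (fiberPolynomial (basePoint n) (A F)).coeff l := by
  -- A purely algebraic extension from symbols to all functions; the values outside the symbols are
  -- irrelevant.
  obtain ⟨L, hL⟩ := LinearMap.exists_extend
    (Polynomial.lcoeff ℂ l ∘ₗ fiberPolynomial (basePoint n) ∘ₗ A)
  have hL' : ∀ F : symbols (n + 1), L F.1 = (fiberPolynomial (basePoint n) (A F)).coeff l :=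
    fun F => congrArg (fun T => T F) hL
  have key : ∀ F ∈ symbols (n + 1), ∀ (g : Matrix.SpecialLinearGroup (Fin (n + 2)) ℝ) (r : ℝ),
      g • basePoint n = fiberScale r (basePoint n) →
      L (fun z => F (g • z)) = (r : ℂ) ^ l * L F := by
    intro F hF g r hg
    have h1 := hL' (liftedAction (n + 1) g⁻¹ ⟨F, hF⟩)
    rw [mem_commutant_iff.1 hA, fiberPolynomial_liftedAction (r := r) (by rwa [inv_inv]),
      Polynomial.comp_C_mul_X_coeff, ← hL' ⟨F, hF⟩, mul_comm] at h1
    rw [← h1]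
    congr 1
    ext z
    change F (g • z) = F (g⁻¹⁻¹ • z)
    rw [inv_inv]
  refine ⟨L, ⟨fun F hF i b => ?_, fun F hF d hd => ?_⟩, hL'⟩
  · have h1 : shear i b • basePoint n = fiberScale 1 (basePoint n) := by
      rw [shear_smul_basePoint, basePoint_eq, fiberScale_mk]
      simp only [one_smul]
    simpa using key F hF _ _ h1
  · exact key F hF _ _ (torus_smul_basePoint d hd)

/-- The elements of the commutant are scalar on the symbols of degree `k`. -/
theorem exists_eq_smul_of_mem_commutant_succ {A : Module.End ℂ (symbols (n + 1))}
    (hA : A ∈ commutant (n + 1)) (k : ℕ) : ∃ c : ℂ, ∀ F : symbols (n + 1),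
      F.1 ∈ symbolsOfDegree (n + 1) k → A F = c • F := by
  choose L hL hLA using fun l => exists_isBorelEigen hA l
  -- In degree k, the functional with l = k vanishes on the kernel of evaluation at dy_0, hence is a
  -- multiple of that evaluation.
  obtain ⟨c, hc⟩ : ∃ c : ℂ, ∀ F ∈ symbolsOfDegree (n + 1) k, L k F = c * F (basePoint n) := by
    by_cases h : ∃ F₁ ∈ symbolsOfDegree (n + 1) k, F₁ (basePoint n) ≠ 0
    · obtain ⟨F₁, hF₁, hne⟩ := h
      refine ⟨L k F₁ / F₁ (basePoint n), fun F hF => ?_⟩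
      have h1 := (hL k).eq_zero ((symbolsOfDegree (n + 1) k).sub_mem hF
        ((symbolsOfDegree (n + 1) k).smul_mem (F (basePoint n) / F₁ (basePoint n)) hF₁))
        (fun _ => by
          change F (basePoint n) - F (basePoint n) / F₁ (basePoint n) * F₁ (basePoint n) = 0
          rw [div_mul_cancel₀ _ hne, sub_self])
      rw [map_sub, map_smul, smul_eq_mul, sub_eq_zero] at h1
      rw [h1]
      ring
    · push Not at h
      exact ⟨0, fun F hF => by rw [zero_mul]; exact (hL k).eq_zero hF fun _ => h F hF⟩
  refine ⟨c, fun F hF => ?_⟩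
  have key : ∀ F : symbols (n + 1), F.1 ∈ symbolsOfDegree (n + 1) k → ∀ t : ℝ,
      (A F).1 (fiberScale t (basePoint n)) = c * F.1 (fiberScale t (basePoint n)) := by
    intro F hF t
    have h1 : fiberPolynomial (basePoint n) (A F)
        = Polynomial.monomial k (c * F.1 (basePoint n)) := by
      ext l
      rw [← hLA, Polynomial.coeff_monomial]
      split_ifs with hlk
      · subst hlk; exact hc _ hF
      · exact (hL l).eq_zero hF fun h => absurd h.symm hlk
    rw [← eval_fiberPolynomial, h1, Polynomial.eval_monomial, fiberScale_of_homogeneous hF.2]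
    ring
  ext z
  -- Equivariance carries the identity from the line through dy_0 to an arbitrary covector.
  obtain ⟨g, s, rfl⟩ := exists_smul_fiberScale_basePoint z
  have h1 := key (liftedAction (n + 1) g⁻¹ F) ⟨hF.1.comp_smul _, hF.2.comp_smul _⟩ s
  rw [mem_commutant_iff.1 hA] at h1
  change (A F).1 (g⁻¹⁻¹ • _) = c * F.1 (g⁻¹⁻¹ • _) at h1
  rw [inv_inv] at h1
  exact h1

/-- In dimension 0 there is no covector dy_0. The cotangent bundle is a point, the symbols are
constants, and every operator is a scalar. -/
instance : Subsingleton (CotangentRP 0) := by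
  refine ⟨fun z w => ?_⟩
  induction z using CotangentRP.ind with
  | _ x ξ hx h =>
    induction w using CotangentRP.ind with
    | _ x' ξ' hx' h' =>
      have key : ∀ {x ξ : Fin 1 → ℝ}, x ≠ 0 → ξ ⬝ᵥ x = 0 → x 0 ≠ 0 ∧ ξ 0 = 0 := by
        intro x ξ hx h
        have h0 : x 0 ≠ 0 := fun h0 => hx <| funext fun j => by rw [Fin.fin_one_eq_zero j]; exact h0
        rw [dotProduct, Fin.sum_univ_one] at h
        exact ⟨h0, (mul_eq_zero.1 h).resolve_right h0⟩
      obtain ⟨h1, h2⟩ := key hx h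
      obtain ⟨h3, h4⟩ := key hx' h'
      refine Quotient.sound (s := cotangentSetoid 0) ⟨x' 0 / x 0, div_ne_zero h3 h1, ?_, ?_⟩
      · ext j
        rw [Fin.fin_one_eq_zero j]
        exact (div_mul_cancel₀ _ h1).symm
      · ext j
        rw [Fin.fin_one_eq_zero j]
        change ξ' 0 = _ * ξ 0
        rw [h2, h4, mul_zero]

theorem one_mem_symbols (n : ℕ) : (1 : CotangentRP n → ℂ) ∈ symbols n :=
  mem_symbols (k := 0) ⟨fun _ => contDiff_const, fun _ _ =>
    ⟨1, MvPolynomial.isHomogeneous_one _ _, fun _ _ => by simp⟩⟩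

theorem exists_eq_smul_of_subsingleton {n : ℕ} [Subsingleton (CotangentRP n)]
    (z : CotangentRP n) (A : Module.End ℂ (symbols n)) : ∃ c : ℂ, ∀ F : symbols n, A F = c • F := by
  have h : ∀ F : symbols n, F = F.1 z • ⟨1, one_mem_symbols n⟩ := fun F => by
    ext w
    change F.1 w = F.1 z * 1
    rw [mul_one, Subsingleton.elim w z]
  refine ⟨(A ⟨1, one_mem_symbols n⟩).1 z, fun F => ?_⟩
  conv_lhs => rw [h F]
  rw [map_smul, h (A ⟨1, one_mem_symbols n⟩), smul_comm, ← h F]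
  congr 2
  change _ = _ * (1 : ℂ)
  rw [mul_one]

theorem mem_commutant_iff_exists_eq_smul (n : ℕ) (A : Module.End ℂ (symbols n)) :
    A ∈ commutant n ↔ ∃ c : ℕ → ℂ, ∀ (k : ℕ) (F : symbols n),
      F.1 ∈ symbolsOfDegree n k → A F = c k • F := by
  constructor
  · intro hA
    cases n with
    | zero =>
      obtain ⟨c, hc⟩ := exists_eq_smul_of_subsingleton (chart 0 0 0) A
      exact ⟨fun _ => c, fun k F _ => hc F⟩
    | succ n =>
      choose c hc using exists_eq_smul_of_mem_commutant_succ hA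
      exact ⟨c, hc⟩
  · rintro ⟨c, hc⟩
    refine mem_commutant_iff.2 fun g F => ?_
    obtain ⟨F, hF⟩ := F
    induction hF using Submodule.iSup_induction' with
    | mem k F hF =>
      have h1 := hc k ⟨F, mem_symbols hF⟩ hF
      have h2 := hc k (liftedAction n g ⟨F, mem_symbols hF⟩)
        ⟨hF.1.comp_smul g⁻¹, hF.2.comp_smul g⁻¹⟩
      rw [h1, h2, map_smul]
    | zero =>
      change A (liftedAction n g 0) = liftedAction n g (A 0)
      simp only [map_zero]
    | add F G hF hG h1 h2 =>
      change A (liftedAction n g (⟨F, hF⟩ + ⟨G, hG⟩)) = liftedAction n g (A (⟨F, hF⟩ + ⟨G, hG⟩))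
      simp only [map_add, h1, h2]

end ProjSymbols

end Commutant

/-! ### Interpolation by entire series, and series in the Euler operator -/

noncomputable section EulerSeries

/-- A polynomial with given value at `m`, zeros at `0, …, m - 1` and arbitrarily small
coefficients on the disc of radius `m / 2`. -/
theorem exists_polynomial_interpolation_small (m : ℕ) (v : ℂ) : ∃ p : Polynomial ℂ,
    (∀ i < m, p.eval (i : ℂ) = 0) ∧ p.eval (m : ℂ) = v ∧
      (0 < m → ∑' j, ‖p.coeff j‖ * ((m : ℝ) / 2) ^ j ≤ (1 / 2) ^ m) := by
  rcases Nat.eq_zero_or_pos m with rfl | hm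
  · exact ⟨Polynomial.C v, by simp, by simp, by simp⟩
  set w : Polynomial ℂ := ∏ i ∈ Finset.range m, (Polynomial.X - Polynomial.C (i : ℂ)) with hw
  have hw0 : ∀ i < m, w.eval (i : ℂ) = 0 := fun i hi => by
    rw [hw, Polynomial.eval_prod]
    exact Finset.prod_eq_zero (Finset.mem_range.2 hi) (by simp)
  have hwm : w.eval (m : ℂ) ≠ 0 := by
    rw [hw, Polynomial.eval_prod, Finset.prod_ne_zero_iff]
    intro i hi
    have : (m : ℂ) ≠ i := by exact_mod_cast (Finset.mem_range.1 hi).ne'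
    simpa [sub_eq_zero] using this
  have hm0 : (m : ℂ) ≠ 0 := by exact_mod_cast hm.ne'
  set S : ℝ := ∑' j, ‖w.coeff j‖ * ((m : ℝ) / 2) ^ j with hS
  have htend : Filter.Tendsto (fun M : ℕ => ‖v‖ / ‖w.eval (m : ℂ)‖ * S * (1 / 2) ^ M)
      Filter.atTop (nhds 0) := by
    simpa using (tendsto_pow_atTop_nhds_zero_of_lt_one (r := (1 / 2 : ℝ)) (by norm_num)
      (by norm_num)).const_mul (‖v‖ / ‖w.eval (m : ℂ)‖ * S)
  -- The factor (X/m)^M equals 1 at m and has size 2^(-M) at radius m/2, so a large M makes the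
  -- coefficient sum small without affecting the interpolation.
  obtain ⟨M, hM⟩ := (htend.eventually_le_const (show (0 : ℝ) < (1 / 2) ^ m by positivity)).exists
  set b : ℂ := v / (w.eval (m : ℂ) * m ^ M) with hb
  refine ⟨Polynomial.C b * w * Polynomial.X ^ M, fun i hi => by simp [hw0 i hi], ?_, fun _ => ?_⟩
  · simp only [Polynomial.eval_mul, Polynomial.eval_C, Polynomial.eval_pow, Polynomial.eval_X, hb]
    field_simp
  · refine le_of_eq_of_le ?_ hM
    have hinj : Function.Injective (fun j : ℕ => j + M) := add_left_injective M
    rw [← hinj.tsum_eq, hS]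
    · simp only [Polynomial.coeff_mul_X_pow, Polynomial.coeff_C_mul, norm_mul]
      rw [← tsum_mul_left, ← tsum_mul_right]
      refine tsum_congr fun j => ?_
      have : (m : ℝ) ≠ 0 := by exact_mod_cast hm.ne'
      have h2 : ‖w.eval (m : ℂ)‖ ≠ 0 := norm_ne_zero_iff.2 hwm
      simp only [hb, norm_div, norm_mul, norm_pow, Complex.norm_natCast, pow_add, div_pow, one_pow]
      field_simp
    · intro j hj
      rw [Function.mem_support] at hj
      by_contra hlt
      apply hj
      have hlt : j < M := by
        by_contra h
        exact hlt ⟨j - M, by simp only; omega⟩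
      rw [Polynomial.coeff_mul_X_pow', if_neg (by omega)]
      simp

theorem Polynomial.summable_norm_coeff_mul_pow (p : Polynomial ℂ) (x : ℝ) :
    Summable fun j => ‖p.coeff j‖ * x ^ j :=
  summable_of_ne_finset_zero (s := p.support) fun j hj => by
    rw [Polynomial.notMem_support_iff.1 hj, norm_zero, zero_mul]

theorem Polynomial.hasSum_coeff_mul_pow (p : Polynomial ℂ) (x : ℂ) :
    HasSum (fun j => p.coeff j * x ^ j) (p.eval x) := by
  rw [Polynomial.eval_eq_sum, Polynomial.sum_def]
  exact hasSum_sum_of_ne_finset_zero fun j hj => by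
    rw [Polynomial.notMem_support_iff.1 hj, zero_mul]

/-- Polynomials with summable coefficients whose sums interpolate a given sequence. -/
theorem exists_polynomial_sequence (c : ℕ → ℂ) : ∃ p : ℕ → Polynomial ℂ,
    (∀ m, ∀ i < m, (p m).eval (i : ℂ) = 0) ∧
    (∀ k, ∑ m ∈ Finset.range (k + 1), (p m).eval (k : ℂ) = c k) ∧
    (∀ m, 0 < m → ∑' j, ‖(p m).coeff j‖ * ((m : ℝ) / 2) ^ j ≤ (1 / 2) ^ m) := by
  choose s hs0 hsv hsn using exists_polynomial_interpolation_small
  -- The m-th partial sum, as in Newton interpolation: the next polynomial repairs the value at m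
  -- and vanishes at all earlier nodes.
  let q : ℕ → Polynomial ℂ := fun m =>
    Nat.rec 0 (fun m r => r + s m (c m - r.eval (m : ℂ))) m
  have hq : ∀ m, q m = ∑ i ∈ Finset.range m, s i (c i - (q i).eval (i : ℂ)) := by
    intro m
    induction m with
    | zero => rfl
    | succ m ih => rw [Finset.sum_range_succ, ← ih]
  refine ⟨fun m => s m (c m - (q m).eval (m : ℂ)), fun m => hs0 m _, fun k => ?_,
    fun m => hsn m _⟩
  rw [Finset.sum_range_succ, hsv, ← Polynomial.eval_finsetSum, ← hq]
  ring

/-- For fixed r all but finitely many m satisfy r ≤ m/2, and for those the geometric bound applies.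
Hence the double series converges absolutely at every radius. -/
theorem summable_norm_coeff_mul_pow {p : ℕ → Polynomial ℂ}
    (hp : ∀ m, 0 < m → ∑' j, ‖(p m).coeff j‖ * ((m : ℝ) / 2) ^ j ≤ (1 / 2) ^ m)
    {r : ℝ} (hr : 0 ≤ r) : Summable fun x : ℕ × ℕ => ‖(p x.1).coeff x.2‖ * r ^ x.2 := by
  have hnn : ∀ x : ℕ × ℕ, 0 ≤ ‖(p x.1).coeff x.2‖ * r ^ x.2 := fun x =>
    mul_nonneg (norm_nonneg _) (pow_nonneg hr _)
  refine (summable_prod_of_nonneg hnn).2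
    ⟨fun m => Polynomial.summable_norm_coeff_mul_pow (p m) r, ?_⟩
  obtain ⟨N, hN⟩ := exists_nat_gt (2 * r)
  refine Summable.of_norm_bounded_eventually_nat
    (summable_geometric_of_lt_one (r := (1 / 2 : ℝ)) (by norm_num) (by norm_num)) ?_
  filter_upwards [Filter.eventually_gt_atTop N] with m hm
  rw [Real.norm_of_nonneg (tsum_nonneg fun j => hnn (m, j))]
  refine le_trans ?_ (hp m (by omega))
  have hle : r ≤ (m : ℝ) / 2 := by
    have : (N : ℝ) < m := by exact_mod_cast hm
    linarith
  exact (Polynomial.summable_norm_coeff_mul_pow (p m) r).tsum_le_tsum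
    (fun j => mul_le_mul_of_nonneg_left (pow_le_pow_left₀ hr hle j) (norm_nonneg _))
    (Polynomial.summable_norm_coeff_mul_pow (p m) _)

/-- Every sequence of values at the natural numbers is interpolated by an entire power series. -/
theorem exists_powerSeries_hasSum (c : ℕ → ℂ) : ∃ a : PowerSeries ℂ, ∀ k : ℕ,
    HasSum (fun j => PowerSeries.coeff j a * (k : ℂ) ^ j) (c k) := by
  obtain ⟨p, hp0, hpc, hpn⟩ := exists_polynomial_sequence c
  refine ⟨PowerSeries.mk fun j => ∑' m, (p m).coeff j, fun k => ?_⟩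
  have hk : Summable fun x : ℕ × ℕ => (p x.1).coeff x.2 * (k : ℂ) ^ x.2 := by
    refine Summable.of_norm ((summable_norm_coeff_mul_pow hpn (Nat.cast_nonneg k)).congr
      fun x => ?_)
    rw [norm_mul, norm_pow, Complex.norm_natCast]
  have h1 : Summable fun x : ℕ × ℕ => (p x.1).coeff x.2 := by
    refine Summable.of_norm ((summable_norm_coeff_mul_pow hpn zero_le_one).congr fun x => ?_)
    rw [one_pow, mul_one]
  have hsum : ∑' x : ℕ × ℕ, (p x.1).coeff x.2 * (k : ℂ) ^ x.2 = c k := by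
    rw [hk.tsum_prod, ← hpc k]
    simp only [(Polynomial.hasSum_coeff_mul_pow _ _).tsum_eq]
    -- At the node k all polynomials with index greater than k vanish, so the sum over m is the
    -- finite sum that equals c k.
    refine tsum_eq_sum fun m hm => hp0 m k ?_
    rw [Finset.mem_range] at hm
    omega
  have hsum' : HasSum (fun x : ℕ × ℕ => (p x.2).coeff x.1 * (k : ℂ) ^ x.1) (c k) := by
    rw [← hsum]
    exact (Equiv.prodComm ℕ ℕ).hasSum_iff.2 hk.hasSum
  have hfib : ∀ j, HasSum (fun m => (p m).coeff j * (k : ℂ) ^ j)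
      ((∑' m, (p m).coeff j) * (k : ℂ) ^ j) := fun j =>
    ((h1.prod_symm.prod_factor j).hasSum).mul_right ((k : ℂ) ^ j)
  simp only [PowerSeries.coeff_mk]
  exact hsum'.prod_fiberwise hfib

namespace ProjSymbols

theorem euler_pow_of_homogeneous {n k : ℕ} (F : symbols n) (hF : F.1 ∈ symbolsOfDegree n k)
    (j : ℕ) : (euler n ^ j) F = (k : ℂ) ^ j • F := by
  have h1 : euler n F = (k : ℂ) • F := Subtype.ext (eulerFun_of_homogeneous hF.2)
  induction j with
  | zero => simp
  | succ j ih => rw [pow_succ, Module.End.mul_apply, h1, map_smul, ih, smul_smul, pow_succ']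

theorem IsSeriesInEuler.eq_smul {n k : ℕ} {a : PowerSeries ℂ} {A : Module.End ℂ (symbols n)}
    (h : IsSeriesInEuler a A) (F : symbols n) (hF : F.1 ∈ symbolsOfDegree n k) :
    A F = (∑' j, PowerSeries.coeff j a * (k : ℂ) ^ j) • F := by
  ext z
  have h1 := h F z
  simp only [euler_pow_of_homogeneous F hF] at h1
  rw [← h1.tsum_eq]
  change _ = (∑' j, PowerSeries.coeff j a * (k : ℂ) ^ j) * F.1 z
  -- This holds without summability. It is needed because the scalar series is not known to converge
  -- when F z = 0; its default value is then harmless.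
  rw [← tsum_mul_right]
  exact tsum_congr fun j => (mul_assoc _ _ _).symm

theorem isSeriesInEuler_of_hasSum {n : ℕ} {a : PowerSeries ℂ} {A : Module.End ℂ (symbols n)}
    {c : ℕ → ℂ} (ha : ∀ k : ℕ, HasSum (fun j => PowerSeries.coeff j a * (k : ℂ) ^ j) (c k))
    (hc : ∀ (k : ℕ) (F : symbols n), F.1 ∈ symbolsOfDegree n k → A F = c k • F) :
    IsSeriesInEuler a A := by
  rintro ⟨F, hF⟩ z
  induction hF using Submodule.iSup_induction' with
  | mem k F hF =>
    rw [hc k ⟨F, mem_symbols hF⟩ hF]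
    simp only [euler_pow_of_homogeneous ⟨F, mem_symbols hF⟩ hF]
    have := (ha k).mul_right (F z)
    simp only [mul_assoc] at this
    exact this
  | zero =>
    have h0 : ∀ T : Module.End ℂ (symbols n), (T 0).1 z = 0 := fun T => by rw [map_zero]; rfl
    have : HasSum (fun j => PowerSeries.coeff j a * ((euler n ^ j) 0).1 z) ((A 0).1 z) := by
      simp only [h0, mul_zero]
      exact hasSum_zero
    exact this
  | add F G hF hG h1 h2 =>
    have hadd : ∀ T : Module.End ℂ (symbols n),
        (T (⟨F, hF⟩ + ⟨G, hG⟩)).1 z = (T ⟨F, hF⟩).1 z + (T ⟨G, hG⟩).1 z := fun T => by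
      rw [map_add]; rfl
    have := h1.add h2
    simp only [← mul_add, ← hadd] at this
    exact this

end ProjSymbols

end EulerSeries

theorem proposition3p1 (n : ℕ) (A : Module.End ℂ (ProjSymbols.symbols n)) :
    (A ∈ ProjSymbols.commutant n ↔
      ∃ a : PowerSeries ℂ, ProjSymbols.IsSeriesInEuler a A) ∧
    (A ∈ ProjSymbols.commutant n ↔
      ∃ c : ℕ → ℂ, ∀ (k : ℕ) (F : ProjSymbols.symbols n),
        F.1 ∈ ProjSymbols.symbolsOfDegree n k → A F = c k • F) := by
  refine ⟨⟨fun hA => ?_, fun ⟨a, ha⟩ => ?_⟩, ProjSymbols.mem_commutant_iff_exists_eq_smul n A⟩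
  · obtain ⟨c, hc⟩ := (ProjSymbols.mem_commutant_iff_exists_eq_smul n A).1 hA
    obtain ⟨a, ha⟩ := exists_powerSeries_hasSum c
    exact ⟨a, ProjSymbols.isSeriesInEuler_of_hasSum ha hc⟩
  · exact (ProjSymbols.mem_commutant_iff_exists_eq_smul n A).2 ⟨_, fun _ F hF => ha.eq_smul F hF⟩
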